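/- **Setting.** An example $x$ with label set $\mathcal L=\{1,\dots,L\}$ is a graph with a non-empty finite node set $V$, a finite set $E$ of ordered pairs of distinct nodes, node features $\phi(u)\in\mathbb R^p$, edge features $\phi(u,v)\in\mathbb R_{\ge 0}^q$, and a ground truth labeling $y\in\mathcal L^V$, identified with its binary encoding $y_u^k=\delta(y_u=k)$. Let $\mathcal Y=\{0,1\}^{V\times\mathcal L}$ be the set of all binary labelings (no sum-to-one constraint). For $\hat y\in\mathcal Y$ the joint feature map $\Psi(x,\hat y)\in\mathbb R^d$, $d=Lp+L^2q$, has the blocks $\sum_{u}\hat y_u^k\phi(u)$ for $k\in\mathcal L$ and $\sum_{(u,v)\in E}\hat y_u^k\hat y_v^l\phi(u,v)$ for $k,l\in\mathcal L$, and the loss is $\Delta_b(y,\hat y)=\frac{\rho}{2|V|}\sum_{u,k}\delta(y_u^k\ne\hat y_u^k)$. Given are $n\ge1$ examples $(x_i,y_i)$, with graphs $(V_i,E_i)$ and binary labeling sets $\mathcal Y_i$, reals $C,\rho,\varepsilon>0$, and a set $P$ of parameter indices that contains all pairwise weights (the coordinates of the blocks $(k,l)$). **Algorithm 1.** Start with $\mathcal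 W=\varnothing$, $\eta=\infty$, $\xi=0$. While $\eta-\xi>\varepsilon$: (a) let $(w,\xi)$ minimize $\frac12\|w\|^2+C\xi$ subject to $\xi\ge0$, $w_j\ge0$ for $j\in P$, and $\frac1n w^{\top}\sum_i[\Psi(x_i,y_i)-\Psi(x_i,\bar y_i)]\ge\frac1n\sum_i\Delta_b(y_i,\bar y_i)-\xi$ for all $(\bar y_1,\dots,\bar y_n)\in\mathcal W$; (b) for each $i$ let $\bar y_i$ maximize $\Delta_b(y_i,\hat y)+w^{\top}\Psi(x_i,\hat y)$ over $\hat y\in\mathcal Y_i$ (separation oracle); (c) add $(\bar y_1,\dots,\bar y_n)$ to $\mathcal W$ and let $\eta=\frac1n\sum_i\Delta_b(y_i,\bar y_i)-\frac1n w^{\top}\sum_i[\Psi(x_i,y_i)-\Psi(x_i,\bar y_i)]$. Return $w$. **Machine model.** A fixed program on a real random access machine: integer arrays with $+$ and truncated $-$, real arrays with exact $+,-,\times,/$ and $\le$, unit cost per operation, and one instruction that calls an exact solver for quadratic programs of the form (a). A call on a program with $m$ margin constraints and $d$ variables costs $(m+1)(d+1)$ steps plus the solver's own running time, which is an arbitrary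 function of the program. **Theorem 2 (Convergence of the algorithm).** Algorithm 1 terminates in polynomial time, in the following sense. 1. (Iterations.) Whenever the loop condition holds, the minimizer in (a) and the maximizers in (b) exist. If $\|\Psi(x_i,y_i)-\Psi(x_i,\hat y)\|\le R$ for all $i$ and $\hat y\in\mathcal Y_i$, and $\varepsilon\le4R^2C$, then every run, whatever maximizers are chosen, makes at most $$\max\Bigl(0,\Bigl\lceil\log_2\frac{\rho L/2}{4R^2C}\Bigr\rceil\Bigr)+\Bigl\lceil\frac{16R^2C}{\varepsilon}\Bigr\rceil$$ iterations. 2. (Separation oracle.) If $w_j\ge0$ for all $j\in P$, then (b) for example $i$ is the minimization of a submodular binary pairwise energy with nodes $V_i\times\mathcal L$, and it is solved exactly by one program (the same for all inputs) that makes no solver call and takes a number of steps polynomial in $|V_i|+|E_i|+L+p+q$. 3. (Running time.) One program, the same for all inputs and all solvers, executes a complete run of Algorithm 1 and outputs the $w$ returned by that run. Let $F$ be any bound on the absolute values of all features and $N=n+\sum_i(|V_i|+|E_i|)+L+p+q+\lceil C\rceil+\lceil\rho\rceil+\max(0,\lceil F\rceil)+\lceil1/\varepsilon\rceil$. The number of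 iterations is polynomial in $N$. The solver is called exactly once in each iteration, on the program (a) of that iteration with every element of $\mathcal W$ listed once. The total running time is at most a polynomial in $N$ plus the sum of the running times of these solver calls; in particular, if each of these calls takes time at most $B$, the total is at most a polynomial in $N$ times $B+1$. The polynomials depend on nothing. -/

import Mathlib

open scoped BigOperators

noncomputable section

namespace SSVM

/-! ### Binary pairwise energies -/

/-- A binary (two-label) pairwise energy on a graph with node set `V` and edge set `E`. -/
structure BinaryEnergy (V E : Type) where
  src : E → V
  tgt : E → V
  unary : V → Bool → ℝ
  pair : E → Bool → Bool → ℝ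

/-- The energy of a labeling: unary potentials plus pairwise potentials. -/
def BinaryEnergy.energy {V E : Type} [Fintype V] [Fintype E] (U : BinaryEnergy V E)
    (y : V → Bool) : ℝ :=
  (∑ v, U.unary v (y v)) + ∑ e, U.pair e (y (U.src e)) (y (U.tgt e))

/-- Submodularity: `U(0,0) + U(1,1) ≤ U(0,1) + U(1,0)` for every pairwise potential. -/
def BinaryEnergy.Submodular {V E : Type} (U : BinaryEnergy V E) : Prop :=
  ∀ e, U.pair e false false + U.pair e true true ≤ U.pair e false true + U.pair e true false

/-! ### Training data, joint feature map, loss -/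

/-- One labeled example with `L` labels, `p` node features and `q` non-negative edge features.
Edges are ordered pairs of distinct nodes (potentials may be directed), listed without
repetition. -/
structure Example (L p q : ℕ) where
  nV : ℕ
  nE : ℕ
  nV_pos : 0 < nV
  src : Fin nE → Fin nV
  tgt : Fin nE → Fin nV
  no_loop : ∀ e, src e ≠ tgt e
  no_repeat : Function.Injective fun e => (src e, tgt e)
  nodeFeat : Fin nV → Fin p → ℝ
  edgeFeat : Fin nE → Fin q → ℝ
  edgeFeat_nonneg : ∀ e b, 0 ≤ edgeFeat e b
  label : Fin nV → Fin L

/-- Indices of the parameter vector: unary weights (label, node feature) and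
pairwise weights ((label, label), edge feature). -/
abbrev Idx (L p q : ℕ) : Type := (Fin L × Fin p) ⊕ ((Fin L × Fin L) × Fin q)

/-- The number of parameters. -/
def dim (L p q : ℕ) : ℕ := L * p + L * L * q

/-- The linear order in which a parameter vector is stored:
unary weight `(k, a)` at place `a + p * k`,
pairwise weight `((k, l), b)` at place `L * p + (b + q * (l + L * k))`. -/
def idxEquiv (L p q : ℕ) : Idx L p q ≃ Fin (dim L p q) :=
  (Equiv.sumCongr finProdFinEquiv
    ((Equiv.prodCongr finProdFinEquiv (Equiv.refl (Fin q))).trans finProdFinEquiv)).trans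
    finSumFinEquiv

/-- The real number `0` or `1` of a truth value. -/
def ind (b : Bool) : ℝ := if b then 1 else 0

namespace Example

variable {L p q : ℕ}

/-- Binary labelings `(u, k) ↦ y_u^k` of an example, without the sum-up-to-one constraint. -/
abbrev Lab (x : Example L p q) : Type := Fin x.nV × Fin L → Bool

/-- The binary encoding of the ground truth. -/
def truth (x : Example L p q) : x.Lab := fun a => decide (x.label a.1 = a.2)

/-- The joint feature map `Ψ`. -/
def psi (x : Example L p q) (y : x.Lab) : Idx L p q → ℝ
  | Sum.inl (k, a) => ∑ u, ind (y (u, k)) * x.nodeFeat u a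
  | Sum.inr ((k, l), b) => ∑ e, ind (y (x.src e, k)) * ind (y (x.tgt e, l)) * x.edgeFeat e b

/-- The Hamming loss for binary encoding, scaled by `ρ`, against the ground truth. -/
def loss (x : Example L p q) (ρ : ℝ) (y : x.Lab) : ℝ :=
  ρ / (2 * (x.nV : ℝ)) * ∑ u, ∑ k, if x.truth (u, k) ≠ y (u, k) then (1 : ℝ) else 0

/-- The objective of the separation oracle (loss augmented inference). -/
def augScore (x : Example L p q) (ρ : ℝ) (w : Idx L p q → ℝ) (y : x.Lab) : ℝ :=
  x.loss ρ y + ∑ j, w j * x.psi y j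

/-- `y` is a correct answer of the separation oracle. -/
def IsOracle (x : Example L p q) (ρ : ℝ) (w : Idx L p q → ℝ) (y : x.Lab) : Prop :=
  ∀ z : x.Lab, x.augScore ρ w z ≤ x.augScore ρ w y

/-- The energy of the loss augmented multi-class-to-binary transformation: one binary node for
each (node, label), and for each edge and pair of labels the pairwise potential
`U(a, b) = a b U_p(k, l)`, where `U_p(k, l) = - w^{kl} · φ(u, v)`. -/
def binaryEnergy (x : Example L p q) (ρ : ℝ) (w : Idx L p q → ℝ) :
    BinaryEnergy (Fin x.nV × Fin L) (Fin x.nE × (Fin L × Fin L)) where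
  src := fun e => (x.src e.1, e.2.1)
  tgt := fun e => (x.tgt e.1, e.2.2)
  unary := fun v b =>
    ind b * (-∑ a, w (Sum.inl (v.2, a)) * x.nodeFeat v.1 a)
      - ρ / (2 * (x.nV : ℝ)) * (if x.truth v ≠ b then 1 else 0)
  pair := fun e a b => ind a * ind b * (-∑ c, w (Sum.inr (e.2, c)) * x.edgeFeat e.1 c)

/-- Size of an example. -/
def size (x : Example L p q) : ℕ := x.nV + x.nE + L + p + q

end Example

/-- An input of the learning algorithm: a non-empty dataset, the regularization constant `C`,
the loss scale `ρ`, the tolerance `ε`, and the set `P` of parameters constrained to be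
non-negative, which contains the pairwise weights. -/
structure Training where
  n : ℕ
  L : ℕ
  p : ℕ
  q : ℕ
  n_pos : 0 < n
  ex : Fin n → Example L p q
  C : ℝ
  ρ : ℝ
  ε : ℝ
  C_pos : 0 < C
  ρ_pos : 0 < ρ
  ε_pos : 0 < ε
  P : Finset (Idx L p q)
  pairwise_mem : ∀ j, Sum.inr j ∈ P

/-! ### The cutting-plane algorithm -/

namespace Training

/-- Parameter vectors. -/
abbrev Weight (T : Training) : Type := Idx T.L T.p T.q → ℝ

/-- Tuples `(ȳ_1, ..., ȳ_n)` of binary labelings, one for each example. -/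
abbrev Tuple (T : Training) : Type := ∀ i : Fin T.n, (T.ex i).Lab

/-- `(1/n) ∑_i [Ψ(x_i, y_i) - Ψ(x_i, ȳ_i)]`. -/
def featGap (T : Training) (y : T.Tuple) : T.Weight := fun j =>
  1 / (T.n : ℝ) * ∑ i, ((T.ex i).psi (T.ex i).truth j - (T.ex i).psi (y i) j)

/-- `(1/n) ∑_i Δ_b(y_i, ȳ_i)`. -/
def avgLoss (T : Training) (y : T.Tuple) : ℝ :=
  1 / (T.n : ℝ) * ∑ i, (T.ex i).loss T.ρ (y i)

/-- Feasibility in the quadratic program for the working set `W`. -/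
def Feasible (T : Training) (W : Set T.Tuple) (w : T.Weight) (ξ : ℝ) : Prop :=
  0 ≤ ξ ∧ (∀ y ∈ W, T.avgLoss y - ξ ≤ ∑ j, w j * T.featGap y j) ∧ ∀ j ∈ T.P, 0 ≤ w j

/-- `½ ‖w‖² + C ξ`. -/
def objective (T : Training) (w : T.Weight) (ξ : ℝ) : ℝ :=
  1 / 2 * ∑ j, w j ^ 2 + T.C * ξ

/-- `(w, ξ)` is a minimizer of the quadratic program for the working set `W`. -/
def IsArgmin (T : Training) (W : Set T.Tuple) (w : T.Weight) (ξ : ℝ) : Prop :=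
  T.Feasible W w ξ ∧ ∀ w' ξ', T.Feasible W w' ξ' → T.objective w ξ ≤ T.objective w' ξ'

/-- The variables of the algorithm. -/
structure State (T : Training) where
  W : Set T.Tuple
  η : EReal
  ξ : ℝ
  w : T.Weight

/-- The initial values (that of `w` is never used). -/
def init (T : Training) : T.State := ⟨∅, ⊤, 0, fun _ => 0⟩

/-- The loop condition `η - ξ > ε`. -/
def Guard (T : Training) (s : T.State) : Prop := (T.ε : EReal) < s.η - (s.ξ : EReal)

/-- One iteration of the loop: solve the quadratic program for the current working set, call the
separation oracle on every example, enlarge the working set, compute the new violation. -/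
def Step (T : Training) (s s' : T.State) : Prop :=
  T.Guard s ∧ T.IsArgmin s.W s'.w s'.ξ ∧
    ∃ y : T.Tuple, (∀ i, (T.ex i).IsOracle T.ρ s'.w (y i)) ∧
      s'.W = s.W ∪ {y} ∧
      s'.η = ((T.avgLoss y - ∑ j, s'.w j * T.featGap y j : ℝ) : EReal)

/-- `s 0, ..., s K` is the beginning of a run of the algorithm, with `K` iterations of the loop. -/
def IsRun (T : Training) (s : ℕ → T.State) (K : ℕ) : Prop :=
  s 0 = T.init ∧ ∀ k < K, T.Step (s k) (s (k + 1))

/-- Size of the input, the real numbers not counted: the number of examples, nodes, edges,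
labels and features. -/
def size (T : Training) : ℕ :=
  T.n + (∑ i, ((T.ex i).nV + (T.ex i).nE)) + T.L + T.p + T.q

/-- `F` bounds the absolute values of all features. -/
def FeatBound (T : Training) (F : ℝ) : Prop :=
  ∀ i, (∀ u a, |(T.ex i).nodeFeat u a| ≤ F) ∧ ∀ e b, |(T.ex i).edgeFeat e b| ≤ F

end Training

/-! ### Quadratic programs and their solvers -/

/-- The quadratic program `min ½ ‖w‖² + C ξ` over `w ∈ ℝ^d` and `ξ ≥ 0`, subject to `m` margin
constraints `A r ⬝ w ≥ b r - ξ` and to `w j ≥ 0` for the marked coordinates `j`. -/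
structure QP where
  m : ℕ
  d : ℕ
  A : Fin m → Fin d → ℝ
  b : Fin m → ℝ
  C : ℝ
  nonneg : Fin d → Bool

def QP.Feasible (Q : QP) (w : Fin Q.d → ℝ) (ξ : ℝ) : Prop :=
  0 ≤ ξ ∧ (∀ r, Q.b r - ξ ≤ ∑ j, w j * Q.A r j) ∧ ∀ j, Q.nonneg j = true → 0 ≤ w j

def QP.objective (Q : QP) (w : Fin Q.d → ℝ) (ξ : ℝ) : ℝ :=
  1 / 2 * ∑ j, w j ^ 2 + Q.C * ξ

def QP.IsArgmin (Q : QP) (w : Fin Q.d → ℝ) (ξ : ℝ) : Prop :=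
  Q.Feasible w ξ ∧ ∀ w' ξ', Q.Feasible w' ξ' → Q.objective w ξ ≤ Q.objective w' ξ'

/-- An exact solver for these programs, with an arbitrary running time `cost`. -/
structure QPSolver where
  solW : (Q : QP) → Fin Q.d → ℝ
  solXi : QP → ℝ
  exact_sol : ∀ Q : QP, 0 < Q.C → Q.IsArgmin (solW Q) (solXi Q)
  cost : QP → ℕ

/-- The quadratic program of the algorithm for a listed working set. -/
def Training.toQP (T : Training) (l : List T.Tuple) : QP where
  m := l.length
  d := dim T.L T.p T.q
  A := fun r j => T.featGap (l.get r) ((idxEquiv T.L T.p T.q).symm j)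
  b := fun r => T.avgLoss (l.get r)
  C := T.C
  nonneg := fun j => decide ((idxEquiv T.L T.p T.q).symm j ∈ T.P)

/-! ### A real random access machine, programmed in a while language

The memory consists of three-dimensional arrays of natural numbers and of real numbers.
Indices are computed with `+` and truncated `-`; on real numbers there are the four field
operations and comparison, at unit cost and exact. There is no rounding of reals to integers. The
only further instruction is a call of the solver for quadratic programs, which is charged the
solver's own running time. -/

/-- Memory: `nat a i j k` is the cell `(i, j, k)` of the integer array number `a`, and
likewise `real` for the real arrays. -/
structure Mem where
  nat : ℕ → ℕ → ℕ → ℕ → ℕ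
  real : ℕ → ℕ → ℕ → ℕ → ℝ

/-- Integer expressions. -/
inductive NExp where
  | const (n : ℕ)
  | get (a : ℕ) (i j k : NExp)
  | add (e f : NExp)
  | sub (e f : NExp)

def NExp.eval (σ : Mem) : NExp → ℕ
  | .const n => n
  | .get a i j k => σ.nat a (i.eval σ) (j.eval σ) (k.eval σ)
  | .add e f => e.eval σ + f.eval σ
  | .sub e f => e.eval σ - f.eval σ

/-- The number of operations in the evaluation of an expression. -/
def NExp.time : NExp → ℕ
  | .const _ => 1
  | .get _ i j k => 1 + i.time + j.time + k.time
  | .add e f => 1 + e.time + f.time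
  | .sub e f => 1 + e.time + f.time

/-- Real expressions. -/
inductive RExp where
  | cast (e : NExp)
  | get (a : ℕ) (i j k : NExp)
  | add (e f : RExp)
  | sub (e f : RExp)
  | mul (e f : RExp)
  | div (e f : RExp)

def RExp.eval (σ : Mem) : RExp → ℝ
  | .cast e => (e.eval σ : ℝ)
  | .get a i j k => σ.real a (i.eval σ) (j.eval σ) (k.eval σ)
  | .add e f => e.eval σ + f.eval σ
  | .sub e f => e.eval σ - f.eval σ
  | .mul e f => e.eval σ * f.eval σ
  | .div e f => e.eval σ / f.eval σ

def RExp.time : RExp → ℕ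
  | .cast e => 1 + e.time
  | .get _ i j k => 1 + i.time + j.time + k.time
  | .add e f => 1 + e.time + f.time
  | .sub e f => 1 + e.time + f.time
  | .mul e f => 1 + e.time + f.time
  | .div e f => 1 + e.time + f.time

/-- Tests. -/
inductive Test where
  | natLE (e f : NExp)
  | realLE (e f : RExp)

def Test.holds (σ : Mem) : Test → Prop
  | .natLE e f => e.eval σ ≤ f.eval σ
  | .realLE e f => e.eval σ ≤ f.eval σ

def Test.time : Test → ℕ
  | .natLE e f => 1 + e.time + f.time
  | .realLE e f => 1 + e.time + f.time

/-- Programs. `branch b c d` runs `c` if `b` holds and `d` otherwise; `loop b c` repeats `c` as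
long as `b` holds; `solveQP` calls the solver. -/
inductive Prog where
  | skip
  | setNat (a : ℕ) (i j k : NExp) (e : NExp)
  | setReal (a : ℕ) (i j k : NExp) (e : RExp)
  | seq (c d : Prog)
  | branch (b : Test) (c d : Prog)
  | loop (b : Test) (c : Prog)
  | solveQP

def Mem.writeNat (σ : Mem) (a i j k v : ℕ) : Mem where
  nat := fun a' i' j' k' =>
    if a' = a ∧ i' = i ∧ j' = j ∧ k' = k then v else σ.nat a' i' j' k'
  real := σ.real

def Mem.writeReal (σ : Mem) (a i j k : ℕ) (v : ℝ) : Mem where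
  nat := σ.nat
  real := fun a' i' j' k' =>
    if a' = a ∧ i' = i ∧ j' = j ∧ k' = k then v else σ.real a' i' j' k'

/-- The quadratic program passed to the solver: `m` and `d` are in the integer arrays 7 and 8, the
marks of the non-negative coordinates in the integer array 6, `C` in the real array 0, and
`A`, `b` in the real arrays 5 and 6. -/
def Mem.readQP (σ : Mem) : QP where
  m := σ.nat 7 0 0 0
  d := σ.nat 8 0 0 0
  A := fun r j => σ.real 5 r j 0
  b := fun r => σ.real 6 r 0 0
  C := σ.real 0 0 0 0
  nonneg := fun j => decide (σ.nat 6 j 0 0 = 1)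

/-- The solver writes `w` into the real array 3 and `ξ` into the real array 4. -/
def Mem.writeSol (σ : Mem) {d : ℕ} (w : Fin d → ℝ) (ξ : ℝ) : Mem where
  nat := σ.nat
  real := fun a i j k =>
    if h : a = 3 ∧ i < d ∧ j = 0 ∧ k = 0 then w ⟨i, h.2.1⟩
    else if a = 4 ∧ i = 0 ∧ j = 0 ∧ k = 0 then ξ
    else σ.real a i j k

/-- `Exec S c σ σ' t qs`: with the solver `S`, the program `c` started in the memory `σ` halts in
the memory `σ'` after `t` steps, solver time included, and `qs` is the list of the quadratic
programs on which the solver was called. Programs are deterministic: `S`, `c` and `σ` determine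
`σ'`, `t` and `qs`. -/
inductive Exec (S : QPSolver) : Prog → Mem → Mem → ℕ → List QP → Prop
  | skip (σ : Mem) : Exec S .skip σ σ 1 []
  | setNat (σ : Mem) (a : ℕ) (i j k e : NExp) :
      Exec S (.setNat a i j k e) σ
        (σ.writeNat a (i.eval σ) (j.eval σ) (k.eval σ) (e.eval σ))
        (1 + i.time + j.time + k.time + e.time) []
  | setReal (σ : Mem) (a : ℕ) (i j k : NExp) (e : RExp) :
      Exec S (.setReal a i j k e) σ
        (σ.writeReal a (i.eval σ) (j.eval σ) (k.eval σ) (e.eval σ))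
        (1 + i.time + j.time + k.time + e.time) []
  | seq {c d : Prog} {σ₁ σ₂ σ₃ : Mem} {t u : ℕ} {qs rs : List QP} :
      Exec S c σ₁ σ₂ t qs → Exec S d σ₂ σ₃ u rs →
      Exec S (.seq c d) σ₁ σ₃ (1 + t + u) (qs ++ rs)
  | branch_true {b : Test} {c d : Prog} {σ σ' : Mem} {t : ℕ} {qs : List QP} :
      b.holds σ → Exec S c σ σ' t qs → Exec S (.branch b c d) σ σ' (1 + b.time + t) qs
  | branch_false {b : Test} {c d : Prog} {σ σ' : Mem} {t : ℕ} {qs : List QP} :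
      ¬ b.holds σ → Exec S d σ σ' t qs → Exec S (.branch b c d) σ σ' (1 + b.time + t) qs
  | loop_true {b : Test} {c : Prog} {σ₁ σ₂ σ₃ : Mem} {t u : ℕ} {qs rs : List QP} :
      b.holds σ₁ → Exec S c σ₁ σ₂ t qs → Exec S (.loop b c) σ₂ σ₃ u rs →
      Exec S (.loop b c) σ₁ σ₃ (1 + b.time + t + u) (qs ++ rs)
  | loop_false {b : Test} {c : Prog} {σ : Mem} :
      ¬ b.holds σ → Exec S (.loop b c) σ σ (1 + b.time) []
  | solveQP (σ : Mem) :
      Exec S .solveQP σ (σ.writeSol (S.solW σ.readQP) (S.solXi σ.readQP))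
        ((σ.readQP.m + 1) * (σ.readQP.d + 1) + S.cost σ.readQP) [σ.readQP]

/-- The input is stored in the memory: the integer arrays 0 to 6 hold the counts, the graphs, the
ground truth and the marks of `P`; the real arrays 0 to 2 hold `C`, `ρ`, `ε` and the features. All
other cells are arbitrary. -/
structure Training.Encoded (T : Training) (σ : Mem) : Prop where
  n : σ.nat 0 0 0 0 = T.n
  L : σ.nat 0 1 0 0 = T.L
  p : σ.nat 0 2 0 0 = T.p
  q : σ.nat 0 3 0 0 = T.q
  nV : ∀ i : Fin T.n, σ.nat 1 i 0 0 = (T.ex i).nV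
  nE : ∀ i : Fin T.n, σ.nat 2 i 0 0 = (T.ex i).nE
  src : ∀ (i : Fin T.n) (e : Fin (T.ex i).nE), σ.nat 3 i e 0 = (T.ex i).src e
  tgt : ∀ (i : Fin T.n) (e : Fin (T.ex i).nE), σ.nat 4 i e 0 = (T.ex i).tgt e
  label : ∀ (i : Fin T.n) (u : Fin (T.ex i).nV), σ.nat 5 i u 0 = (T.ex i).label u
  marks : ∀ j : Idx T.L T.p T.q,
    σ.nat 6 (idxEquiv T.L T.p T.q j) 0 0 = if j ∈ T.P then 1 else 0
  C : σ.real 0 0 0 0 = T.C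
  ρ : σ.real 0 1 0 0 = T.ρ
  ε : σ.real 0 2 0 0 = T.ε
  nodeFeat : ∀ (i : Fin T.n) (u : Fin (T.ex i).nV) (a : Fin T.p),
    σ.real 1 i u a = (T.ex i).nodeFeat u a
  edgeFeat : ∀ (i : Fin T.n) (e : Fin (T.ex i).nE) (b : Fin T.q),
    σ.real 2 i e b = (T.ex i).edgeFeat e b

/-- The real array 3 holds the parameter vector `w`. -/
def Training.HoldsWeight (T : Training) (σ : Mem) (w : T.Weight) : Prop :=
  ∀ j, σ.real 3 (idxEquiv T.L T.p T.q j) 0 0 = w j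

end SSVM

end

/-! Three arguments are combined: a convergence proof for cutting planes, a reduction of the oracle
to a minimum cut, and a small verified compiler that turns both into machine programs with
polynomial running time.

Iterations. Let e_k be the amount by which the optimal value in iteration k falls short of the
optimum over all tuples. If the constraint found in iteration k is violated by v, then adding it
raises the optimal value by at least μCv - 2μ²R²C² for every μ in [0, 1] (`IsArgmin.growth`). This
is the line search of dual ascent, carried out in primal terms: it uses only the first-order
condition `IsArgmin.variational`, the bound ‖w‖ ≤ CR of `IsArgmin.sum_sq_le`, and the new
constraint. Because the oracle returns a most violated constraint, the current weights with slack ξ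
+ v are feasible for all tuples (`feasible_of_oracle`), so Cv ≥ e_k; and Cv > Cε as long as the loop
goes on. `steps_le` solves the resulting recursion: one step brings the gap below 4R²C², then it
decays like 1/k down to Cε, then it loses a constant amount in each step. Minimizers exist by
compactness of sublevel sets.

Oracle. Up to a constant, the score of a labeling is a sum of node gains plus products y_x y_y with
nonnegative coefficients. Writing y_x y_y = y_x - y_x (1 - y_y) turns it into "excess inside a set
minus capacity leaving it" (`Flow.value_add`). Push-relabel maximizes this quantity, with the nodes
of negative excess in the role of sinks: a move changes the value of no set (`Flow.value_move`),
polynomially many passes leave no active node (`Flow.no_active`), and then the nodes above an empty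
level form an optimal set (`Flow.value_le_of_gap`).

Programs. Everything except the main loop is written as a `BProg`, whose loops run up to a global
bound. Such programs have a total semantics, a computable list of written arrays (`frame_run`) and a
running time polynomial in the bound (`exec_compile`, `timeBound_poly`). The machine cannot multiply
integers, so addresses are read off a multiplication table built beforehand. `Synced` relates the
memory to the abstract state; `Synced.step` matches one machine round with one iteration, and
`Synced.loop` obtains termination from the iteration bound. For the polynomial bound,
`iterations_le_poly` feeds the iteration theorem a radius computed from the bound on the features.
-/

namespace SSVM

/-! ### Bounded programs -/

/-- The scalar variable stored in the cell `(0, 0, 0)` of an integer array. -/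
abbrev NExp.var (a : ℕ) : NExp := .get a (.const 0) (.const 0) (.const 0)

/-- The scalar variable stored in the cell `(0, 0, 0)` of a real array. -/
abbrev RExp.var (a : ℕ) : RExp := .get a (.const 0) (.const 0) (.const 0)

/-- Programs whose loops are all of the form "for `v` from `0` to the value of the integer
variable 11". -/
inductive BProg where
  | skip
  | setNat (a : ℕ) (i j k : NExp) (e : NExp)
  | setReal (a : ℕ) (i j k : NExp) (e : RExp)
  | seq (c d : BProg)
  | branch (b : Test) (c d : BProg)
  | upto (v : ℕ) (c : BProg)

namespace BProg

/-- The translation into the machine language. -/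
def compile : BProg → Prog
  | skip => .skip
  | setNat a i j k e => .setNat a i j k e
  | setReal a i j k e => .setReal a i j k e
  | seq c d => .seq c.compile d.compile
  | branch b c d => .branch b c.compile d.compile
  | upto v c =>
      .seq (.setNat v (.const 0) (.const 0) (.const 0) (.const 0))
        (.loop (.natLE (.add (.var v) (.const 1)) (.var 11))
          (.seq c.compile
            (.setNat v (.const 0) (.const 0) (.const 0) (.add (.var v) (.const 1)))))

/-- The integer arrays that a program may write. -/
def natWrites : BProg → List ℕ
  | skip => []
  | setNat a _ _ _ _ => [a]
  | setReal _ _ _ _ _ => []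
  | seq c d => c.natWrites ++ d.natWrites
  | branch _ c d => c.natWrites ++ d.natWrites
  | upto v c => v :: c.natWrites

/-- The real arrays that a program may write. -/
def realWrites : BProg → List ℕ
  | skip => []
  | setNat _ _ _ _ _ => []
  | setReal a _ _ _ _ => [a]
  | seq c d => c.realWrites ++ d.realWrites
  | branch _ c d => c.realWrites ++ d.realWrites
  | upto _ c => c.realWrites

/-- No loop body modifies its loop variable or the loop bound. -/
def ok : BProg → Bool
  | skip => true
  | setNat _ _ _ _ _ => true
  | setReal _ _ _ _ _ => true
  | seq c d => c.ok && d.ok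
  | branch _ c d => c.ok && d.ok
  | upto v c => c.ok && (!(v :: c.natWrites).contains 11) && (!c.natWrites.contains v)

open Classical in
/-- The memory after the execution of a bounded program. -/
noncomputable def run : BProg → Mem → Mem
  | skip, σ => σ
  | setNat a i j k e, σ => σ.writeNat a (i.eval σ) (j.eval σ) (k.eval σ) (e.eval σ)
  | setReal a i j k e, σ => σ.writeReal a (i.eval σ) (j.eval σ) (k.eval σ) (e.eval σ)
  | seq c d, σ => d.run (c.run σ)
  | branch b c d, σ => if b.holds σ then c.run σ else d.run σ
  | upto v c, σ =>
      (fun τ => (c.run τ).writeNat v 0 0 0 ((c.run τ).nat v 0 0 0 + 1))^[σ.nat 11 0 0 0]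
        (σ.writeNat v 0 0 0 0)

/-- A bound on the running time if the loop bound is `B`. -/
def timeBound (B : ℕ) : BProg → ℕ
  | skip => 1
  | setNat _ i j k e => 1 + i.time + j.time + k.time + e.time
  | setReal _ i j k e => 1 + i.time + j.time + k.time + e.time
  | seq c d => 1 + c.timeBound B + d.timeBound B
  | branch b c d => 1 + b.time + (c.timeBound B + d.timeBound B)
  | upto _ c => 20 + B * (30 + c.timeBound B)

/-- `τ` arises from `σ` by changing only arrays that `c` may write. -/
structure Frame (c : BProg) (σ τ : Mem) : Prop where
  nat : ∀ a, a ∉ c.natWrites → τ.nat a = σ.nat a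
  real : ∀ a, a ∉ c.realWrites → τ.real a = σ.real a

end BProg

/-! ### Memory updates, and the correctness and running time of compiled programs -/

@[simp] theorem Mem.writeNat_real (σ : Mem) (a i j k v : ℕ) :
    (σ.writeNat a i j k v).real = σ.real := rfl

@[simp] theorem Mem.writeReal_nat (σ : Mem) (a i j k : ℕ) (v : ℝ) :
    (σ.writeReal a i j k v).nat = σ.nat := rfl

theorem Mem.writeNat_nat_of_ne (σ : Mem) {a b : ℕ} (h : b ≠ a) (i j k v : ℕ) :
    (σ.writeNat a i j k v).nat b = σ.nat b := by
  funext i' j' k'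
  simp [Mem.writeNat, h]

theorem Mem.writeReal_real_of_ne (σ : Mem) {a b : ℕ} (h : b ≠ a) (i j k : ℕ) (v : ℝ) :
    (σ.writeReal a i j k v).real b = σ.real b := by
  funext i' j' k'
  simp [Mem.writeReal, h]

theorem Mem.writeNat_nat_self (σ : Mem) (a i j k v i' j' k' : ℕ) :
    (σ.writeNat a i j k v).nat a i' j' k' =
      if i' = i ∧ j' = j ∧ k' = k then v else σ.nat a i' j' k' := by
  simp [Mem.writeNat]

theorem Mem.writeReal_real_self (σ : Mem) (a i j k : ℕ) (v : ℝ) (i' j' k' : ℕ) :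
    (σ.writeReal a i j k v).real a i' j' k' =
      if i' = i ∧ j' = j ∧ k' = k then v else σ.real a i' j' k' := by
  simp [Mem.writeReal]

namespace BProg

@[simp] theorem run_skip (σ : Mem) : skip.run σ = σ := rfl

@[simp] theorem run_seq (c d : BProg) (σ : Mem) : (seq c d).run σ = d.run (c.run σ) := rfl

@[simp] theorem run_setNat (a : ℕ) (i j k e : NExp) (σ : Mem) :
    (setNat a i j k e).run σ =
      σ.writeNat a (i.eval σ) (j.eval σ) (k.eval σ) (e.eval σ) := rfl

@[simp] theorem run_setReal (a : ℕ) (i j k : NExp) (e : RExp) (σ : Mem) :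
    (setReal a i j k e).run σ =
      σ.writeReal a (i.eval σ) (j.eval σ) (k.eval σ) (e.eval σ) := rfl

@[simp] theorem run_branch_natLE (e f : NExp) (c d : BProg) (σ : Mem) :
    (branch (.natLE e f) c d).run σ = if e.eval σ ≤ f.eval σ then c.run σ else d.run σ := by
  simp only [run]
  by_cases h : e.eval σ ≤ f.eval σ
  · rw [if_pos h, if_pos (show (Test.natLE e f).holds σ from h)]
  · rw [if_neg h, if_neg (show ¬ (Test.natLE e f).holds σ from h)]

theorem run_branch_pos {b : Test} {c d : BProg} {σ : Mem} (h : b.holds σ) :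
    (branch b c d).run σ = c.run σ := if_pos h

theorem run_branch_neg {b : Test} {c d : BProg} {σ : Mem} (h : ¬ b.holds σ) :
    (branch b c d).run σ = d.run σ := if_neg h

theorem Frame.refl (c : BProg) (σ : Mem) : Frame c σ σ := ⟨fun _ _ => rfl, fun _ _ => rfl⟩

theorem Frame.trans {c : BProg} {σ τ υ : Mem} (h : Frame c σ τ) (h' : Frame c τ υ) :
    Frame c σ υ :=
  ⟨fun a ha => (h'.nat a ha).trans (h.nat a ha), fun a ha => (h'.real a ha).trans (h.real a ha)⟩

theorem Frame.mono {c d : BProg} {σ τ : Mem} (h : Frame c σ τ)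
    (hn : c.natWrites ⊆ d.natWrites) (hr : c.realWrites ⊆ d.realWrites) : Frame d σ τ :=
  ⟨fun a ha => h.nat a fun h' => ha (hn h'), fun a ha => h.real a fun h' => ha (hr h')⟩

/-- An array outside the two lists is never the target of a write. Since these lists are computable,
later claims that an array keeps its contents reduce to `decide`. -/
theorem frame_run (c : BProg) (σ : Mem) : Frame c σ (c.run σ) := by
  induction c generalizing σ with
  | skip => exact Frame.refl _ _
  | setNat a i j k e =>
    refine ⟨fun b hb => ?_, fun b _ => rfl⟩
    simp only [natWrites, List.mem_singleton] at hb
    exact Mem.writeNat_nat_of_ne _ hb _ _ _ _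
  | setReal a i j k e =>
    refine ⟨fun b _ => rfl, fun b hb => ?_⟩
    simp only [realWrites, List.mem_singleton] at hb
    exact Mem.writeReal_real_of_ne _ hb _ _ _ _
  | seq c d hc hd =>
    exact ((hc σ).mono (by simp [natWrites]) (by simp [realWrites])).trans
      ((hd _).mono (by simp [natWrites]) (by simp [realWrites]))
  | branch b c d hc hd =>
    simp only [run]
    split_ifs
    · exact (hc σ).mono (by simp [natWrites]) (by simp [realWrites])
    · exact (hd σ).mono (by simp [natWrites]) (by simp [realWrites])
  | upto v c hc =>
    have hw : ∀ (τ : Mem) (x : ℕ), Frame (upto v c) τ (τ.writeNat v 0 0 0 x) := fun τ x => by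
      refine ⟨fun b hb => ?_, fun b _ => rfl⟩
      simp only [natWrites, List.mem_cons, not_or] at hb
      exact Mem.writeNat_nat_of_ne _ hb.1 _ _ _ _
    have hs : ∀ (n : ℕ) (τ : Mem), Frame (upto v c) τ
        ((fun τ => (c.run τ).writeNat v 0 0 0 ((c.run τ).nat v 0 0 0 + 1))^[n] τ) := by
      intro n
      induction n with
      | zero => exact fun τ => Frame.refl _ _
      | succ n ih =>
        intro τ
        rw [Function.iterate_succ_apply]
        refine Frame.trans ?_ (ih _)
        exact ((hc τ).mono (by simp [natWrites]) (by simp [realWrites])).trans (hw _ _)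
    exact (hw σ 0).trans (hs _ _)

theorem ok_upto {v : ℕ} {c : BProg} (h : (upto v c).ok = true) :
    c.ok = true ∧ v ≠ 11 ∧ 11 ∉ c.natWrites ∧ v ∉ c.natWrites := by
  simp only [ok, Bool.and_eq_true, Bool.not_eq_true', List.contains_eq_mem,
    decide_eq_false_iff_not, List.mem_cons, not_or] at h
  exact ⟨h.1.1, fun e => h.1.2.1 e.symm, h.1.2.2, h.2⟩

theorem frame_bound {c : BProg} {σ τ : Mem} (h : Frame c σ τ) (hc : 11 ∉ c.natWrites) :
    τ.nat 11 0 0 0 = σ.nat 11 0 0 0 := by rw [h.nat 11 hc]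

/-- The time bound holds if the program does not modify the loop bound outside its loops either. -/
theorem exec_compile (S : QPSolver) {c : BProg} (h : c.ok = true) (h11 : 11 ∉ c.natWrites)
    (σ : Mem) : ∃ t, Exec S c.compile σ (c.run σ) t [] ∧ t ≤ c.timeBound (σ.nat 11 0 0 0) := by
  induction c generalizing σ with
  | skip => exact ⟨1, Exec.skip σ, le_rfl⟩
  | setNat a i j k e => exact ⟨_, Exec.setNat σ a i j k e, le_rfl⟩
  | setReal a i j k e => exact ⟨_, Exec.setReal σ a i j k e, le_rfl⟩
  | seq c d hc hd =>
    simp only [ok, Bool.and_eq_true] at h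
    simp only [natWrites, List.mem_append, not_or] at h11
    obtain ⟨t, ht, ht'⟩ := hc h.1 h11.1 σ
    obtain ⟨u, hu, hu'⟩ := hd h.2 h11.2 (c.run σ)
    rw [frame_bound (frame_run c σ) h11.1] at hu'
    refine ⟨_, Exec.seq ht hu, ?_⟩
    simp only [timeBound]
    omega
  | branch b c d hc hd =>
    simp only [ok, Bool.and_eq_true] at h
    simp only [natWrites, List.mem_append, not_or] at h11
    by_cases hb : b.holds σ
    · obtain ⟨t, ht, ht'⟩ := hc h.1 h11.1 σ
      refine ⟨_, by
        simpa only [run, compile, if_pos hb] using Exec.branch_true (d := d.compile) hb ht, ?_⟩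
      simp only [timeBound]
      omega
    · obtain ⟨t, ht, ht'⟩ := hd h.2 h11.2 σ
      refine ⟨_, by
        simpa only [run, compile, if_neg hb] using Exec.branch_false (c := c.compile) hb ht, ?_⟩
      simp only [timeBound]
      omega
  | upto v c hc =>
    obtain ⟨hok, hv, hc11, hcv⟩ := ok_upto h
    set B := σ.nat 11 0 0 0 with hB
    set step : Mem → Mem :=
      fun τ => (c.run τ).writeNat v 0 0 0 ((c.run τ).nat v 0 0 0 + 1) with hstep
    -- Induction on the number of rounds still to come: loop variable plus remaining rounds equals
    -- the bound. The body touches neither the variable nor the bound, so the machine loop and the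
    -- iterate in `run` stop together.
    have key : ∀ (m : ℕ) (τ : Mem), τ.nat 11 0 0 0 = B → τ.nat v 0 0 0 + m = B →
        ∃ t, Exec S (.loop (.natLE (.add (.var v) (.const 1)) (.var 11))
          (.seq c.compile (.setNat v (.const 0) (.const 0) (.const 0)
            (.add (.var v) (.const 1))))) τ (step^[m] τ) t [] ∧
          t ≤ 14 + m * (30 + c.timeBound B) := by
      intro m
      induction m with
      | zero =>
        intro τ h1 h2
        refine ⟨_, Exec.loop_false ?_, ?_⟩
        · simp only [Test.holds, NExp.eval]
          omega
        · simp [Test.time, NExp.time]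
      | succ m ih =>
        intro τ h1 h2
        obtain ⟨t, ht, ht'⟩ := hc hok hc11 τ
        have e1 : (step τ).nat 11 0 0 0 = B := by
          rw [hstep]
          simp only [Mem.writeNat_nat_of_ne _ hv.symm]
          rw [frame_bound (frame_run c τ) hc11, h1]
        have e2 : (step τ).nat v 0 0 0 + m = B := by
          have : (c.run τ).nat v = τ.nat v := (frame_run c τ).nat v hcv
          rw [hstep]
          simp only [Mem.writeNat_nat_self, and_self, if_true, this]
          omega
        obtain ⟨u, hu, hu'⟩ := ih (step τ) e1 e2
        have hset := Exec.setNat (S := S) (c.run τ) v (.const 0) (.const 0) (.const 0)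
          (.add (.var v) (.const 1))
        have hlt : (Test.natLE (.add (.var v) (.const 1)) (.var 11)).holds τ := by
          simp only [Test.holds, NExp.eval]
          omega
        rw [Function.iterate_succ_apply]
        refine ⟨_, Exec.loop_true hlt (Exec.seq ht hset) hu, ?_⟩
        simp only [Test.time, NExp.time]
        rw [h1] at ht'
        rw [Nat.succ_mul]
        omega
    have hset := Exec.setNat (S := S) σ v (.const 0) (.const 0) (.const 0) (.const 0)
    obtain ⟨t, ht, ht'⟩ := key B (σ.writeNat v 0 0 0 0)
      (by simp only [Mem.writeNat_nat_of_ne _ hv.symm]; rfl) (by simp [Mem.writeNat_nat_self])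
    refine ⟨_, Exec.seq hset ht, ?_⟩
    simp only [NExp.time, timeBound]
    omega

/-- Each loop multiplies the time of its body by the bound, so the nesting depth governs the degree.
One number serves as factor and exponent, so that bounds of subprograms merge by monotonicity. -/
theorem timeBound_poly (c : BProg) : ∃ k, ∀ B, c.timeBound B ≤ k * (B + 2) ^ k := by
  have mono : ∀ {k l B : ℕ}, k ≤ l → k * (B + 2) ^ k ≤ l * (B + 2) ^ l := fun h =>
    Nat.mul_le_mul h (Nat.pow_le_pow_right (by omega) h)
  have const : ∀ k B : ℕ, k ≤ k * (B + 2) ^ k := fun k B =>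
    Nat.le_mul_of_pos_right _ (Nat.pow_pos (by omega))
  induction c with
  | skip => exact ⟨1, fun B => const 1 B⟩
  | setNat a i j k e => exact ⟨_, fun B => const _ B⟩
  | setReal a i j k e => exact ⟨_, fun B => const _ B⟩
  | seq c d hc hd =>
    obtain ⟨k, hk⟩ := hc
    obtain ⟨l, hl⟩ := hd
    refine ⟨1 + k + l, fun B => ?_⟩
    have h0 : 1 ≤ (B + 2) ^ (1 + k + l) := Nat.one_le_pow _ _ (by omega)
    have h1 : (B + 2) ^ k ≤ (B + 2) ^ (1 + k + l) := Nat.pow_le_pow_right (by omega) (by omega)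
    have h2 : (B + 2) ^ l ≤ (B + 2) ^ (1 + k + l) := Nat.pow_le_pow_right (by omega) (by omega)
    have h3 := Nat.mul_le_mul_left k h1
    have h4 := Nat.mul_le_mul_left l h2
    have h5 := hk B
    have h6 := hl B
    simp only [timeBound, add_mul]
    omega
  | branch b c d hc hd =>
    obtain ⟨k, hk⟩ := hc
    obtain ⟨l, hl⟩ := hd
    refine ⟨(1 + b.time) + k + l, fun B => ?_⟩
    set m := (1 + b.time) + k + l
    have h0 : 1 ≤ (B + 2) ^ m := Nat.one_le_pow _ _ (by omega)
    have h1 : (B + 2) ^ k ≤ (B + 2) ^ m := Nat.pow_le_pow_right (by omega) (by omega)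
    have h2 : (B + 2) ^ l ≤ (B + 2) ^ m := Nat.pow_le_pow_right (by omega) (by omega)
    have h3 := Nat.mul_le_mul_left k h1
    have h4 := Nat.mul_le_mul_left l h2
    have h7 := Nat.mul_le_mul_left (1 + b.time) h0
    have h5 := hk B
    have h6 := hl B
    have : m * (B + 2) ^ m = (1 + b.time) * (B + 2) ^ m + k * (B + 2) ^ m + l * (B + 2) ^ m := by
      rw [← add_mul, ← add_mul]
    simp only [timeBound]
    omega
  | upto v c hc =>
    obtain ⟨k, hk⟩ := hc
    refine ⟨k + 50, fun B => ?_⟩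
    have h0 : 1 ≤ (B + 2) ^ k := Nat.one_le_pow _ _ (by omega)
    have h1 : (B + 2) ^ (k + 1) ≤ (B + 2) ^ (k + 50) :=
      Nat.pow_le_pow_right (by omega) (by omega)
    have h2 := hk B
    simp only [timeBound]
    calc 20 + B * (30 + c.timeBound B)
        ≤ 20 * (B + 2) ^ k + B * ((30 + k) * (B + 2) ^ k) := by
          have : 30 + c.timeBound B ≤ (30 + k) * (B + 2) ^ k := by nlinarith
          have := Nat.mul_le_mul_left B this
          omega
      _ ≤ (k + 50) * (B + 2) ^ (k + 1) := by
          rw [pow_succ]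
          nlinarith [Nat.zero_le (B * (B + 2) ^ k), Nat.zero_le (k * (B + 2) ^ k),
            Nat.zero_le (k * B * (B + 2) ^ k)]
      _ ≤ _ := Nat.mul_le_mul_left _ h1

/-! ### Loops with a computed bound -/

/-- `for v < e do c`, provided that `e` is at most the loop bound. -/
def forLT (v : ℕ) (e : NExp) (c : BProg) : BProg :=
  upto v (branch (.natLE (.add (.var v) (.const 1)) e) c skip)

/-- The loop makes as many rounds as the global bound says, and the rounds beyond `n` idle; hence
the induction carries `I (min m n)`. The loop variable ends at the global bound, not at `n`, so the
invariant has to tolerate writes to it. -/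
theorem run_forLT {v : ℕ} {e : NExp} {c : BProg} {σ : Mem} (hok : (forLT v e c).ok = true)
    (n : ℕ) (hn : n ≤ σ.nat 11 0 0 0) (he : ∀ τ, Frame (forLT v e c) σ τ → e.eval τ = n)
    (I : ℕ → Mem → Prop) (hv : ∀ i τ x, I i τ → I i (τ.writeNat v 0 0 0 x)) (h0 : I 0 σ)
    (hs : ∀ i < n, ∀ τ, τ.nat v 0 0 0 = i → Frame (forLT v e c) σ τ → I i τ →
      I (i + 1) (c.run τ)) :
    I n ((forLT v e c).run σ) := by
  obtain ⟨-, hv11, hc11, hcv⟩ := ok_upto hok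
  have hw : ∀ (τ : Mem) (x : ℕ), Frame (forLT v e c) τ (τ.writeNat v 0 0 0 x) := fun τ x => by
    refine ⟨fun b hb => ?_, fun b _ => rfl⟩
    simp only [forLT, natWrites, List.mem_cons, not_or] at hb
    exact Mem.writeNat_nat_of_ne _ hb.1 _ _ _ _
  set d : BProg := branch (.natLE (.add (.var v) (.const 1)) e) c skip with hd
  have key : ∀ m ≤ σ.nat 11 0 0 0, ∀ τ,
      τ = (fun τ => (d.run τ).writeNat v 0 0 0 ((d.run τ).nat v 0 0 0 + 1))^[m]
        (σ.writeNat v 0 0 0 0) →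
      τ.nat v 0 0 0 = m ∧ Frame (forLT v e c) σ τ ∧ I (min m n) τ := by
    intro m
    induction m with
    | zero =>
      rintro - τ rfl
      refine ⟨by simp [Mem.writeNat_nat_self], hw σ 0, ?_⟩
      simpa using hv 0 σ 0 h0
    | succ m ih =>
      rintro hm τ rfl
      rw [Function.iterate_succ_apply']
      obtain ⟨h1, h2, h3⟩ := ih (by omega) _ rfl
      set τ := (fun τ => (d.run τ).writeNat v 0 0 0 ((d.run τ).nat v 0 0 0 + 1))^[m]
        (σ.writeNat v 0 0 0 0) with hτ
      have hfr : Frame (forLT v e c) τ (d.run τ) :=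
        (frame_run d τ).mono (by simp [forLT, natWrites, hd]) (by simp [forLT, realWrites, hd])
      have hdv : (d.run τ).nat v 0 0 0 = m := by
        rw [(frame_run d τ).nat v hcv, h1]
      refine ⟨?_, (h2.trans hfr).trans (hw _ _), ?_⟩
      · simp [Mem.writeNat_nat_self, hdv]
      · apply hv
        have hcond : (Test.natLE (.add (.var v) (.const 1)) e).holds τ ↔ m + 1 ≤ n := by
          simp [Test.holds, NExp.eval, h1, he τ h2]
        by_cases hmn : m + 1 ≤ n
        · rw [min_eq_left hmn]
          rw [min_eq_left (by omega)] at h3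
          simp only [hd, run, if_pos (hcond.2 hmn)]
          exact hs m hmn τ h1 h2 h3
        · simp only [hd, run, if_neg (fun h => hmn (hcond.1 h))]
          rw [show min (m + 1) n = min m n by omega]
          exact h3
  have := (key _ le_rfl _ rfl).2.2
  rwa [min_eq_right hn] at this

/-- `acc := ∑ v < e, (inner; term)`. -/
def sumTo (acc v : ℕ) (e : NExp) (inner : BProg) (term : RExp) : BProg :=
  seq (setReal acc (.const 0) (.const 0) (.const 0) (.cast (.const 0)))
    (forLT v e (seq inner (setReal acc (.const 0) (.const 0) (.const 0)
      (.add (.var acc) term))))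

/-- The inner program may use other accumulators but not this one. Its result enters only through
the term evaluated after it, so nested sums follow by nesting this lemma. -/
theorem run_sumTo {acc v : ℕ} {e : NExp} {inner : BProg} {term : RExp} {σ : Mem}
    (hok : (sumTo acc v e inner term).ok = true) (hacc : acc ∉ inner.realWrites)
    (n : ℕ) (hn : n ≤ σ.nat 11 0 0 0)
    (he : ∀ τ, Frame (sumTo acc v e inner term) σ τ → e.eval τ = n) (f : ℕ → ℝ)
    (hf : ∀ i < n, ∀ τ, τ.nat v 0 0 0 = i → Frame (sumTo acc v e inner term) σ τ →
      term.eval (inner.run τ) = f i) :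
    ((sumTo acc v e inner term).run σ).real acc 0 0 0 = ∑ i ∈ Finset.range n, f i := by
  set σ' := σ.writeReal acc 0 0 0 0 with hσ'
  set c : BProg := seq inner (setReal acc (.const 0) (.const 0) (.const 0)
      (.add (.var acc) term)) with hc
  have hfr0 : Frame (sumTo acc v e inner term) σ σ' :=
    ⟨fun a _ => rfl, fun a ha => Mem.writeReal_real_of_ne _
      (fun h => ha (by simp [sumTo, forLT, realWrites, h])) _ _ _ _⟩
  have hfr : ∀ τ, Frame (forLT v e c) σ' τ → Frame (sumTo acc v e inner term) σ τ := fun τ h =>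
    hfr0.trans (h.mono (by simp [sumTo, natWrites, hc]) (by simp [sumTo, realWrites, hc]))
  have hok' : (forLT v e c).ok = true := by
    simpa [sumTo, ok, hc] using hok
  have := run_forLT (σ := σ') hok' n (by simpa [hσ'] using hn) (fun τ h => he τ (hfr τ h))
    (fun i τ => τ.real acc 0 0 0 = ∑ i ∈ Finset.range i, f i) (fun i τ x h => h)
    (by simp [hσ', Mem.writeReal_real_self]) (fun i hi τ h1 h2 h3 => by
      rw [hc]
      simp only [run, NExp.eval, RExp.eval, Mem.writeReal_real_self, and_self, if_true,
        hf i hi τ h1 (hfr τ h2)]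
      rw [(frame_run inner τ).real acc hacc, h3, Finset.sum_range_succ])
  have hrun : (sumTo acc v e inner term).run σ = (forLT v e c).run σ' := by
    simp [sumTo, run, hσ', NExp.eval, RExp.eval, hc]
  rw [hrun]
  exact this

end BProg

end SSVM

noncomputable section

namespace SSVM

/-! ### Maximizing a supermodular quadratic function by pushes and relabelings -/

/-- Heights, excesses and residual capacities on the nodes `0, 1, 2, ...`. -/
structure Flow where
  h : ℕ → ℕ
  e : ℕ → ℝ
  r : ℕ → ℕ → ℝ

namespace Flow

/-- The excess inside `Y` minus the residual capacity of the arcs that leave `Y`. -/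
def value (n : ℕ) (s : Flow) (Y : ℕ → Bool) : ℝ :=
  ∑ x ∈ Finset.range n, (ind (Y x) * s.e x -
    ∑ y ∈ Finset.range n, ind (Y x) * (1 - ind (Y y)) * s.r x y)

/-- Push `d` along the arc from `x` to `y`. -/
def move (x y : ℕ) (d : ℝ) (s : Flow) : Flow where
  h := s.h
  e := fun z => if z = x then s.e x - d else if z = y then s.e y + d else s.e z
  r := fun a b => if a = x ∧ b = y then s.r x y - d
    else if a = y ∧ b = x then s.r y x + d else s.r a b

open Classical in
/-- Push as much as possible from `x` to `y` if the arc is admissible. -/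
def push (x y : ℕ) (s : Flow) : Flow :=
  if s.h x = s.h y + 1 then s.move x y (min (s.e x) (s.r x y)) else s

/-- Apply `f 0`, ..., `f (n - 1)`. -/
def iter {α : Type} (f : ℕ → α → α) : ℕ → α → α
  | 0, a => a
  | n + 1, a => f n (iter f n a)

/-- Increase the height of `x`. -/
def lift (x : ℕ) (s : Flow) : Flow := { s with h := fun z => if z = x then s.h x + 1 else s.h z }

open Classical in
/-- Increase the height of `x` if it still has excess. -/
def relabel (x : ℕ) (s : Flow) : Flow := if s.e x ≤ 0 then s else s.lift x

open Classical in
/-- Push from an active node to all admissible neighbours, then relabel. -/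
def discharge (n x : ℕ) (s : Flow) : Flow :=
  if s.e x ≤ 0 then s else if n ≤ s.h x then s else
    relabel x (iter (fun y => push x y) n s)

/-- Discharge all nodes once. -/
def pass (n : ℕ) (s : Flow) : Flow := iter (discharge n) n s

/-- The invariant of the algorithm, relative to the initial state `s₀`. -/
structure Inv (n : ℕ) (s₀ s : Flow) : Prop where
  r_nonneg : ∀ x < n, ∀ y < n, 0 ≤ s.r x y
  valid : ∀ x < n, ∀ y < n, 0 < s.r x y → s.h x ≤ s.h y + 1
  deficit : ∀ x < n, s.e x < 0 → s.h x = 0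
  h_le : ∀ x < n, s.h x ≤ n
  value_eq : ∀ Y, s.value n Y = s₀.value n Y

/-- Positive excess and not yet disconnected from the deficits. -/
def Active (n : ℕ) (s : Flow) (x : ℕ) : Prop := 0 < s.e x ∧ s.h x < n

/-- If the arc leaves `Y`, the excess inside and the capacity leaving both drop by `d`; if it enters
`Y`, both rise by `d`, the latter through the reverse arc; otherwise neither total changes. -/
theorem value_move {n x y : ℕ} (hx : x < n) (hy : y < n) (hxy : x ≠ y) (d : ℝ) (s : Flow)
    (Y : ℕ → Bool) : (s.move x y d).value n Y = s.value n Y := by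
  have h1 : ∀ z ∈ Finset.range n, ∀ a ∈ Finset.range n,
      ind (Y z) * (1 - ind (Y a)) * (s.move x y d).r z a =
      ind (Y z) * (1 - ind (Y a)) * s.r z a
      + (if a = y then (if z = x then - (ind (Y x) * (1 - ind (Y y)) * d) else 0) else 0)
      + (if a = x then (if z = y then ind (Y y) * (1 - ind (Y x)) * d else 0) else 0) := by
    intro z _ a _
    simp only [move]
    by_cases hzx : z = x <;> by_cases hay : a = y <;> by_cases hzy : z = y <;>
      by_cases hax : a = x <;> simp_all <;> ring
  have h2 : ∀ z ∈ Finset.range n, ind (Y z) * (s.move x y d).e z =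
      ind (Y z) * s.e z + (if z = x then - (ind (Y x) * d) else 0)
        + (if z = y then ind (Y y) * d else 0) := by
    intro z _
    simp only [move]
    by_cases hzx : z = x <;> by_cases hzy : z = y <;> simp_all <;> ring
  have hx' : x ∈ Finset.range n := Finset.mem_range.2 hx
  have hy' : y ∈ Finset.range n := Finset.mem_range.2 hy
  unfold value
  rw [Finset.sum_congr rfl fun z hz => by rw [h2 z hz, Finset.sum_congr rfl (h1 z hz)]]
  simp only [Finset.sum_add_distrib, Finset.sum_sub_distrib, Finset.sum_ite_eq', hx', hy',
    if_true]
  ring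

theorem iter_induction {α : Type} {f : ℕ → α → α} {n : ℕ} {a : α} (I : ℕ → α → Prop)
    (h0 : I 0 a) (hs : ∀ i < n, ∀ b, I i b → I (i + 1) (f i b)) : I n (iter f n a) := by
  induction n with
  | zero => exact h0
  | succ n ih => exact hs n (by omega) _ (ih fun i hi => hs i (by omega))

theorem push_h (x y : ℕ) (s : Flow) : (s.push x y).h = s.h := by
  unfold push
  split_ifs <;> rfl

theorem move_e_self (x y : ℕ) (d : ℝ) (s : Flow) : (s.move x y d).e x = s.e x - d := by
  simp [move]

/-- The only arc that can become residual is the reverse one, which climbs one level, so the heights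
stay valid. Because `d ≤ s.e x`, no new deficit arises. -/
theorem inv_move {n x y : ℕ} {s₀ s : Flow} (hI : Inv n s₀ s) (hx : x < n) (hy : y < n)
    {d : ℝ} (hd : 0 ≤ d) (hde : d ≤ s.e x) (hdr : d ≤ s.r x y) (hh : s.h x = s.h y + 1) :
    Inv n s₀ (s.move x y d) := by
  have hxy : x ≠ y := fun h => by rw [h] at hh; omega
  have hr := hI.r_nonneg
  refine ⟨?_, ?_, ?_, hI.h_le, fun Y => (value_move hx hy hxy d s Y).trans (hI.value_eq Y)⟩
  · intro a ha b hb
    simp only [move]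
    split_ifs with h1 h2
    · linarith
    · have := hr y hy x hx
      linarith
    · exact hr a ha b hb
  · intro a ha b hb
    simp only [move]
    split_ifs with h1 h2
    · intro _
      rw [h1.1, h1.2, hh]
    · intro _
      rw [h2.1, h2.2, hh]
      omega
    · exact hI.valid a ha b hb
  · intro a ha
    simp only [move]
    split_ifs with h1 h2
    · intro h
      linarith
    · intro h
      rw [h2]
      exact hI.deficit y hy (by linarith)
    · exact hI.deficit a ha

theorem inv_push {n x y : ℕ} {s₀ s : Flow} (hI : Inv n s₀ s) (hx : x < n) (hy : y < n)
    (he : 0 ≤ s.e x) : Inv n s₀ (s.push x y) ∧ 0 ≤ (s.push x y).e x := by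
  unfold push
  split_ifs with h
  · refine ⟨inv_move hI hx hy (le_min he (hI.r_nonneg x hx y hy)) (min_le_left _ _)
      (min_le_right _ _) h, ?_⟩
    rw [move_e_self]
    linarith [min_le_left (s.e x) (s.r x y)]
  · exact ⟨hI, he⟩

/-- After pushing to `y`, either the excess or the arc is exhausted. -/
theorem push_saturates {n x y : ℕ} {s₀ s : Flow} (hI : Inv n s₀ s) (hx : x < n) (hy : y < n)
    (he : 0 ≤ s.e x) (j : ℕ) (hjy : j = y)
    (hs : 0 < s.e x → ∀ z < j, s.h x = s.h z + 1 → s.r x z = 0) :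
    0 < (s.push x y).e x → ∀ z < j + 1, s.h x = s.h z + 1 → (s.push x y).r x z = 0 := by
  subst hjy
  unfold push
  split_ifs with h
  · rw [move_e_self]
    intro hpos z hz hzh
    have hxj : x ≠ j := fun h' => by rw [h'] at h; omega
    have hxz : x ≠ z := fun h' => by rw [h'] at hzh; omega
    have h0 : 0 ≤ min (s.e x) (s.r x j) := le_min he (hI.r_nonneg x hx j hy)
    simp only [move]
    split_ifs with h1 h2
    · have : ¬ s.e x ≤ s.r x j := fun h' => by rw [min_eq_left h'] at hpos; linarith
      rw [min_eq_right (le_of_not_ge this)]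
      ring
    · exact absurd h2.1 hxj
    · refine hs (by linarith) z ?_ hzh
      have : z ≠ j := fun h' => h1 ⟨trivial, h'⟩
      omega
  · intro hpos z hz hzh
    refine hs hpos z ?_ hzh
    have : z ≠ j := fun h' => h (by rw [← h']; exact hzh)
    omega

/-- The pushes out of an active node `x` of height at most `H`. -/
theorem pushes_spec {n x H : ℕ} {s₀ s : Flow} (hI : Inv n s₀ s) (hx : x < n)
    (he : 0 < s.e x) (hH : ∀ z < n, Active n s z → s.h z ≤ H) (hhx : s.h x < n)
    (hP : ∀ z < x, Active n s z → s.h z + 1 ≤ H) :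
    let s' := iter (fun y => push x y) n s
    Inv n s₀ s' ∧ s'.h = s.h ∧ 0 ≤ s'.e x ∧
      (0 < s'.e x → ∀ z < n, s.h x = s.h z + 1 → s'.r x z = 0) ∧
      (∀ z < n, Active n s' z → s.h z ≤ H) ∧
      (∀ z < x, Active n s' z → s.h z + 1 ≤ H) := by
  have hxH : s.h x ≤ H := hH x hx ⟨he, hhx⟩
  have key := iter_induction (f := fun y => push x y) (n := n) (a := s) (fun j s' => j ≤ n →
    (Inv n s₀ s' ∧ s'.h = s.h ∧ 0 ≤ s'.e x ∧
      (0 < s'.e x → ∀ z < j, s'.h x = s'.h z + 1 → s'.r x z = 0) ∧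
      (∀ z < n, Active n s' z → s.h z ≤ H) ∧
      (∀ z < x, Active n s' z → s.h z + 1 ≤ H)))
    (fun _ => ⟨hI, rfl, he.le, fun _ z hz => absurd hz (Nat.not_lt_zero z), hH, hP⟩) ?_
  · obtain ⟨h1, h2, h3, h4, h5, h6⟩ := key le_rfl
    exact ⟨h1, h2, h3, by rw [h2] at h4; exact h4, h5, h6⟩
  · intro j hj t ht _
    obtain ⟨h1, h2, h3, h4, h5, h6⟩ := ht hj.le
    obtain ⟨g1, g2⟩ := inv_push h1 hx hj h3
    have g3 := push_saturates h1 hx hj h3 j rfl h4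
    -- A push can activate only its target, which lies one level below `x` and hence strictly below
    -- `H`.
    have hact : ∀ z, Active n (t.push x j) z → Active n t z ∨ (z = j ∧ s.h x = s.h z + 1) := by
      intro z
      unfold push
      split_ifs with h
      · rintro ⟨ha, hb⟩
        by_cases hzj : z = j
        · right
          refine ⟨hzj, ?_⟩
          rw [hzj, ← h2]
          exact h
        · left
          refine ⟨?_, hb⟩
          simp only [move] at ha
          split_ifs at ha with hzx
          · rw [hzx]
            have := le_min h3 (h1.r_nonneg x hx j hj)
            linarith
          · exact ha
      · exact Or.inl
    refine ⟨g1, by rw [push_h, h2], g2, by rw [push_h]; exact g3, ?_, ?_⟩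
    · intro z hz hz'
      rcases hact z hz' with h | ⟨-, h⟩
      · exact h5 z hz h
      · omega
    · intro z hz hz'
      rcases hact z hz' with h | ⟨-, h⟩
      · exact h6 z hz h
      · omega

/-- A lift endangers validity only on residual arcs out of `x` that already descend one level, and
these are saturated by hypothesis; arcs into `x` gain slack. -/
theorem inv_lift {n x : ℕ} {s₀ s : Flow} (hI : Inv n s₀ s) (hx : x < n) (he : 0 < s.e x)
    (hhx : s.h x < n) (hs : ∀ z < n, s.h x = s.h z + 1 → s.r x z = 0) :
    Inv n s₀ (s.lift x) := by
  refine ⟨hI.r_nonneg, ?_, ?_, ?_, hI.value_eq⟩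
  · intro a ha b hb hr
    have := hI.valid a ha b hb hr
    simp only [lift] at hr ⊢
    split_ifs with h1 h2 h2
    · omega
    · subst h1
      have : s.h a ≠ s.h b + 1 := fun h => by
        rw [hs b hb h] at hr
        exact lt_irrefl _ hr
      omega
    · subst h2
      omega
    · exact this
  · intro a ha hea
    simp only [lift] at hea ⊢
    split_ifs with h1
    · subst h1
      linarith
    · exact hI.deficit a ha hea
  · intro a ha
    simp only [lift]
    split_ifs with h1
    · omega
    · exact hI.h_le a ha

/-- The total height. -/
def heightSum (n : ℕ) (s : Flow) : ℕ := ∑ x ∈ Finset.range n, s.h x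

theorem heightSum_lift {n x : ℕ} (hx : x < n) (s : Flow) :
    heightSum n (s.lift x) = heightSum n s + 1 := by
  unfold heightSum
  have : ∀ z ∈ Finset.range n, (s.lift x).h z = s.h z + if z = x then 1 else 0 := by
    intro z _
    simp only [lift]
    split_ifs with h
    · rw [h]
    · rfl
  rw [Finset.sum_congr rfl this, Finset.sum_add_distrib, Finset.sum_ite_eq']
  simp [hx]

/-- In a pass without a lift every discharged node loses all its excess, and excess moves only one
level down. So the bound on the active levels falls, unless the total height grows. -/
theorem pass_spec {n H : ℕ} {s₀ s : Flow} (hI : Inv n s₀ s)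
    (hH : ∀ z < n, Active n s z → s.h z ≤ H) :
    Inv n s₀ (s.pass n) ∧ (heightSum n s < heightSum n (s.pass n) ∨
      (heightSum n s = heightSum n (s.pass n) ∧
        ∀ z < n, Active n (s.pass n) z → (s.pass n).h z + 1 ≤ H)) := by
  unfold pass
  have key := iter_induction (f := discharge n) (n := n) (a := s) (fun x t => Inv n s₀ t ∧
    (heightSum n s < heightSum n t ∨ (heightSum n s = heightSum n t ∧
      (∀ z < n, Active n t z → t.h z ≤ H) ∧ ∀ z < x, Active n t z → t.h z + 1 ≤ H)))
    ⟨hI, Or.inr ⟨rfl, hH, fun z hz => absurd hz (Nat.not_lt_zero z)⟩⟩ ?_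
  · exact ⟨key.1, key.2.imp id fun h => ⟨h.1, h.2.2⟩⟩
  · rintro x hx t ⟨hIt, ht⟩
    unfold discharge
    have inactive : ¬ Active n t x → (heightSum n s < heightSum n t ∨
        (heightSum n s = heightSum n t ∧ (∀ z < n, Active n t z → t.h z ≤ H) ∧
          ∀ z < x + 1, Active n t z → t.h z + 1 ≤ H)) := by
      intro hna
      refine ht.imp id fun h => ⟨h.1, h.2.1, fun z hz hz' => h.2.2 z ?_ hz'⟩
      have : z ≠ x := fun h => hna (h ▸ hz')
      omega
    split_ifs with h1 h2
    · exact ⟨hIt, inactive fun h => absurd h.1 (not_lt.2 h1)⟩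
    · exact ⟨hIt, inactive fun h => absurd h.2 (not_lt.2 h2)⟩
    · push Not at h1 h2
      rcases ht with ht | ⟨ht1, ht2, ht3⟩
      · -- the total height has increased before
        obtain ⟨g1, g2, g3, g4, -, -⟩ := pushes_spec (H := n + 1) hIt hx h1
          (fun z hz _ => (hIt.h_le z hz).trans (by omega)) h2
          (fun z hz _ => by have := hIt.h_le z (by omega); omega)
        set t' := iter (fun y => push x y) n t
        unfold relabel
        have e : heightSum n t' = heightSum n t := by unfold heightSum; rw [g2]
        split_ifs with h3
        · exact ⟨g1, Or.inl (by omega)⟩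
        · push Not at h3
          refine ⟨inv_lift g1 hx h3 (by rw [g2]; exact h2) (by rw [g2]; exact g4 h3),
            Or.inl ?_⟩
          rw [heightSum_lift hx]
          omega
      · obtain ⟨g1, g2, g3, g4, g5, g6⟩ := pushes_spec hIt hx h1 ht2 h2 ht3
        set t' := iter (fun y => push x y) n t
        unfold relabel
        have e : heightSum n t' = heightSum n t := by unfold heightSum; rw [g2]
        split_ifs with h3
        · refine ⟨g1, Or.inr ⟨by omega, by rw [g2]; exact g5, ?_⟩⟩
          rw [g2]
          intro z hz hz'
          refine g6 z ?_ hz'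
          have : z ≠ x := fun h => absurd (h ▸ hz'.1 : 0 < t'.e x) (not_lt.2 h3)
          omega
        · push Not at h3
          refine ⟨inv_lift g1 hx h3 (by rw [g2]; exact h2) (by rw [g2]; exact g4 h3),
            Or.inl ?_⟩
          rw [heightSum_lift hx]
          omega

theorem heightSum_le {n : ℕ} {s₀ s : Flow} (hI : Inv n s₀ s) : heightSum n s ≤ n * n := by
  unfold heightSum
  calc _ ≤ ∑ _x ∈ Finset.range n, n :=
        Finset.sum_le_sum fun x hx => hI.h_le x (Finset.mem_range.1 hx)
    _ = n * n := by simp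

/-- A potential argument: a pass with a lift resets `H` to `n` but pays `n + 1`, a pass without one
lowers `H`. The value `n` is always a legitimate bound, as active nodes lie below level `n`; `H = 0`
means that none is active. -/
theorem passes_spec {n : ℕ} {s : Flow} (hI : Inv n s s) (t : ℕ) :
    Inv n s ((pass n)^[t] s) ∧ ((∀ z < n, ¬ Active n ((pass n)^[t] s) z) ∨
      ∃ H ≤ n, (∀ z < n, Active n ((pass n)^[t] s) z → ((pass n)^[t] s).h z + 1 ≤ H) ∧
        t ≤ (n + 1) * heightSum n ((pass n)^[t] s) + (n - H)) := by
  induction t with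
  | zero => exact ⟨hI, Or.inr ⟨n, le_rfl, fun z _ hz => hz.2, by simp⟩⟩
  | succ t ih =>
    obtain ⟨h1, h2⟩ := ih
    rw [Function.iterate_succ_apply']
    set u := (pass n)^[t] s
    have h2' : ∃ H ≤ n, (∀ z < n, Active n u z → u.h z + 1 ≤ H) ∧
        ((∀ z < n, ¬ Active n u z) ∨ 1 ≤ H ∧ t ≤ (n + 1) * heightSum n u + (n - H)) := by
      rcases h2 with h2 | ⟨H, hH, h3, h4⟩
      · exact ⟨0, by omega, fun z hz hz' => absurd hz' (h2 z hz), Or.inl h2⟩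
      · refine ⟨H, hH, h3, ?_⟩
        rcases Nat.eq_zero_or_pos H with h0 | h0
        · left
          intro z hz hz'
          have := h3 z hz hz'
          omega
        · exact Or.inr ⟨h0, h4⟩
    obtain ⟨H, hHn, hH, h3⟩ := h2'
    rcases h3 with h3 | ⟨h0, h3⟩
    · refine ⟨(pass_spec h1 (H := 0) fun z hz hz' => absurd hz' (h3 z hz)).1, Or.inl ?_⟩
      -- Without active nodes each discharge is the identity, so the situation persists in further
      -- passes.
      have hp : ∀ m, iter (discharge n) m u = u ∨ ¬ m ≤ n := by
        intro m
        by_cases hm : m ≤ n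
        · left
          refine iter_induction (f := discharge n) (n := m) (a := u) (fun _ v => v = u) rfl ?_
          rintro i hi v rfl
          unfold discharge
          split_ifs with a b
          · rfl
          · rfl
          · exact absurd ⟨not_le.1 a, not_le.1 b⟩ (h3 i (by omega))
        · exact Or.inr hm
      have : pass n u = u := (hp n).resolve_right (by simp)
      rw [this]
      exact h3
    · obtain ⟨g1, g2⟩ := pass_spec h1 (H := H - 1) fun z hz hz' => by
        have := hH z hz hz'
        omega
      refine ⟨g1, Or.inr ?_⟩
      rcases g2 with g2 | ⟨g2, g3⟩
      · refine ⟨n, le_rfl, fun z _ hz => hz.2, ?_⟩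
        have := Nat.mul_le_mul_left (n + 1) (Nat.succ_le_of_lt g2)
        rw [Nat.succ_eq_add_one, mul_add] at this
        omega
      · refine ⟨H - 1, by omega, fun z hz hz' => g3 z hz hz', ?_⟩
        rw [← g2]
        omega

/-- Heights are at most `n`, so the potential is at most `(n + 1) n² + n`, which is less than `(n +
1)³`. -/
theorem no_active {n t : ℕ} {s : Flow} (hI : Inv n s s) (ht : (n + 1) ^ 3 ≤ t) :
    Inv n s ((pass n)^[t] s) ∧ ∀ z < n, ¬ Active n ((pass n)^[t] s) z := by
  obtain ⟨h1, h2⟩ := passes_spec hI t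
  refine ⟨h1, h2.resolve_right ?_⟩
  rintro ⟨H, -, -, h⟩
  have h3 := Nat.mul_le_mul_left (n + 1) (heightSum_le h1)
  have h4 : (n + 1) ^ 3 = (n + 1) * (n * n) + (n + 1) * (2 * n + 1) := by ring
  have h5 : n + 1 ≤ (n + 1) * (2 * n + 1) := Nat.le_mul_of_pos_right _ (by omega)
  omega

/-- Some level between `0` and `n` contains no node. -/
theorem exists_gap (n : ℕ) (h : ℕ → ℕ) : ∃ j < n + 1, ∀ x < n, h x ≠ j := by
  by_contra! hc
  have : Finset.range (n + 1) ⊆ (Finset.range n).image h := fun j hj => by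
    obtain ⟨x, hx, hxj⟩ := hc j (Finset.mem_range.1 hj)
    exact Finset.mem_image.2 ⟨x, Finset.mem_range.2 hx, hxj⟩
  have h1 := Finset.card_le_card this
  have h2 := Finset.card_image_le (s := Finset.range n) (f := h)
  simp only [Finset.card_range] at h1 h2
  omega

/-- The nodes above an empty level form an optimal set. -/
theorem value_le_of_gap {n j : ℕ} {s₀ s : Flow} (hI : Inv n s₀ s)
    (hact : ∀ z < n, ¬ Active n s z) (hj : j < n + 1) (hgap : ∀ x < n, s.h x ≠ j)
    (Y : ℕ → Bool) : s₀.value n Y ≤ s₀.value n fun x => decide (j ≤ s.h x) := by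
  rw [← hI.value_eq, ← hI.value_eq]
  have hY : ∀ b, 0 ≤ ind b ∧ ind b ≤ 1 := fun b => by cases b <;> simp [ind]
  unfold value
  -- The comparison is node by node: above the gap the excess is nonnegative and no residual arc
  -- leaves the set, below it the excess is not positive.
  refine Finset.sum_le_sum fun x hx => ?_
  have hx := Finset.mem_range.1 hx
  have h1 : 0 ≤ ∑ y ∈ Finset.range n, ind (Y x) * (1 - ind (Y y)) * s.r x y :=
    Finset.sum_nonneg fun y hy => mul_nonneg (mul_nonneg (hY _).1 (by linarith [(hY (Y y)).2]))
      (hI.r_nonneg x hx y (Finset.mem_range.1 hy))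
  by_cases hjx : j ≤ s.h x
  · have h2 : 0 ≤ s.e x := by
      by_contra! h
      have := hI.deficit x hx h
      have := hgap x hx
      omega
    have h3 : ∑ y ∈ Finset.range n, ind (decide (j ≤ s.h x)) *
        (1 - ind (decide (j ≤ s.h y))) * s.r x y = 0 := by
      refine Finset.sum_eq_zero fun y hy => ?_
      have hy := Finset.mem_range.1 hy
      by_cases hjy : j ≤ s.h y
      · simp [hjy, ind]
      -- A residual arc descends at most one level, while crossing the empty level takes a drop of
      -- at least two.
      · have h4 : s.r x y = 0 := by
          refine le_antisymm ?_ (hI.r_nonneg x hx y hy)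
          by_contra! h
          have := hI.valid x hx y hy h
          have := hgap x hx
          omega
        rw [h4, mul_zero]
    rw [h3]
    have : ind (decide (j ≤ s.h x)) = 1 := by simp [ind, hjx]
    rw [this]
    nlinarith [mul_le_mul_of_nonneg_right (hY (Y x)).2 h2]
  -- Positive excess would make `x` active, since its height is below `j ≤ n`.
  · have h2 : s.e x ≤ 0 := by
      by_contra! h
      exact hact x hx ⟨h, by omega⟩
    have : ind (decide (j ≤ s.h x)) = 0 := by simp [ind, hjx]
    simp only [this, zero_mul, Finset.sum_const_zero, sub_zero]
    nlinarith [(hY (Y x)).1]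

end Flow

end SSVM

end

noncomputable section

namespace SSVM

/-! ### The push-relabel method as a bounded program

The number of nodes is in the integer variable 14, the heights are in the integer array 15, the
excesses in the real array 7 and the residual capacities in the real array 8. -/

/-- The state of the push-relabel method that is stored in the memory. -/
def Mem.flow (σ : Mem) : Flow where
  h := fun x => σ.nat 15 x 0 0
  e := fun x => σ.real 7 x 0 0
  r := fun x y => σ.real 8 x y 0

namespace BProg

/-- The constant zero. -/
abbrev zero : NExp := .const 0

/-- Run `c` if the two integers agree. -/
def whenEq (e f : NExp) (c : BProg) : BProg :=
  branch (.natLE e f) (branch (.natLE f e) c skip) skip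

theorem run_whenEq (e f : NExp) (c : BProg) (σ : Mem) :
    (whenEq e f c).run σ = if e.eval σ = f.eval σ then c.run σ else σ := by
  simp only [whenEq, run_branch_natLE, run_skip]
  by_cases h : e.eval σ = f.eval σ
  · rw [if_pos h.le, if_pos h.ge, if_pos h]
  · rw [if_neg h]
    by_cases h' : e.eval σ ≤ f.eval σ
    · rw [if_pos h', if_neg (by omega)]
    · rw [if_neg h']

/-- Move the amount in the real variable 9 from node `x` to node `y`. -/
def moveProg : BProg :=
  seq (setReal 7 (.var 19) zero zero (.sub (.get 7 (.var 19) zero zero) (.var 9)))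
    (seq (setReal 7 (.var 20) zero zero (.add (.get 7 (.var 20) zero zero) (.var 9)))
      (seq (setReal 8 (.var 19) (.var 20) zero
          (.sub (.get 8 (.var 19) (.var 20) zero) (.var 9)))
        (setReal 8 (.var 20) (.var 19) zero
          (.add (.get 8 (.var 20) (.var 19) zero) (.var 9)))))

/-- The writes happen one after another and agree with the simultaneous update only for distinct
nodes. -/
theorem flow_moveProg (σ : Mem) (hxy : σ.nat 19 0 0 0 ≠ σ.nat 20 0 0 0) :
    (moveProg.run σ).flow =
      σ.flow.move (σ.nat 19 0 0 0) (σ.nat 20 0 0 0) (σ.real 9 0 0 0) := by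
  have hyx := hxy.symm
  simp only [Mem.flow, Flow.move, Flow.mk.injEq]
  refine ⟨?_, ?_, ?_⟩
  · funext x
    simp [moveProg, Mem.writeReal]
  · funext z
    simp [moveProg, Mem.writeReal, NExp.eval, RExp.eval, hxy, hyx]
    split_ifs <;> simp_all
  · funext a b
    simp [moveProg, Mem.writeReal, NExp.eval, RExp.eval, hxy, hyx]
    split_ifs <;> simp_all

/-- Push as much as possible from node `x` to node `y`. -/
def pushProg : BProg :=
  whenEq (.get 15 (.var 19) zero zero) (.add (.get 15 (.var 20) zero zero) (.const 1))
    (seq (branch (.realLE (.get 7 (.var 19) zero zero) (.get 8 (.var 19) (.var 20) zero))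
        (setReal 9 zero zero zero (.get 7 (.var 19) zero zero))
        (setReal 9 zero zero zero (.get 8 (.var 19) (.var 20) zero)))
      moveProg)

theorem flow_pushProg (σ : Mem) :
    (pushProg.run σ).flow = σ.flow.push (σ.nat 19 0 0 0) (σ.nat 20 0 0 0) := by
  unfold pushProg Flow.push
  rw [run_whenEq]
  have hc : (σ.flow.h (σ.nat 19 0 0 0) = σ.flow.h (σ.nat 20 0 0 0) + 1) ↔
      (NExp.get 15 (.var 19) zero zero).eval σ =
        (NExp.add (.get 15 (.var 20) zero zero) (.const 1)).eval σ := Iff.rfl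
  by_cases h : σ.flow.h (σ.nat 19 0 0 0) = σ.flow.h (σ.nat 20 0 0 0) + 1
  · rw [if_pos h, if_pos (hc.1 h)]
    have hxy : σ.nat 19 0 0 0 ≠ σ.nat 20 0 0 0 := fun h' => by
      rw [h'] at h
      omega
    rw [run_seq]
    set τ := run (branch (.realLE (.get 7 (.var 19) zero zero) (.get 8 (.var 19) (.var 20) zero))
      (setReal 9 zero zero zero (.get 7 (.var 19) zero zero))
      (setReal 9 zero zero zero (.get 8 (.var 19) (.var 20) zero))) σ with hτ
    have hfr := frame_run (branch (.realLE (.get 7 (.var 19) zero zero)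
      (.get 8 (.var 19) (.var 20) zero)) (setReal 9 zero zero zero (.get 7 (.var 19) zero zero))
      (setReal 9 zero zero zero (.get 8 (.var 19) (.var 20) zero))) σ
    rw [← hτ] at hfr
    have hflow : τ.flow = σ.flow := by
      simp only [Mem.flow, hfr.nat 15 (by decide), hfr.real 7 (by decide),
        hfr.real 8 (by decide)]
    have h9 : τ.real 9 0 0 0 = min (σ.flow.e (σ.nat 19 0 0 0))
        (σ.flow.r (σ.nat 19 0 0 0) (σ.nat 20 0 0 0)) := by
      rw [hτ]
      by_cases h' : σ.real 7 (σ.nat 19 0 0 0) 0 0 ≤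
          σ.real 8 (σ.nat 19 0 0 0) (σ.nat 20 0 0 0) 0
      · rw [run_branch_pos ?_]
        · refine Eq.trans ?_ (min_eq_left h').symm
          simp [Mem.writeReal, RExp.eval, NExp.eval]
        · exact h'
      · rw [run_branch_neg ?_]
        · refine Eq.trans ?_ (min_eq_right (le_of_not_ge h')).symm
          simp [Mem.writeReal, RExp.eval, NExp.eval]
        · exact h'
    have h19 := hfr.nat 19 (by decide)
    have h20 := hfr.nat 20 (by decide)
    rw [flow_moveProg τ (by rw [h19, h20]; exact hxy), hflow, h19, h20, h9]
  · rw [if_neg h, if_neg fun h' => h (hc.2 h')]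

/-- Increase the height of node `x` if it has positive excess. -/
def relabelProg : BProg :=
  branch (.realLE (.get 7 (.var 19) zero zero) (.cast zero)) skip
    (setNat 15 (.var 19) zero zero (.add (.get 15 (.var 19) zero zero) (.const 1)))

theorem flow_relabelProg (σ : Mem) :
    (relabelProg.run σ).flow = σ.flow.relabel (σ.nat 19 0 0 0) := by
  unfold relabelProg Flow.relabel
  have hc : (Test.realLE (.get 7 (.var 19) zero zero) (.cast zero)).holds σ ↔
      σ.flow.e (σ.nat 19 0 0 0) ≤ 0 := by
    simp [Test.holds, RExp.eval, NExp.eval, Mem.flow]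
  by_cases h : σ.flow.e (σ.nat 19 0 0 0) ≤ 0
  · rw [run_branch_pos (hc.2 h), if_pos h, run_skip]
  · rw [run_branch_neg fun h' => h (hc.1 h'), if_neg h]
    simp only [run_setNat, NExp.eval]
    simp only [Mem.flow, Flow.lift, Flow.mk.injEq]
    refine ⟨?_, rfl, rfl⟩
    funext z
    simp [Mem.writeNat]

theorem flow_writeNat (σ : Mem) {a : ℕ} (ha : 15 ≠ a) (i j k v : ℕ) :
    (σ.writeNat a i j k v).flow = σ.flow := by
  simp only [Mem.flow, Mem.writeNat_nat_of_ne _ ha, Mem.writeNat_real]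

/-- A loop whose body acts on the stored flow like `f`. -/
theorem flow_forLT {v : ℕ} {e : NExp} {c : BProg} {σ : Mem} (hok : (forLT v e c).ok = true)
    (hv : 15 ≠ v) (n : ℕ) (hn : n ≤ σ.nat 11 0 0 0)
    (he : ∀ τ, Frame (forLT v e c) σ τ → e.eval τ = n) (f : ℕ → Flow → Flow)
    (hf : ∀ i < n, ∀ τ, τ.nat v 0 0 0 = i → Frame (forLT v e c) σ τ →
      (c.run τ).flow = f i τ.flow) :
    ((forLT v e c).run σ).flow = Flow.iter f n σ.flow :=
  run_forLT hok n hn he (fun i τ => τ.flow = Flow.iter f i σ.flow)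
    (fun i τ x h => by rw [flow_writeNat _ hv, h]) rfl
    (fun i hi τ h1 h2 h3 => by rw [hf i hi τ h1 h2, h3]; rfl)

/-- Discharge node `x`. -/
def dischargeProg : BProg :=
  branch (.realLE (.get 7 (.var 19) zero zero) (.cast zero)) skip
    (branch (.natLE (.var 14) (.get 15 (.var 19) zero zero)) skip
      (seq (forLT 20 (.var 14) pushProg) relabelProg))

theorem flow_dischargeProg (σ : Mem) {n : ℕ} (hn : σ.nat 14 0 0 0 = n)
    (hB : n ≤ σ.nat 11 0 0 0) :
    (dischargeProg.run σ).flow = σ.flow.discharge n (σ.nat 19 0 0 0) := by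
  unfold dischargeProg Flow.discharge
  have hc : (Test.realLE (.get 7 (.var 19) zero zero) (.cast zero)).holds σ ↔
      σ.flow.e (σ.nat 19 0 0 0) ≤ 0 := by
    simp [Test.holds, RExp.eval, NExp.eval, Mem.flow]
  by_cases h : σ.flow.e (σ.nat 19 0 0 0) ≤ 0
  · rw [run_branch_pos (hc.2 h), if_pos h, run_skip]
  · rw [run_branch_neg fun h' => h (hc.1 h'), if_neg h]
    simp only [run_skip, run_seq, run_branch_natLE, NExp.eval, hn]
    by_cases h' : n ≤ σ.nat 15 (σ.nat 19 0 0 0) 0 0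
    · rw [if_pos h', if_pos (show n ≤ σ.flow.h _ from h')]
    · rw [if_neg h', if_neg (show ¬ n ≤ σ.flow.h _ from h')]
      rw [flow_relabelProg, (frame_run (forLT 20 (.var 14) pushProg) σ).nat 19 (by decide)]
      congr 1
      refine flow_forLT (by decide) (by decide) n hB (fun τ h => ?_) _ (fun i hi τ h1 h2 => ?_)
      · simp only [NExp.eval, h.nat 14 (by decide), hn]
      · rw [flow_pushProg, h1, h2.nat 19 (by decide)]

/-- Discharge all nodes. -/
def passProg : BProg := forLT 19 (.var 14) dischargeProg

theorem flow_passProg (σ : Mem) {n : ℕ} (hn : σ.nat 14 0 0 0 = n)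
    (hB : n ≤ σ.nat 11 0 0 0) : (passProg.run σ).flow = σ.flow.pass n := by
  refine flow_forLT (by decide) (by decide) n hB (fun τ h => ?_) _ (fun i hi τ h1 h2 => ?_)
  · simp only [NExp.eval, h.nat 14 (by decide), hn]
  · rw [flow_dischargeProg τ (n := n) (by rw [h2.nat 14 (by decide), hn])
      (by rw [h2.nat 11 (by decide)]; exact hB), h1]

theorem iter_const {α : Type} (f : α → α) (n : ℕ) (a : α) :
    Flow.iter (fun _ => f) n a = f^[n] a := by
  induction n with
  | zero => rfl
  | succ n ih => rw [Function.iterate_succ_apply', ← ih]; rfl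

/-- Sufficiently many passes. -/
def passesProg : BProg :=
  forLT 16 (.var 11) (forLT 17 (.var 11) (forLT 18 (.var 11) passProg))

/-- Three nested loops give the cube of the loop bound, which will be at least `n + 1`; this reaches
the `(n + 1)³` passes that suffice. Nested loops multiply the exponents of the iterates. -/
theorem flow_passesProg (σ : Mem) {n B : ℕ} (hn : σ.nat 14 0 0 0 = n)
    (hB : σ.nat 11 0 0 0 = B) (hnB : n ≤ B) :
    (passesProg.run σ).flow = (Flow.pass n)^[B * (B * B)] σ.flow := by
  have h1 : ∀ τ : Mem, τ.nat 14 = σ.nat 14 → τ.nat 11 = σ.nat 11 →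
      ((forLT 18 (.var 11) passProg).run τ).flow = (Flow.pass n)^[B] τ.flow := by
    intro τ h14 h11
    rw [← iter_const]
    refine flow_forLT (by decide) (by decide) B (by rw [h11, hB]) (fun υ h => ?_) _
      (fun i hi υ g1 g2 => flow_passProg υ ?_ ?_)
    · simp only [NExp.eval, h.nat 11 (by decide), h11, hB]
    · rw [g2.nat 14 (by decide), h14, hn]
    · rw [g2.nat 11 (by decide), h11, hB]
      exact hnB
  have h2 : ∀ τ : Mem, τ.nat 14 = σ.nat 14 → τ.nat 11 = σ.nat 11 →
      ((forLT 17 (.var 11) (forLT 18 (.var 11) passProg)).run τ).flow =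
        (Flow.pass n)^[B * B] τ.flow := by
    intro τ h14 h11
    rw [Function.iterate_mul, ← iter_const]
    refine flow_forLT (by decide) (by decide) B (by rw [h11, hB]) (fun υ h => ?_) _
      (fun i hi υ g1 g2 => h1 υ ?_ ?_)
    · simp only [NExp.eval, h.nat 11 (by decide), h11, hB]
    · rw [g2.nat 14 (by decide), h14]
    · rw [g2.nat 11 (by decide), h11]
  rw [mul_comm, Function.iterate_mul, ← iter_const]
  refine flow_forLT (by decide) (by decide) B (by rw [hB]) (fun υ h => ?_) _
    (fun i hi υ g1 g2 => h2 υ ?_ ?_)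
  · simp only [NExp.eval, h.nat 11 (by decide), hB]
  · rw [g2.nat 14 (by decide)]
  · rw [g2.nat 11 (by decide)]

/-- Set the integer variable 30 to `1` if level `j` is empty and to `0` otherwise. -/
def levelProg : BProg :=
  seq (setNat 30 zero zero zero (.const 1))
    (forLT 19 (.var 14) (whenEq (.get 15 (.var 19) zero zero) (.var 29)
      (setNat 30 zero zero zero zero)))

theorem levelProg_spec (σ : Mem) {n : ℕ} (hn : σ.nat 14 0 0 0 = n) (hB : n ≤ σ.nat 11 0 0 0) :
    1 ≤ (levelProg.run σ).nat 30 0 0 0 ↔ ∀ x < n, σ.nat 15 x 0 0 ≠ σ.nat 29 0 0 0 := by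
  unfold levelProg
  rw [run_seq]
  set σ' := run (setNat 30 zero zero zero (.const 1)) σ with hσ'
  have hfr := frame_run (setNat 30 zero zero zero (.const 1)) σ
  rw [← hσ'] at hfr
  refine run_forLT (σ := σ') (by decide) n (by rw [hfr.nat 11 (by decide)]; exact hB)
    (fun τ h => ?_) (fun i τ => 1 ≤ τ.nat 30 0 0 0 ↔ ∀ x < i, σ.nat 15 x 0 0 ≠ σ.nat 29 0 0 0)
    (fun i τ x h => ?_) ?_ (fun i hi τ h1 h2 h3 => ?_)
  · simp only [NExp.eval, h.nat 14 (by decide), hfr.nat 14 (by decide), hn]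
  · rw [Mem.writeNat_nat_of_ne _ (by decide)]
    exact h
  · simp [hσ', Mem.writeNat, NExp.eval]
  · rw [run_whenEq]
    simp only [NExp.eval, h1, h2.nat 15 (by decide), h2.nat 29 (by decide),
      hfr.nat 15 (by decide), hfr.nat 29 (by decide)]
    rw [Nat.forall_lt_succ_right, ← h3]
    split_ifs with h
    · simp [Mem.writeNat, NExp.eval, h]
    · simp [h]

/-- Store an empty level in the integer variable 31. -/
def gapProg : BProg :=
  forLT 29 (.add (.var 14) (.const 1))
    (seq levelProg (branch (.natLE (.const 1) (.var 30))
      (setNat 31 zero zero zero (.var 29)) skip))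

/-- The invariant speaks of variable 31 only once an empty level has been met, so its old content is
irrelevant. By pigeonhole the levels from `0` to `n` contain an empty one. -/
theorem gapProg_spec (σ : Mem) {n : ℕ} (hn : σ.nat 14 0 0 0 = n)
    (hB : n + 1 ≤ σ.nat 11 0 0 0) :
    (gapProg.run σ).nat 31 0 0 0 < n + 1 ∧
      ∀ x < n, σ.nat 15 x 0 0 ≠ (gapProg.run σ).nat 31 0 0 0 := by
  have key := run_forLT (σ := σ) (v := 29) (e := .add (.var 14) (.const 1))
    (c := seq levelProg (branch (.natLE (.const 1) (.var 30))
      (setNat 31 zero zero zero (.var 29)) skip)) (by decide) (n + 1) hB (fun τ h => ?_)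
    (fun i τ => (∃ j < i, ∀ x < n, σ.nat 15 x 0 0 ≠ j) → τ.nat 31 0 0 0 < n + 1 ∧
      ∀ x < n, σ.nat 15 x 0 0 ≠ τ.nat 31 0 0 0)
    (fun i τ x h => ?_) (fun ⟨j, hj, _⟩ => absurd hj (Nat.not_lt_zero j))
    (fun i hi τ h1 h2 h3 => ?_)
  · exact key (Flow.exists_gap n fun x => σ.nat 15 x 0 0)
  · simp only [NExp.eval, h.nat 14 (by decide), hn]
  · rw [Mem.writeNat_nat_of_ne _ (by decide)]
    exact h
  · have hl := levelProg_spec τ (n := n) (by rw [h2.nat 14 (by decide), hn])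
      (by rw [h2.nat 11 (by decide)]; omega)
    rw [h1, h2.nat 15 (by decide)] at hl
    have hfr := frame_run levelProg τ
    simp only [run_skip, run_seq, run_setNat, run_branch_natLE, NExp.eval, hl]
    split_ifs with h
    · intro _
      simp [Mem.writeNat, hfr.nat 29 (by decide), h1]
      exact ⟨by omega, h⟩
    · rintro ⟨j, hj, hj'⟩
      rw [hfr.nat 31 (by decide)]
      refine h3 ⟨j, ?_, hj'⟩
      have : j ≠ i := fun e => h (e ▸ hj')
      omega

/-- Set all heights to zero. -/
def zeroHeights : BProg := forLT 19 (.var 14) (setNat 15 (.var 19) zero zero zero)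

theorem zeroHeights_spec (σ : Mem) {n : ℕ} (hn : σ.nat 14 0 0 0 = n)
    (hB : n ≤ σ.nat 11 0 0 0) : ∀ x < n, (zeroHeights.run σ).nat 15 x 0 0 = 0 := by
  refine run_forLT (σ := σ) (by decide) n hB (fun τ h => ?_)
    (fun i τ => ∀ x < i, τ.nat 15 x 0 0 = 0) (fun i τ x h => ?_)
    (fun x hx => absurd hx (Nat.not_lt_zero x)) (fun i hi τ h1 h2 h3 => ?_)
  · simp only [NExp.eval, h.nat 14 (by decide), hn]
  · rw [Mem.writeNat_nat_of_ne _ (by decide)]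
    exact h
  · intro x hx
    simp only [run_setNat, NExp.eval, Mem.writeNat_nat_self, h1]
    split_ifs with h
    · rfl
    · exact h3 x (by simp at h; omega)

/-- Compute heights and a level such that the nodes at or above that level form an optimal set. -/
def maxProg : BProg := seq zeroHeights (seq passesProg gapProg)

theorem maxProg_spec (σ : Mem) {n : ℕ} (hn : σ.nat 14 0 0 0 = n)
    (hB : n + 1 ≤ σ.nat 11 0 0 0) (hr : ∀ x < n, ∀ y < n, 0 ≤ σ.real 8 x y 0)
    (Y : ℕ → Bool) :
    σ.flow.value n Y ≤ σ.flow.value n fun x =>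
      decide ((maxProg.run σ).nat 31 0 0 0 ≤ (maxProg.run σ).nat 15 x 0 0) := by
  set σ₁ := zeroHeights.run σ with h₁
  set σ₂ := passesProg.run σ₁ with h₂
  have f₁ : Frame _ σ σ₁ := frame_run zeroHeights σ
  have f₂ : Frame _ σ₁ σ₂ := frame_run passesProg σ₁
  have f₃ : Frame _ σ₂ _ := frame_run gapProg σ₂
  have z := zeroHeights_spec σ hn (by omega)
  rw [← h₁] at z
  have hB₁ : σ₁.nat 11 0 0 0 = σ.nat 11 0 0 0 := by rw [f₁.nat 11 (by decide)]
  have hn₁ : σ₁.nat 14 0 0 0 = n := by rw [f₁.nat 14 (by decide), hn]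
  have hval : ∀ Y, σ.flow.value n Y = σ₁.flow.value n Y := fun Y => by
    simp only [Flow.value, Mem.flow, f₁.real 7 (by decide), f₁.real 8 (by decide)]
  have hflow := flow_passesProg σ₁ hn₁ hB₁ (by omega)
  rw [← h₂] at hflow
  -- With all heights zero the invariant holds whatever the excesses are, so no initial saturation
  -- of arcs is needed.
  have hI : Flow.Inv n σ₁.flow σ₁.flow := by
    refine ⟨fun x hx y hy => ?_, fun x hx y hy _ => ?_, fun x hx _ => z x hx,
      fun x hx => ?_, fun _ => rfl⟩
    · simp only [Mem.flow, f₁.real 8 (by decide)]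
      exact hr x hx y hy
    · simp only [Mem.flow, z x hx]
      omega
    · simp only [Mem.flow, z x hx]
      omega
  obtain ⟨g1, g2⟩ := Flow.no_active (t := σ.nat 11 0 0 0 * (σ.nat 11 0 0 0 * σ.nat 11 0 0 0)) hI
    (by
      rw [show (n + 1) ^ 3 = (n + 1) * ((n + 1) * (n + 1)) by ring]
      gcongr)
  rw [← hflow] at g1 g2
  obtain ⟨g3, g4⟩ := gapProg_spec σ₂ (n := n) (by rw [f₂.nat 14 (by decide), hn₁])
    (by rw [f₂.nat 11 (by decide), hB₁]; exact hB)
  have := Flow.value_le_of_gap g1 g2 g3 g4 Y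
  rw [hval, hval]
  have e : (maxProg.run σ) = gapProg.run σ₂ := rfl
  rw [e, f₃.nat 15 (by decide)]
  exact this

end BProg

end SSVM

end

noncomputable section

namespace SSVM

namespace BProg

/-! ### Nested loops -/

/-- `hrow` passes from a finished inner loop to the start of the next row. Both loops write their
own variables, so the invariant must not depend on either. -/
theorem run_forLT₂ {v w : ℕ} {e f : NExp} {c : BProg} {σ : Mem}
    (hok : (forLT v e (forLT w f c)).ok = true)
    (n m : ℕ) (hn : n ≤ σ.nat 11 0 0 0) (hm : m ≤ σ.nat 11 0 0 0)
    (he : ∀ τ, Frame (forLT v e (forLT w f c)) σ τ → e.eval τ = n)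
    (hf : ∀ τ, Frame (forLT v e (forLT w f c)) σ τ → f.eval τ = m)
    (I : ℕ → ℕ → Mem → Prop) (hv : ∀ i j τ x, I i j τ → I i j (τ.writeNat v 0 0 0 x))
    (hw : ∀ i j τ x, I i j τ → I i j (τ.writeNat w 0 0 0 x))
    (h0 : I 0 0 σ) (hrow : ∀ i τ, I i m τ → I (i + 1) 0 τ)
    (hs : ∀ i < n, ∀ j < m, ∀ τ, τ.nat v 0 0 0 = i → τ.nat w 0 0 0 = j →
      Frame (forLT v e (forLT w f c)) σ τ → I i j τ → I i (j + 1) (c.run τ)) :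
    I n 0 ((forLT v e (forLT w f c)).run σ) := by
  obtain ⟨hok', hv11, hc11, hcv⟩ := ok_upto hok
  simp only [natWrites, List.append_nil] at hc11 hcv
  have hok'' : (forLT w f c).ok = true := by
    simpa [ok] using hok'
  refine run_forLT hok n hn he (fun i τ => I i 0 τ) (fun i τ x h => hv i 0 τ x h) h0
    (fun i hi τ h1 h2 h3 => hrow _ _ ?_)
  have hsub : ∀ υ, Frame (forLT w f c) τ υ → Frame (forLT v e (forLT w f c)) σ υ := fun υ h =>
    h2.trans (h.mono (by simp [forLT, natWrites]) (by simp [forLT, realWrites]))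
  refine run_forLT hok'' m ?_ (fun υ h => hf υ (hsub υ h)) (fun j υ => I i j υ)
    (fun j υ x h => hw i j υ x h) h3
    (fun j hj υ g1 g2 g3 => hs i hi j hj υ ?_ g1 (hsub υ g2) g3)
  · rw [frame_bound h2]
    · exact hm
    · simp only [forLT, natWrites, List.append_nil, List.mem_cons, not_or] at hc11 ⊢
      exact ⟨hv11.symm, hc11⟩
  · rw [g2.nat v hcv, h1]

/-- A double loop that establishes `P i j` in its pass `(i, j)`. -/
theorem run_forLT₂_fill {v w : ℕ} {e f : NExp} {c : BProg} {σ : Mem}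
    (hok : (forLT v e (forLT w f c)).ok = true)
    (n m : ℕ) (hn : n ≤ σ.nat 11 0 0 0) (hm : m ≤ σ.nat 11 0 0 0)
    (he : ∀ τ, Frame (forLT v e (forLT w f c)) σ τ → e.eval τ = n)
    (hf : ∀ τ, Frame (forLT v e (forLT w f c)) σ τ → f.eval τ = m)
    (P : ℕ → ℕ → Mem → Prop) (hv : ∀ i j τ x, P i j τ → P i j (τ.writeNat v 0 0 0 x))
    (hw : ∀ i j τ x, P i j τ → P i j (τ.writeNat w 0 0 0 x))
    (hs : ∀ i < n, ∀ j < m, ∀ τ, τ.nat v 0 0 0 = i → τ.nat w 0 0 0 = j →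
      Frame (forLT v e (forLT w f c)) σ τ → P i j (c.run τ) ∧
        ∀ i' < n, ∀ j' < m, (i', j') ≠ (i, j) → P i' j' τ → P i' j' (c.run τ)) :
    ∀ i < n, ∀ j < m, P i j ((forLT v e (forLT w f c)).run σ) := by
  have := run_forLT₂ hok n m hn hm he hf
    -- Rows before `i` are complete and row `i` is filled below `j`. The guards confine the claim to
    -- index pairs for which `hs` preserves `P`.
    (fun i j τ => i ≤ n → (∀ i' < i, ∀ j' < m, P i' j' τ) ∧ (j ≤ m → i < n → ∀ j' < j, P i j' τ))
    (fun i j τ x h hi => ⟨fun i' hi' j' hj' => hv _ _ _ _ ((h hi).1 i' hi' j' hj'),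
      fun hj hi' j' hj' => hv _ _ _ _ ((h hi).2 hj hi' j' hj')⟩)
    (fun i j τ x h hi => ⟨fun i' hi' j' hj' => hw _ _ _ _ ((h hi).1 i' hi' j' hj'),
      fun hj hi' j' hj' => hw _ _ _ _ ((h hi).2 hj hi' j' hj')⟩)
    (fun _ => ⟨fun i' hi' => absurd hi' (Nat.not_lt_zero _),
      fun _ _ j' hj' => absurd hj' (Nat.not_lt_zero _)⟩)
    (fun i τ h hi => ⟨fun i' hi' j' hj' => by
        rcases Nat.lt_succ_iff_lt_or_eq.1 hi' with h' | rfl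
        · exact (h (by omega)).1 i' h' j' hj'
        · exact (h (by omega)).2 le_rfl (by omega) j' hj',
      fun _ _ j' hj' => absurd hj' (Nat.not_lt_zero _)⟩)
    (fun i hi j hj τ h1 h2 h3 h4 hi' => by
      obtain ⟨g1, g2⟩ := hs i hi j hj τ h1 h2 h3
      refine ⟨fun i' hi' j' hj' =>
          g2 i' (by omega) j' hj' (fun h => ?_) ((h4 hi.le).1 i' hi' j' hj'),
        fun _ _ j' hj' => ?_⟩
      · rw [Prod.mk.injEq] at h
        omega
      · rcases Nat.lt_succ_iff_lt_or_eq.1 hj' with h' | rfl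
        · refine g2 i hi j' (by omega) (fun h => ?_) ((h4 hi.le).2 hj.le hi j' h')
          rw [Prod.mk.injEq] at h
          omega
        · exact g1)
  exact (this le_rfl).1

/-! ### The multiplication table -/

/-- The multiplication table of the numbers below the loop bound, in the integer array 13. -/
def mulTable : BProg :=
  forLT 16 (.var 11) (seq (setNat 12 zero zero zero zero)
    (forLT 17 (.var 11) (seq (setNat 13 (.var 16) (.var 17) zero (.var 12))
      (setNat 12 zero zero zero (.add (.var 12) (.var 16))))))

/-- Integer expressions have no product, so each row arises by repeated addition: variable 12 holds
`i * j` at the moment the entry `(i, j)` is written. -/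
theorem mulTable_spec (σ : Mem) {B : ℕ} (hB : σ.nat 11 0 0 0 = B) :
    ∀ x < B, ∀ y < B, (mulTable.run σ).nat 13 x y 0 = x * y := by
  refine run_forLT (σ := σ) (by decide) B hB.ge (fun τ h => ?_)
    (fun i τ => ∀ x < i, ∀ y < B, τ.nat 13 x y 0 = x * y) (fun i τ x h => ?_)
    (fun x hx => absurd hx (Nat.not_lt_zero x)) (fun i hi τ h1 h2 h3 => ?_)
  · simp only [NExp.eval, h.nat 11 (by decide), hB]
  · rw [Mem.writeNat_nat_of_ne _ (by decide)]
    exact h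
  · rw [run_seq]
    set υ := run (setNat 12 zero zero zero zero) τ with hυ
    have fυ := frame_run (setNat 12 zero zero zero zero) τ
    rw [← hυ] at fυ
    have := run_forLT (σ := υ) (v := 17) (e := .var 11)
      (c := seq (setNat 13 (.var 16) (.var 17) zero (.var 12))
        (setNat 12 zero zero zero (.add (.var 12) (.var 16)))) (by decide) B
      (by rw [fυ.nat 11 (by decide), h2.nat 11 (by decide), hB])
      (fun ω h => by
        simp only [NExp.eval, h.nat 11 (by decide), fυ.nat 11 (by decide), h2.nat 11 (by decide),
          hB])
      (fun j ω => ω.nat 12 0 0 0 = i * j ∧ (∀ x < i, ∀ y < B, ω.nat 13 x y 0 = x * y) ∧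
        ∀ y < j, ω.nat 13 i y 0 = i * y)
      (fun j ω x h => by simpa only [Mem.writeNat_nat_of_ne _ (show (12 : ℕ) ≠ 17 by decide),
        Mem.writeNat_nat_of_ne _ (show (13 : ℕ) ≠ 17 by decide)] using h)
      ⟨by simp [hυ, NExp.eval, Mem.writeNat],
        by rw [fυ.nat 13 (by decide)]; exact h3, fun y hy => absurd hy (Nat.not_lt_zero y)⟩
      (fun j hj ω g1 g2 ⟨g3, g4, g5⟩ => by
        have g6 : ω.nat 16 0 0 0 = i := by
          rw [g2.nat 16 (by decide), fυ.nat 16 (by decide), h1]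
        refine ⟨?_, fun x hx y hy => ?_, fun y hy => ?_⟩
        · simp [NExp.eval, Mem.writeNat, g3, g6]
          ring
        · have : x ≠ i := by omega
          simp [NExp.eval, Mem.writeNat, g6, this]
          exact g4 x hx y hy
        · simp [NExp.eval, Mem.writeNat, g6, g1, g3]
          split_ifs with hyj
          · rw [hyj]
          · exact g5 y (by omega))
    intro x hx y hy
    rcases Nat.lt_succ_iff_lt_or_eq.1 hx with h' | rfl
    · exact this.2.1 x h' y hy
    · exact this.2.2 y hy

/-- The product, read off from the multiplication table. -/
abbrev mulE (e f : NExp) : NExp := .get 13 e f zero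

/-- Set the loop bound to its square plus one, in the integer variable 12. -/
def squareProg : BProg :=
  seq (setNat 12 zero zero zero (.const 1)) (forLT 16 (.var 11) (forLT 17 (.var 11)
    (setNat 12 zero zero zero (.add (.var 12) (.const 1)))))

/-- The counter starts at one because the table covers only arguments strictly below the loop bound,
and arguments up to `s ^ 2` must be admitted. -/
theorem squareProg_spec (σ : Mem) {s : ℕ} (hs : σ.nat 11 0 0 0 = s) :
    (squareProg.run σ).nat 12 0 0 0 = s ^ 2 + 1 := by
  unfold squareProg
  rw [run_seq]
  set τ := run (setNat 12 zero zero zero (.const 1)) σ with hτ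
  have fτ := frame_run (setNat 12 zero zero zero (.const 1)) σ
  rw [← hτ] at fτ
  have h11 : τ.nat 11 0 0 0 = s := by rw [fτ.nat 11 (by decide), hs]
  have := run_forLT₂ (σ := τ) (v := 16) (w := 17) (e := .var 11) (f := .var 11)
    (c := setNat 12 zero zero zero (.add (.var 12) (.const 1))) (by decide) s s h11.ge h11.ge
    (fun υ h => by simp only [NExp.eval, h.nat 11 (by decide), h11])
    (fun υ h => by simp only [NExp.eval, h.nat 11 (by decide), h11])
    (fun i j υ => υ.nat 12 0 0 0 = i * s + j + 1)
    (fun i j υ x h => by simpa [Mem.writeNat] using h)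
    (fun i j υ x h => by simpa [Mem.writeNat] using h)
    (by simp [hτ, Mem.writeNat, NExp.eval])
    (fun i υ h => by rw [h]; ring)
    (fun i _ j _ υ _ _ _ h => by simp [Mem.writeNat, NExp.eval, h]; ring)
  rw [this]
  ring

/-! ### The separation oracle as a bounded program -/

/-- The memory is prepared for the separation oracle: the loop bound, the multiplication table
and the sizes of the selected example. -/
structure Ready (σ : Mem) (nV nE L p q : ℕ) : Prop where
  bound : (nV + nE + L + p + q) ^ 2 < σ.nat 11 0 0 0
  mul : ∀ x < σ.nat 11 0 0 0, ∀ y < σ.nat 11 0 0 0, σ.nat 13 x y 0 = x * y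
  hL : σ.nat 0 1 0 0 = L
  hp : σ.nat 0 2 0 0 = p
  hq : σ.nat 0 3 0 0 = q
  hV : σ.nat 1 (σ.nat 9 0 0 0) 0 0 = nV
  hE : σ.nat 2 (σ.nat 9 0 0 0) 0 0 = nE

theorem Ready.frame {σ τ : Mem} {nV nE L p q : ℕ} {c : BProg} (h : Ready σ nV nE L p q)
    (hf : Frame c σ τ) (hc : ∀ a ∈ [0, 1, 2, 9, 11, 13], a ∉ c.natWrites) :
    Ready τ nV nE L p q := by
  have h0 := hf.nat 0 (hc 0 (by decide))
  have h1 := hf.nat 1 (hc 1 (by decide))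
  have h2 := hf.nat 2 (hc 2 (by decide))
  have h9 := hf.nat 9 (hc 9 (by decide))
  have h11 := hf.nat 11 (hc 11 (by decide))
  have h13 := hf.nat 13 (hc 13 (by decide))
  constructor
  · rw [h11]; exact h.bound
  · rw [h11, h13]; exact h.mul
  · rw [h0]; exact h.hL
  · rw [h0]; exact h.hp
  · rw [h0]; exact h.hq
  · rw [h1, h9]; exact h.hV
  · rw [h2, h9]; exact h.hE

theorem Ready.mul_eq {σ : Mem} {nV nE L p q : ℕ} (h : Ready σ nV nE L p q) {x y : ℕ}
    (hx : x ≤ nV + nE + L + p + q) (hy : y ≤ (nV + nE + L + p + q) ^ 2) :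
    σ.nat 13 x y 0 = x * y := by
  have := h.bound
  refine h.mul x ?_ y (by omega)
  have : nV + nE + L + p + q ≤ (nV + nE + L + p + q) ^ 2 := Nat.le_self_pow (by decide) _
  omega

theorem Ready.le_bound {σ : Mem} {nV nE L p q : ℕ} (h : Ready σ nV nE L p q) {x : ℕ}
    (hx : x ≤ nV + nE + L + p + q) : x ≤ σ.nat 11 0 0 0 ∧ x ≤ (nV + nE + L + p + q) ^ 2 := by
  have := h.bound
  have : nV + nE + L + p + q ≤ (nV + nE + L + p + q) ^ 2 := Nat.le_self_pow (by decide) _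
  omega

/-- Quotient and remainder by `L` recover the pair from its flat number. -/
theorem flat_inj {L u u' k k' : ℕ} (hk : k < L) (hk' : k' < L) (h : u * L + k = u' * L + k') :
    u = u' ∧ k = k' := by
  have h1 : (u * L + k) / L = (u' * L + k') / L := by rw [h]
  have h2 : (u * L + k) % L = (u' * L + k') % L := by rw [h]
  rw [Nat.mul_comm, Nat.mul_comm u', Nat.mul_add_div (by omega), Nat.mul_add_div (by omega),
    Nat.div_eq_of_lt hk, Nat.div_eq_of_lt hk'] at h1
  rw [Nat.mul_add_mod', Nat.mul_add_mod', Nat.mod_eq_of_lt hk, Nat.mod_eq_of_lt hk'] at h2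
  exact ⟨h1, h2⟩

theorem flat_lt {L n u k : ℕ} (hu : u < n) (hk : k < L) : u * L + k < n * L := by
  calc u * L + k < u * L + L := by omega
    _ = (u + 1) * L := by ring
    _ ≤ n * L := Nat.mul_le_mul_right _ hu

/-- The number of labels. -/
abbrev labelsE : NExp := .get 0 (.const 1) zero zero

/-- The number of node features. -/
abbrev nodeFeatsE : NExp := .get 0 (.const 2) zero zero

/-- The number of edge features. -/
abbrev edgeFeatsE : NExp := .get 0 (.const 3) zero zero

/-- The number of nodes of the selected example. -/
abbrev nodesE : NExp := .get 1 (.var 9) zero zero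

/-- The number of edges of the selected example. -/
abbrev edgesE : NExp := .get 2 (.var 9) zero zero

/-- The gain of label `k` at node `u`, up to the loss of the empty labeling. -/
def nodeScore (σ : Mem) (nV p u k : ℕ) : ℝ :=
  (∑ a ∈ Finset.range p, σ.real 3 (a + p * k) 0 0 * σ.real 1 (σ.nat 9 0 0 0) u a) +
    (if σ.nat 5 (σ.nat 9 0 0 0) u 0 = k then -1 else 1) * (σ.real 0 1 0 0 / (2 * nV))

/-- The gain of the labels `k`, `l` at the ends of edge `e`. -/
def edgeScore (σ : Mem) (L p q e k l : ℕ) : ℝ :=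
  ∑ b ∈ Finset.range q,
    σ.real 3 (L * p + (b + q * (l + L * k))) 0 0 * σ.real 2 (σ.nat 9 0 0 0) e b

/-- `ρ / (2 |V|)`. -/
abbrev lossE : RExp :=
  .div (.get 0 (.const 1) zero zero) (.mul (.cast (.const 2)) (.cast nodesE))

/-- The summation of the node features. -/
def nodeSum : BProg :=
  sumTo 9 26 nodeFeatsE skip
    (.mul (.get 3 (.add (.var 26) (mulE nodeFeatsE (.var 22))) zero zero)
      (.get 1 (.var 9) (.var 21) (.var 26)))

/-- Store the gain of label `k` at node `u`. -/
def nodeBody : BProg :=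
  seq nodeSum
    (seq (setReal 7 (.add (mulE (.var 21) labelsE) (.var 22)) zero zero (.add (.var 9) lossE))
      (whenEq (.get 5 (.var 9) (.var 21) zero) (.var 22)
        (setReal 7 (.add (mulE (.var 21) labelsE) (.var 22)) zero zero (.sub (.var 9) lossE))))

theorem nodeBody_spec {τ : Mem} {nV nE L p q : ℕ} (h : Ready τ nV nE L p q)
    (hu : τ.nat 21 0 0 0 < nV) (hk : τ.nat 22 0 0 0 < L) (z : ℕ) :
    (nodeBody.run τ).real 7 z 0 0 =
      if z = τ.nat 21 0 0 0 * L + τ.nat 22 0 0 0 then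
        nodeScore τ nV p (τ.nat 21 0 0 0) (τ.nat 22 0 0 0) else τ.real 7 z 0 0 := by
  unfold nodeBody
  rw [run_seq]
  have h9 : (nodeSum.run τ).real 9 0 0 0 =
      ∑ a ∈ Finset.range p, τ.real 3 (a + p * τ.nat 22 0 0 0) 0 0 *
        τ.real 1 (τ.nat 9 0 0 0) (τ.nat 21 0 0 0) a := by
    refine run_sumTo (σ := τ) (by decide) (by decide) p (h.le_bound (by omega)).1
      (fun υ hf => ?_) _ (fun i hi υ g1 g2 => ?_)
    · simp only [NExp.eval, hf.nat 0 (by decide), h.hp]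
    · have e := h.mul_eq (x := p) (y := τ.nat 22 0 0 0) (by omega) (h.le_bound (by omega)).2
      simp only [run_skip, RExp.eval, NExp.eval, g2.nat 0 (by decide), h.hp,
        g2.nat 13 (by decide), g2.nat 22 (by decide), g2.nat 9 (by decide),
        g2.nat 21 (by decide), g2.real 3 (by decide), g2.real 1 (by decide), g1, e]
  have hf := frame_run nodeSum τ
  have hR := h.frame hf (by decide)
  set υ := nodeSum.run τ
  have e := h.mul_eq (x := τ.nat 21 0 0 0) (y := L) (by omega) (h.le_bound (by omega)).2
  have e1 := hf.nat 21 (by decide)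
  have e2 := hf.nat 22 (by decide)
  have e3 := hf.nat 13 (by decide)
  have e4 := hf.nat 9 (by decide)
  have e5 := hf.nat 5 (by decide)
  have e6 := hf.real 0 (by decide)
  have e7 := hf.real 7 (by decide)
  rw [run_seq, run_whenEq]
  unfold nodeScore
  by_cases hlab : τ.nat 5 (τ.nat 9 0 0 0) (τ.nat 21 0 0 0) 0 = τ.nat 22 0 0 0
  · simp [NExp.eval, RExp.eval, Mem.writeReal, e1, e2, e3, e4, e5, e6, e7, hR.hL, hlab, e, h9,
      ← h.hV, hf.nat 1 (by decide)]
    split_ifs <;> ring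
  · simp [NExp.eval, RExp.eval, Mem.writeReal, e1, e2, e3, e4, e5, e6, e7, hR.hL, hlab, e, h9,
      ← h.hV, hf.nat 1 (by decide)]

/-- Store the gains of all labels at all nodes. -/
def nodeProg : BProg := forLT 21 nodesE (forLT 22 labelsE nodeBody)

theorem nodeProg_spec {σ : Mem} {nV nE L p q : ℕ} (h : Ready σ nV nE L p q) :
    ∀ u < nV, ∀ k < L, (nodeProg.run σ).real 7 (u * L + k) 0 0 = nodeScore σ nV p u k := by
  refine run_forLT₂_fill (σ := σ) (by decide) nV L (h.le_bound (by omega)).1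
    (h.le_bound (by omega)).1 (fun τ hf => ?_) (fun τ hf => ?_)
    (fun u k τ => τ.real 7 (u * L + k) 0 0 = nodeScore σ nV p u k) (fun _ _ _ _ h => h)
    (fun _ _ _ _ h => h) (fun u hu k hk τ g1 g2 g3 => ?_)
  · exact (h.frame hf (by decide)).hV
  · exact (h.frame hf (by decide)).hL
  · have hR := h.frame g3 (by decide)
    have hb := nodeBody_spec hR (by omega) (by omega)
    have hscore : nodeScore τ nV p u k = nodeScore σ nV p u k := by
      simp only [nodeScore, g3.real 0 (by decide), g3.real 1 (by decide), g3.real 3 (by decide),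
        g3.nat 5 (by decide), g3.nat 9 (by decide)]
    simp only [g1, g2] at hb
    refine ⟨by rw [hb, if_pos rfl, hscore], fun u' hu' k' hk' hne h' => ?_⟩
    rw [hb, if_neg, h']
    intro he
    exact hne (by rw [(flat_inj hk' hk he).1, (flat_inj hk' hk he).2])

/-- Set all residual capacities to zero. -/
def zeroArcs : BProg :=
  forLT 19 (.var 14) (forLT 20 (.var 14) (setReal 8 (.var 19) (.var 20) zero (.cast zero)))

theorem zeroArcs_spec {σ : Mem} {n : ℕ} (hn : σ.nat 14 0 0 0 = n) (hB : n ≤ σ.nat 11 0 0 0) :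
    ∀ x < n, ∀ y < n, (zeroArcs.run σ).real 8 x y 0 = 0 := by
  refine run_forLT₂_fill (σ := σ) (by decide) n n hB hB (fun τ hf => ?_) (fun τ hf => ?_)
    (fun x y τ => τ.real 8 x y 0 = 0) (fun _ _ _ _ h => h)
    (fun _ _ _ _ h => h) (fun x hx y hy τ g1 g2 g3 => ?_)
  · simp only [NExp.eval, hf.nat 14 (by decide), hn]
  · simp only [NExp.eval, hf.nat 14 (by decide), hn]
  · refine ⟨by simp [Mem.writeReal, RExp.eval, NExp.eval, g1, g2], fun x' _ y' _ _ h' => ?_⟩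
    simp only [run_setReal, Mem.writeReal_real_self, RExp.eval, NExp.eval]
    split_ifs
    · simp
    · exact h'

/-- The summation of the edge features. -/
def edgeSum : BProg :=
  sumTo 9 25 edgeFeatsE skip
    (.mul (.get 3 (.add (mulE labelsE nodeFeatsE) (.add (.var 25)
        (mulE edgeFeatsE (.add (.var 23) (mulE labelsE (.var 22)))))) zero zero)
      (.get 2 (.var 9) (.var 24) (.var 25)))

theorem edgeSum_spec {τ : Mem} {nV nE L p q : ℕ} (h : Ready τ nV nE L p q)
    (hk : τ.nat 22 0 0 0 < L) (hl : τ.nat 23 0 0 0 < L) :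
    (edgeSum.run τ).real 9 0 0 0 =
      edgeScore τ L p q (τ.nat 24 0 0 0) (τ.nat 22 0 0 0) (τ.nat 23 0 0 0) := by
  unfold edgeScore
  refine run_sumTo (σ := τ) (by decide) (by decide) q (h.le_bound (by omega)).1
    (fun υ hf => ?_) _ (fun i hi υ g1 g2 => ?_)
  · simp only [NExp.eval, hf.nat 0 (by decide), h.hq]
  · have e1 := h.mul_eq (x := L) (y := p) (by omega) (h.le_bound (by omega)).2
    have e2 := h.mul_eq (x := L) (y := τ.nat 22 0 0 0) (by omega) (h.le_bound (by omega)).2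
    -- The second factor is itself the address `l + L * k` of a pair of labels, at most `L * L`;
    -- this is why the bound has to be quadratic in the size.
    have e3 := h.mul_eq (x := q) (y := τ.nat 23 0 0 0 + L * τ.nat 22 0 0 0) (by omega) (by
      have h1 : τ.nat 23 0 0 0 + L * τ.nat 22 0 0 0 ≤ L * L := by
        calc _ ≤ L + L * (L - 1) := by
              gcongr
              · exact Nat.le_sub_one_of_lt hk
          _ = L * L := by
              obtain ⟨m, rfl⟩ : ∃ m, L = m + 1 := ⟨L - 1, by omega⟩
              simp only [Nat.add_sub_cancel]
              ring
      have h2 : L * L ≤ (nV + nE + L + p + q) ^ 2 := by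
        rw [sq]
        gcongr <;> omega
      omega)
    simp only [run_skip, RExp.eval, NExp.eval, g2.nat 0 (by decide), h.hp, h.hL, h.hq,
      g2.nat 13 (by decide), g2.nat 22 (by decide), g2.nat 23 (by decide), g2.nat 9 (by decide),
      g2.nat 24 (by decide), g2.real 3 (by decide), g2.real 2 (by decide), g1, e1, e2, e3]

/-- Add the gain of the labels `k`, `l` at the ends of edge `e`. -/
def edgeBody : BProg :=
  seq edgeSum
    (seq (setNat 27 zero zero zero
      (.add (mulE (.get 3 (.var 9) (.var 24) zero) labelsE) (.var 22)))
    (seq (setNat 28 zero zero zero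
      (.add (mulE (.get 4 (.var 9) (.var 24) zero) labelsE) (.var 23)))
    (seq (setReal 7 (.var 27) zero zero (.add (.get 7 (.var 27) zero zero) (.var 9)))
      (setReal 8 (.var 27) (.var 28) zero (.add (.get 8 (.var 27) (.var 28) zero) (.var 9))))))

theorem edgeBody_spec {τ : Mem} {nV nE L p q : ℕ} (h : Ready τ nV nE L p q)
    (hk : τ.nat 22 0 0 0 < L) (hl : τ.nat 23 0 0 0 < L)
    (hs : τ.nat 3 (τ.nat 9 0 0 0) (τ.nat 24 0 0 0) 0 < nV)
    (ht : τ.nat 4 (τ.nat 9 0 0 0) (τ.nat 24 0 0 0) 0 < nV) :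
    let x := τ.nat 3 (τ.nat 9 0 0 0) (τ.nat 24 0 0 0) 0 * L + τ.nat 22 0 0 0
    let y := τ.nat 4 (τ.nat 9 0 0 0) (τ.nat 24 0 0 0) 0 * L + τ.nat 23 0 0 0
    let d := edgeScore τ L p q (τ.nat 24 0 0 0) (τ.nat 22 0 0 0) (τ.nat 23 0 0 0)
    (∀ z, (edgeBody.run τ).real 7 z 0 0 = τ.real 7 z 0 0 + if z = x then d else 0) ∧
      ∀ z z', (edgeBody.run τ).real 8 z z' 0 =
        τ.real 8 z z' 0 + if z = x ∧ z' = y then d else 0 := by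
  intro x y d
  unfold edgeBody
  rw [run_seq]
  have h9 := edgeSum_spec h hk hl
  have hf := frame_run edgeSum τ
  have hR := h.frame hf (by decide)
  set υ := edgeSum.run τ
  have e := h.mul_eq (x := τ.nat 3 (τ.nat 9 0 0 0) (τ.nat 24 0 0 0) 0) (y := L) (by omega)
    (h.le_bound (by omega)).2
  have e' := h.mul_eq (x := τ.nat 4 (τ.nat 9 0 0 0) (τ.nat 24 0 0 0) 0) (y := L) (by omega)
    (h.le_bound (by omega)).2
  constructor
  · intro z
    simp [NExp.eval, RExp.eval, Mem.writeReal, Mem.writeNat, hf.nat 22 (by decide),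
      hf.nat 3 (by decide), hf.nat 13 (by decide), hf.nat 9 (by decide),
      hf.nat 24 (by decide), hf.real 7 (by decide), hR.hL, e, h9]
    change (if z = x then τ.real 7 x 0 0 + d else _) = _ + if z = x then d else 0
    split_ifs with hz
    · rw [hz]
    · simp
  · intro z z'
    simp [NExp.eval, RExp.eval, Mem.writeReal, Mem.writeNat, hf.nat 22 (by decide),
      hf.nat 23 (by decide), hf.nat 3 (by decide), hf.nat 4 (by decide), hf.nat 13 (by decide),
      hf.nat 9 (by decide), hf.nat 24 (by decide), hf.real 8 (by decide), hR.hL, e, e', h9]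
    change (if z = x ∧ z' = y then τ.real 8 x y 0 + d else _) =
      _ + if z = x ∧ z' = y then d else 0
    split_ifs with hz
    · rw [hz.1, hz.2]
    · simp

end BProg

end SSVM

end

noncomputable section

/-! ### The oracle as a maximum of excess minus cut -/

namespace SSVM

/-- Since `y_x y_y = y_x - y_x (1 - y_y)`, a reward `d` for choosing both nodes amounts to an excess
`d` at `x` together with an arc of capacity `d` from `x` to `y`. Pairwise gains thus become flow
data. -/
theorem Flow.value_add {n x y : ℕ} {s s' : Flow} {d : ℝ} (hx : x < n) (hy : y < n)
    (he : ∀ z, s'.e z = s.e z + if z = x then d else 0)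
    (hr : ∀ z z', s'.r z z' = s.r z z' + if z = x ∧ z' = y then d else 0) (Y : ℕ → Bool) :
    s'.value n Y = s.value n Y + ind (Y x) * ind (Y y) * d := by
  have h1 : ∀ z ∈ Finset.range n, ∀ a ∈ Finset.range n,
      ind (Y z) * (1 - ind (Y a)) * s'.r z a = ind (Y z) * (1 - ind (Y a)) * s.r z a
      + (if a = y then (if z = x then ind (Y x) * (1 - ind (Y y)) * d else 0) else 0) := by
    intro z _ a _
    rw [hr]
    by_cases hzx : z = x <;> by_cases hay : a = y <;> simp [hzx, hay]
    ring
  have h2 : ∀ z ∈ Finset.range n, ind (Y z) * s'.e z =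
      ind (Y z) * s.e z + (if z = x then ind (Y x) * d else 0) := by
    intro z _
    rw [he]
    by_cases hzx : z = x <;> simp [hzx]
    ring
  have hx' : x ∈ Finset.range n := Finset.mem_range.2 hx
  have hy' : y ∈ Finset.range n := Finset.mem_range.2 hy
  unfold Flow.value
  rw [Finset.sum_congr rfl fun z hz => by rw [h2 z hz, Finset.sum_congr rfl (h1 z hz)]]
  simp only [Finset.sum_add_distrib, Finset.sum_sub_distrib, Finset.sum_ite_eq', hx', hy',
    if_true]
  ring

theorem sum_range_mul {M : Type} [AddCommMonoid M] (n L : ℕ) (g : ℕ → M) :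
    ∑ x ∈ Finset.range (n * L), g x =
      ∑ u ∈ Finset.range n, ∑ k ∈ Finset.range L, g (u * L + k) := by
  induction n with
  | zero => simp
  | succ n ih => rw [Nat.succ_mul, Finset.sum_range_add, ih, Finset.sum_range_succ]

namespace BProg

/-- The part of the gain that comes from the nodes. -/
def nodeGain (σ : Mem) (nV L p : ℕ) (Y : ℕ → Bool) : ℝ :=
  ∑ u ∈ Finset.range nV, ∑ k ∈ Finset.range L, ind (Y (u * L + k)) * nodeScore σ nV p u k

/-- The gain of the labels `k`, `l` at the ends of edge `e` in a labeling. -/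
def pairGain (σ : Mem) (L p q : ℕ) (Y : ℕ → Bool) (e k l : ℕ) : ℝ :=
  ind (Y (σ.nat 3 (σ.nat 9 0 0 0) e 0 * L + k)) * ind (Y (σ.nat 4 (σ.nat 9 0 0 0) e 0 * L + l)) *
    edgeScore σ L p q e k l

/-- The part of the gain that comes from the first `m` edges. -/
def edgeGain (σ : Mem) (L p q : ℕ) (Y : ℕ → Bool) (m : ℕ) : ℝ :=
  ∑ e ∈ Finset.range m, ∑ k ∈ Finset.range L, ∑ l ∈ Finset.range L, pairGain σ L p q Y e k l

/-- Add the gains of all pairs of labels at the ends of all edges. -/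
def edgeProg : BProg := forLT 24 edgesE (forLT 22 labelsE (forLT 23 labelsE edgeBody))

/-- Each run of the body adds one pairwise gain by `Flow.value_add`. Nonnegativity of the gains
keeps the capacities admissible for push-relabel; this is the place where supermodularity enters. -/
theorem edgeProg_spec {σ : Mem} {nV nE L p q : ℕ} (h : Ready σ nV nE L p q)
    (hs : ∀ e < nE, σ.nat 3 (σ.nat 9 0 0 0) e 0 < nV)
    (ht : ∀ e < nE, σ.nat 4 (σ.nat 9 0 0 0) e 0 < nV)
    (hpos : ∀ e < nE, ∀ k < L, ∀ l < L, 0 ≤ edgeScore σ L p q e k l)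
    (hr : ∀ x < nV * L, ∀ y < nV * L, 0 ≤ σ.real 8 x y 0) :
    (∀ Y, (edgeProg.run σ).flow.value (nV * L) Y =
      σ.flow.value (nV * L) Y + edgeGain σ L p q Y nE) ∧
    ∀ x < nV * L, ∀ y < nV * L, 0 ≤ (edgeProg.run σ).real 8 x y 0 := by
  have hval : ∀ (τ : Mem) (a i j k v : ℕ) (Y : ℕ → Bool),
      (τ.writeNat a i j k v).flow.value (nV * L) Y = τ.flow.value (nV * L) Y :=
    fun _ _ _ _ _ _ _ => rfl
  refine run_forLT (σ := σ) (by decide) nE (h.le_bound (by omega)).1 (fun τ hf => ?_)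
    (fun m τ => (∀ Y, τ.flow.value (nV * L) Y =
        σ.flow.value (nV * L) Y + edgeGain σ L p q Y m) ∧
      ∀ x < nV * L, ∀ y < nV * L, 0 ≤ τ.real 8 x y 0)
    (fun m τ x hI => hI) ⟨fun Y => by simp [edgeGain], hr⟩
    (fun e he τ g1 g2 ⟨g3, g4⟩ => ?_)
  · exact (h.frame hf (by decide)).hE
  · have hR := h.frame g2 (by decide)
    have key := run_forLT₂ (σ := τ) (v := 22) (w := 23) (e := labelsE) (f := labelsE)
      (c := edgeBody) (by decide) L L (hR.le_bound (by omega)).1 (hR.le_bound (by omega)).1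
      (fun υ hf => (hR.frame hf (by decide)).hL) (fun υ hf => (hR.frame hf (by decide)).hL)
      -- The value collects the edges before `e`, the full rows `k' < k` of label pairs, and the
      -- first `l` pairs of row `k`.
      (fun k l υ => k ≤ L → (∀ Y, υ.flow.value (nV * L) Y =
        σ.flow.value (nV * L) Y + edgeGain σ L p q Y e
          + (∑ k' ∈ Finset.range k, ∑ l' ∈ Finset.range L, pairGain σ L p q Y e k' l')
          + ∑ l' ∈ Finset.range l, pairGain σ L p q Y e k l') ∧
        ∀ x < nV * L, ∀ y < nV * L, 0 ≤ υ.real 8 x y 0)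
      (fun k l υ x hI => hI) (fun k l υ x hI => hI)
      (fun _ => ⟨fun Y => by simp [g3], g4⟩)
      (fun k υ hI hk => ⟨fun Y => by
        rw [(hI (by omega)).1, Finset.sum_range_succ, Finset.sum_range_zero]
        ring, (hI (by omega)).2⟩)
      (fun k hk l hl υ f1 f2 f3 f4 hk' => by
        obtain ⟨f5, f6⟩ := f4 hk'
        have hRυ := hR.frame f3 (by decide)
        have e24 : υ.nat 24 0 0 0 = e := by rw [f3.nat 24 (by decide), g1]
        have n9 : υ.nat 9 = σ.nat 9 := by rw [f3.nat 9 (by decide), g2.nat 9 (by decide)]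
        have n3 : υ.nat 3 = σ.nat 3 := by rw [f3.nat 3 (by decide), g2.nat 3 (by decide)]
        have n4 : υ.nat 4 = σ.nat 4 := by rw [f3.nat 4 (by decide), g2.nat 4 (by decide)]
        have r3 : υ.real 3 = σ.real 3 := by rw [f3.real 3 (by decide), g2.real 3 (by decide)]
        have r2 : υ.real 2 = σ.real 2 := by rw [f3.real 2 (by decide), g2.real 2 (by decide)]
        have hb := edgeBody_spec hRυ (by omega) (by omega)
          (by rw [n3, n9, e24]; exact hs e he) (by rw [n4, n9, e24]; exact ht e he)
        have hsc : edgeScore υ L p q e k l = edgeScore σ L p q e k l := by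
          simp only [edgeScore, n9, r3, r2]
        simp only [n3, n4, n9, e24, f1, f2, hsc] at hb
        refine ⟨fun Y => ?_, fun x hx y hy => ?_⟩
        · rw [Flow.value_add (s := υ.flow) (s' := (edgeBody.run υ).flow) (flat_lt (hs e he) hk)
              (flat_lt (ht e he) hl) hb.1 hb.2, f5,
            Finset.sum_range_succ _ l, pairGain]
          ring
        · rw [hb.2]
          have := hpos e he k hk l hl
          have := f6 x hx y hy
          split_ifs <;> linarith)
    obtain ⟨k1, k2⟩ := key le_rfl
    refine ⟨fun Y => ?_, k2⟩
    rw [k1, edgeGain, edgeGain, Finset.sum_range_succ _ e, Finset.sum_range_zero]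
    ring

/-- Write the labeling given by the nodes at or above the computed level. -/
def labelProg : BProg :=
  forLT 21 nodesE (forLT 22 labelsE
    (branch (.natLE (.var 31) (.get 15 (.add (mulE (.var 21) labelsE) (.var 22)) zero zero))
      (setNat 10 (.var 21) (.var 22) zero (.const 1))
      (setNat 10 (.var 21) (.var 22) zero zero)))

theorem labelProg_spec {σ : Mem} {nV nE L p q : ℕ} (h : Ready σ nV nE L p q) :
    ∀ u < nV, ∀ k < L, (labelProg.run σ).nat 10 u k 0 =
      if decide (σ.nat 31 0 0 0 ≤ σ.nat 15 (u * L + k) 0 0) then 1 else 0 := by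
  refine run_forLT₂_fill (σ := σ) (by decide) nV L (h.le_bound (by omega)).1
    (h.le_bound (by omega)).1 (fun τ hf => ?_) (fun τ hf => ?_)
    (fun u k τ => τ.nat 10 u k 0 =
      if decide (σ.nat 31 0 0 0 ≤ σ.nat 15 (u * L + k) 0 0) then 1 else 0)
    (fun _ _ _ _ h => by rw [Mem.writeNat_nat_of_ne _ (by decide)]; exact h)
    (fun _ _ _ _ h => by rw [Mem.writeNat_nat_of_ne _ (by decide)]; exact h)
    (fun u hu k hk τ g1 g2 g3 => ?_)
  · exact (h.frame hf (by decide)).hV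
  · exact (h.frame hf (by decide)).hL
  · have hR := h.frame g3 (by decide)
    have e := hR.mul_eq (x := u) (y := L) (by omega) (hR.le_bound (by omega)).2
    simp only [run_branch_natLE, NExp.eval, g1, g2, hR.hL, e, g3.nat 31 (by decide),
      g3.nat 15 (by decide)]
    refine ⟨?_, fun u' _ k' _ hne h' => ?_⟩
    · by_cases hc : σ.nat 31 0 0 0 ≤ σ.nat 15 (u * L + k) 0 0
      · simp [hc, Mem.writeNat, NExp.eval, g1, g2]
      · simp [hc, Mem.writeNat, NExp.eval, g1, g2]
    · have hne' : ¬ (u' = u ∧ k' = k ∧ True) := fun hh => hne (by rw [hh.1, hh.2.1])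
      rw [← h']
      split_ifs <;>
        simp only [run_setNat, Mem.writeNat_nat_self, NExp.eval, g1, g2, if_neg hne']

/-- The separation oracle for the example selected by the integer variable 9. -/
def oracleProg : BProg :=
  seq nodeProg (seq (setNat 14 zero zero zero (mulE nodesE labelsE))
    (seq zeroArcs (seq edgeProg (seq maxProg labelProg))))

/-- Once all gains are entered, the value of a node set is the gain of the labeling that it encodes,
and `maxProg` finds a best set. Competitors are functions on ℕ, which postpones the translation to
labelings of an example. -/
theorem oracleProg_spec {σ : Mem} {nV nE L p q : ℕ} (h : Ready σ nV nE L p q)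
    (hs : ∀ e < nE, σ.nat 3 (σ.nat 9 0 0 0) e 0 < nV)
    (ht : ∀ e < nE, σ.nat 4 (σ.nat 9 0 0 0) e 0 < nV)
    (hpos : ∀ e < nE, ∀ k < L, ∀ l < L, 0 ≤ edgeScore σ L p q e k l) :
    ∃ Y : ℕ → Bool,
      (∀ u < nV, ∀ k < L, (oracleProg.run σ).nat 10 u k 0 = if Y (u * L + k) then 1 else 0) ∧
      ∀ Z, nodeGain σ nV L p Z + edgeGain σ L p q Z nE ≤
        nodeGain σ nV L p Y + edgeGain σ L p q Y nE := by
  set σ₁ := nodeProg.run σ with h₁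
  set σ₂ := (setNat 14 zero zero zero (mulE nodesE labelsE)).run σ₁ with h₂
  set σ₃ := zeroArcs.run σ₂ with h₃
  set σ₄ := edgeProg.run σ₃ with h₄
  set σ₅ := maxProg.run σ₄ with h₅
  have hrun : oracleProg.run σ = labelProg.run σ₅ := rfl
  have f₁ : Frame _ σ σ₁ := frame_run nodeProg σ
  have f₂ : Frame _ σ₁ σ₂ := frame_run (setNat 14 zero zero zero (mulE nodesE labelsE)) σ₁
  have f₃ : Frame _ σ₂ σ₃ := frame_run zeroArcs σ₂
  have f₄ : Frame _ σ₃ σ₄ := frame_run edgeProg σ₃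
  have f₅ : Frame _ σ₄ σ₅ := frame_run maxProg σ₄
  have R₁ := h.frame f₁ (by decide)
  have R₂ := R₁.frame f₂ (by decide)
  have R₃ := R₂.frame f₃ (by decide)
  have R₄ := R₃.frame f₄ (by decide)
  have R₅ := R₄.frame f₅ (by decide)
  have hnode := nodeProg_spec h
  rw [← h₁] at hnode
  have hn₂ : σ₂.nat 14 0 0 0 = nV * L := by
    have e := R₁.mul_eq (x := nV) (y := L) (by omega) (h.le_bound (by omega)).2
    rw [h₂]
    simp [NExp.eval, Mem.writeNat, R₁.hV, R₁.hL, e]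
  have hn₄ : σ₄.nat 14 0 0 0 = nV * L := by
    rw [f₄.nat 14 (by decide), f₃.nat 14 (by decide), hn₂]
  have hle : nV * L ≤ (nV + nE + L + p + q) ^ 2 := by
    rw [sq]
    gcongr <;> omega
  have hzero := zeroArcs_spec hn₂ (hle.trans R₂.bound.le)
  rw [← h₃] at hzero
  have n3 : σ₃.nat 3 = σ.nat 3 := by
    rw [f₃.nat 3 (by decide), f₂.nat 3 (by decide), f₁.nat 3 (by decide)]
  have n4 : σ₃.nat 4 = σ.nat 4 := by
    rw [f₃.nat 4 (by decide), f₂.nat 4 (by decide), f₁.nat 4 (by decide)]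
  have n9 : σ₃.nat 9 = σ.nat 9 := by
    rw [f₃.nat 9 (by decide), f₂.nat 9 (by decide), f₁.nat 9 (by decide)]
  have r2 : σ₃.real 2 = σ.real 2 := by
    rw [f₃.real 2 (by decide), f₂.real 2 (by decide), f₁.real 2 (by decide)]
  have r3 : σ₃.real 3 = σ.real 3 := by
    rw [f₃.real 3 (by decide), f₂.real 3 (by decide), f₁.real 3 (by decide)]
  have hsc : ∀ e k l, edgeScore σ₃ L p q e k l = edgeScore σ L p q e k l := fun e k l => by
    simp only [edgeScore, n9, r3, r2]
  obtain ⟨hedge, hr₄⟩ := edgeProg_spec R₃ (by rw [n3, n9]; exact hs) (by rw [n4, n9]; exact ht)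
    (fun e he k hk l hl => by rw [hsc]; exact hpos e he k hk l hl)
    (fun x hx y hy => by rw [hzero x hx y hy])
  rw [← h₄] at hedge hr₄
  have hgain : ∀ Y, σ₄.flow.value (nV * L) Y =
      nodeGain σ nV L p Y + edgeGain σ L p q Y nE := by
    intro Y
    rw [hedge]
    congr 1
    -- Before the edges are entered all arcs are zero, so only the excesses count, and these are the
    -- node gains.
    · have e1 : σ₃.flow.value (nV * L) Y =
          ∑ x ∈ Finset.range (nV * L), ind (Y x) * σ₁.real 7 x 0 0 := by
        unfold Flow.value
        refine Finset.sum_congr rfl fun x hx => ?_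
        rw [Finset.sum_eq_zero fun y hy => ?_, sub_zero]
        · simp only [Mem.flow, f₃.real 7 (by decide), f₂.real 7 (by decide)]
        · rw [show σ₃.flow.r x y = 0 from
            hzero x (Finset.mem_range.1 hx) y (Finset.mem_range.1 hy), mul_zero]
      rw [e1, sum_range_mul, nodeGain]
      exact Finset.sum_congr rfl fun u hu => Finset.sum_congr rfl fun k hk => by
        rw [hnode u (Finset.mem_range.1 hu) k (Finset.mem_range.1 hk)]
    · simp only [edgeGain, pairGain, hsc, n3, n4, n9]
  refine ⟨fun x => decide (σ₅.nat 31 0 0 0 ≤ σ₅.nat 15 x 0 0), ?_, fun Z => ?_⟩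
  · rw [hrun]
    exact labelProg_spec R₅
  · have := maxProg_spec σ₄ hn₄ (by have := R₄.bound; omega) hr₄ Z
    rw [hgain, hgain] at this
    exact this

end BProg

end SSVM

end

noncomputable section

namespace SSVM

/-! ### The separation oracle in terms of the examples -/

theorem idxEquiv_inl {L p q : ℕ} (k : Fin L) (a : Fin p) :
    (idxEquiv L p q (Sum.inl (k, a)) : ℕ) = a + p * k := rfl

theorem idxEquiv_inr {L p q : ℕ} (k l : Fin L) (b : Fin q) :
    (idxEquiv L p q (Sum.inr ((k, l), b)) : ℕ) = L * p + (b + q * (l + L * k)) := rfl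

namespace Example

variable {L p q : ℕ}

theorem sum_mul_psi (x : Example L p q) (w : Idx L p q → ℝ) (y : x.Lab) :
    ∑ j, w j * x.psi y j =
      (∑ u, ∑ k, ind (y (u, k)) * ∑ a, w (Sum.inl (k, a)) * x.nodeFeat u a) +
      ∑ e, ∑ k, ∑ l, ind (y (x.src e, k)) * ind (y (x.tgt e, l)) *
        ∑ b, w (Sum.inr ((k, l), b)) * x.edgeFeat e b := by
  simp only [Fintype.sum_sum_type, Fintype.sum_prod_type, psi, Finset.mul_sum]
  congr 1
  · symm
    rw [Finset.sum_comm]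
    refine Finset.sum_congr rfl fun k _ => ?_
    rw [Finset.sum_comm]
    exact Finset.sum_congr rfl fun a _ => Finset.sum_congr rfl fun u _ => by ring
  · symm
    rw [Finset.sum_comm]
    refine Finset.sum_congr rfl fun k _ => ?_
    rw [Finset.sum_comm]
    refine Finset.sum_congr rfl fun l _ => ?_
    rw [Finset.sum_comm]
    exact Finset.sum_congr rfl fun b _ => Finset.sum_congr rfl fun e _ => by ring

/-- For bits, `[t ≠ y] = t + (1 - 2 t) y`: relative to the empty labeling, a correct label saves one
unit of loss and a wrong one costs a unit. -/
theorem loss_eq (x : Example L p q) (ρ : ℝ) (y : x.Lab) :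
    x.loss ρ y = ρ / (2 * (x.nV : ℝ)) * (∑ u, ∑ k, ind (x.truth (u, k))) +
      ∑ u, ∑ k, ind (y (u, k)) * ((if x.truth (u, k) then -1 else 1) *
        (ρ / (2 * (x.nV : ℝ)))) := by
  simp only [loss, Finset.mul_sum, ← Finset.sum_add_distrib]
  refine Finset.sum_congr rfl fun u _ => Finset.sum_congr rfl fun k _ => ?_
  cases x.truth (u, k) <;> cases y (u, k) <;> simp [ind]

theorem augScore_eq (x : Example L p q) (ρ : ℝ) (w : Idx L p q → ℝ) (y : x.Lab) :
    x.augScore ρ w y = ρ / (2 * (x.nV : ℝ)) * (∑ u, ∑ k, ind (x.truth (u, k))) +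
      ((∑ u, ∑ k, ind (y (u, k)) * ((∑ a, w (Sum.inl (k, a)) * x.nodeFeat u a) +
        (if x.truth (u, k) then -1 else 1) * (ρ / (2 * (x.nV : ℝ))))) +
      ∑ e, ∑ k, ∑ l, ind (y (x.src e, k)) * ind (y (x.tgt e, l)) *
        ∑ b, w (Sum.inr ((k, l), b)) * x.edgeFeat e b) := by
  rw [augScore, sum_mul_psi, loss_eq]
  simp only [mul_add, Finset.sum_add_distrib]
  ring

/-- A pairwise potential can be nonzero only if both labels are chosen, and then it is minus a sum
of products of nonnegative weights and features. -/
theorem binaryEnergy_submodular (x : Example L p q) (ρ : ℝ) (w : Idx L p q → ℝ)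
    (hw : ∀ j, 0 ≤ w (Sum.inr j)) : (x.binaryEnergy ρ w).Submodular := by
  intro e
  have : 0 ≤ ∑ c, w (Sum.inr (e.2, c)) * x.edgeFeat e.1 c :=
    Finset.sum_nonneg fun c _ => mul_nonneg (hw _) (x.edgeFeat_nonneg _ _)
  simp [binaryEnergy, ind]
  linarith

theorem binaryEnergy_energy (x : Example L p q) (ρ : ℝ) (w : Idx L p q → ℝ) (y : x.Lab) :
    (x.binaryEnergy ρ w).energy y = -x.augScore ρ w y := by
  rw [augScore, sum_mul_psi, loss, BinaryEnergy.energy]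
  simp only [binaryEnergy, Fintype.sum_prod_type, mul_neg, Finset.sum_sub_distrib,
    Finset.sum_neg_distrib, ← Finset.mul_sum]
  ring

end Example

namespace Training

variable {T : Training} {σ : Mem}

theorem Encoded.frame {τ : Mem} (h : T.Encoded σ) (hn : ∀ a < 7, τ.nat a = σ.nat a)
    (hr : ∀ a < 3, τ.real a = σ.real a) : T.Encoded τ := by
  have n0 := hn 0 (by decide)
  have r0 := hr 0 (by decide)
  constructor
  · rw [n0]; exact h.n
  · rw [n0]; exact h.L
  · rw [n0]; exact h.p
  · rw [n0]; exact h.q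
  · rw [hn 1 (by decide)]; exact h.nV
  · rw [hn 2 (by decide)]; exact h.nE
  · rw [hn 3 (by decide)]; exact h.src
  · rw [hn 4 (by decide)]; exact h.tgt
  · rw [hn 5 (by decide)]; exact h.label
  · rw [hn 6 (by decide)]; exact h.marks
  · rw [r0]; exact h.C
  · rw [r0]; exact h.ρ
  · rw [r0]; exact h.ε
  · rw [hr 1 (by decide)]; exact h.nodeFeat
  · rw [hr 2 (by decide)]; exact h.edgeFeat

theorem Encoded.frame_run {c : BProg} {τ : Mem} (h : T.Encoded σ) (hf : BProg.Frame c σ τ)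
    (hn : ∀ a < 7, a ∉ c.natWrites) (hr : ∀ a < 3, a ∉ c.realWrites) : T.Encoded τ :=
  h.frame (fun a ha => hf.nat a (hn a ha)) (fun a ha => hf.real a (hr a ha))

open BProg in
theorem Encoded.ready (h : T.Encoded σ) (i : Fin T.n) (hi : σ.nat 9 0 0 0 = i)
    (hB : (T.ex i).size ^ 2 < σ.nat 11 0 0 0)
    (hmul : ∀ x < σ.nat 11 0 0 0, ∀ y < σ.nat 11 0 0 0, σ.nat 13 x y 0 = x * y) :
    Ready σ (T.ex i).nV (T.ex i).nE T.L T.p T.q :=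
  ⟨hB, hmul, h.L, h.p, h.q, by rw [hi]; exact h.nV i, by rw [hi]; exact h.nE i⟩

open BProg in
theorem Encoded.nodeScore_eq (h : T.Encoded σ) {w : T.Weight} (hw : T.HoldsWeight σ w)
    (i : Fin T.n) (hi : σ.nat 9 0 0 0 = i) (u : Fin (T.ex i).nV) (k : Fin T.L) :
    nodeScore σ (T.ex i).nV T.p u k = (∑ a, w (Sum.inl (k, a)) * (T.ex i).nodeFeat u a) +
      (if (T.ex i).truth (u, k) then -1 else 1) * (T.ρ / (2 * ((T.ex i).nV : ℝ))) := by
  unfold nodeScore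
  rw [Finset.sum_range, h.ρ, hi, h.label i u]
  congr 1
  · refine Finset.sum_congr rfl fun a _ => ?_
    rw [h.nodeFeat i u a, ← hw (Sum.inl (k, a)), idxEquiv_inl]
  · simp [Example.truth, Fin.ext_iff]

open BProg in
theorem Encoded.edgeScore_eq (h : T.Encoded σ) {w : T.Weight} (hw : T.HoldsWeight σ w)
    (i : Fin T.n) (hi : σ.nat 9 0 0 0 = i) (e : Fin (T.ex i).nE) (k l : Fin T.L) :
    edgeScore σ T.L T.p T.q e k l =
      ∑ b, w (Sum.inr ((k, l), b)) * (T.ex i).edgeFeat e b := by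
  unfold edgeScore
  rw [Finset.sum_range, hi]
  refine Finset.sum_congr rfl fun b _ => ?_
  rw [h.edgeFeat i e b, ← hw (Sum.inr ((k, l), b)), idxEquiv_inr]

open BProg in
theorem Encoded.augScore_eq (h : T.Encoded σ) {w : T.Weight} (hw : T.HoldsWeight σ w)
    (i : Fin T.n) (hi : σ.nat 9 0 0 0 = i) (y : (T.ex i).Lab) (Y : ℕ → Bool)
    (hY : ∀ (u : Fin (T.ex i).nV) (k : Fin T.L), Y (u * T.L + k) = y (u, k)) :
    (T.ex i).augScore T.ρ w y =
      T.ρ / (2 * ((T.ex i).nV : ℝ)) * (∑ u, ∑ k, ind ((T.ex i).truth (u, k))) +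
        (nodeGain σ (T.ex i).nV T.L T.p Y + edgeGain σ T.L T.p T.q Y (T.ex i).nE) := by
  rw [Example.augScore_eq, nodeGain, edgeGain, Finset.sum_range, Finset.sum_range]
  congr 2
  · refine Finset.sum_congr rfl fun u _ => ?_
    rw [Finset.sum_range]
    exact Finset.sum_congr rfl fun k _ => by rw [hY, h.nodeScore_eq hw i hi u k]
  · refine Finset.sum_congr rfl fun e _ => ?_
    rw [Finset.sum_range]
    refine Finset.sum_congr rfl fun k _ => ?_
    rw [Finset.sum_range]
    refine Finset.sum_congr rfl fun l _ => ?_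
    rw [pairGain, hi, h.src i e, h.tgt i e, hY, hY, h.edgeScore_eq hw i hi e k l]

open BProg in
theorem Encoded.oracleProg_spec (h : T.Encoded σ) {w : T.Weight} (hw : T.HoldsWeight σ w)
    (hP : ∀ j ∈ T.P, 0 ≤ w j) (i : Fin T.n) (hi : σ.nat 9 0 0 0 = i)
    (hB : (T.ex i).size ^ 2 < σ.nat 11 0 0 0)
    (hmul : ∀ x < σ.nat 11 0 0 0, ∀ y < σ.nat 11 0 0 0, σ.nat 13 x y 0 = x * y) :
    ∃ y : (T.ex i).Lab, (T.ex i).IsOracle T.ρ w y ∧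
      ∀ (u : Fin (T.ex i).nV) (k : Fin T.L),
        (oracleProg.run σ).nat 10 u k 0 = if y (u, k) then 1 else 0 := by
  obtain ⟨Y, hY, hmax⟩ := BProg.oracleProg_spec (h.ready i hi hB hmul)
    (fun e he => by rw [hi, h.src i ⟨e, he⟩]; exact Fin.isLt _)
    (fun e he => by rw [hi, h.tgt i ⟨e, he⟩]; exact Fin.isLt _)
    (fun e he k hk l hl => by
      rw [h.edgeScore_eq hw i hi ⟨e, he⟩ ⟨k, hk⟩ ⟨l, hl⟩]
      exact Finset.sum_nonneg fun b _ => mul_nonneg (hP _ (T.pairwise_mem _))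
        ((T.ex i).edgeFeat_nonneg _ _))
  refine ⟨fun a => Y (a.1 * T.L + a.2), fun z => ?_, fun u k => hY u u.2 k k.2⟩
  -- The program is compared with functions on ℕ, so the competitor `z` is carried over along the
  -- injective flat numbering and extended by `false`.
  have hflat : ∃ Z : ℕ → Bool, ∀ (u : Fin (T.ex i).nV) (k : Fin T.L),
      Z (u * T.L + k) = z (u, k) := by
    classical
    refine ⟨fun x => if hx : ∃ a : Fin (T.ex i).nV × Fin T.L, (a.1 : ℕ) * T.L + a.2 = x
      then z hx.choose else false, fun u k => ?_⟩
    have hx : ∃ a : Fin (T.ex i).nV × Fin T.L, (a.1 : ℕ) * T.L + a.2 = u * T.L + k :=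
      ⟨(u, k), rfl⟩
    simp only [hx, dif_pos]
    have := flat_inj hx.choose.2.2 k.2 hx.choose_spec
    congr 1
    exact Prod.ext (Fin.ext this.1) (Fin.ext this.2)
  obtain ⟨Z, hZ⟩ := hflat
  rw [h.augScore_eq hw i hi z Z hZ, h.augScore_eq hw i hi _ Y fun u k => rfl]
  exact add_le_add le_rfl (hmax Z)

end Training

/-- `s ^ m + 3 ≤ 4 * s ^ m ≤ s ^ (m + 2)` for `s ≥ 2`, so the additive constant costs two in the
inner exponent. -/
theorem poly_bound (k m : ℕ) : ∃ c, ∀ s, 2 ≤ s → k * (s ^ m + 3) ^ k ≤ c * s ^ c := by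
  refine ⟨k + (m + 2) * k, fun s hs => ?_⟩
  have h1 : s ^ m + 3 ≤ s ^ (m + 2) := by
    have : 1 ≤ s ^ m := Nat.one_le_pow _ _ (by omega)
    have h4 : 4 ≤ s ^ 2 := Nat.pow_le_pow_left hs 2
    have := Nat.mul_le_mul_left (s ^ m) h4
    rw [pow_add]
    omega
  calc k * (s ^ m + 3) ^ k ≤ k * (s ^ (m + 2)) ^ k := by gcongr
    _ = k * s ^ ((m + 2) * k) := by rw [pow_mul]
    _ ≤ _ := by
      gcongr
      · omega
      · omega
      · omega

/-- The separation oracle as a stand-alone program. -/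
def oracleMain : Prog :=
  .seq (.setNat 11 (.const 0) (.const 0) (.const 0)
      (.add (.add (.add (.add BProg.nodesE BProg.edgesE) BProg.labelsE) BProg.nodeFeatsE)
        BProg.edgeFeatsE))
    (.seq BProg.squareProg.compile (.seq (.setNat 11 (.const 0) (.const 0) (.const 0) (.var 12))
      (BProg.seq BProg.mulTable BProg.oracleProg).compile))

open BProg in
theorem oracleMain_spec : ∃ c : ℕ, ∀ (S : QPSolver) (T : Training) (i : Fin T.n)
    (w : T.Weight) (σ : Mem),
    (∀ j ∈ T.P, 0 ≤ w j) → T.Encoded σ → T.HoldsWeight σ w → σ.nat 9 0 0 0 = i →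
    ∃ (y : (T.ex i).Lab) (σ' : Mem) (t : ℕ),
      Exec S oracleMain σ σ' t [] ∧ t ≤ c * (T.ex i).size ^ c ∧
      (T.ex i).IsOracle T.ρ w y ∧
      ∀ (u : Fin (T.ex i).nV) (k : Fin T.L), σ'.nat 10 u k 0 = if y (u, k) then 1 else 0 := by
  obtain ⟨k₁, hk₁⟩ := timeBound_poly squareProg
  obtain ⟨k₂, hk₂⟩ := timeBound_poly (seq mulTable oracleProg)
  obtain ⟨c, hc⟩ := poly_bound (100 + k₁ + k₂) 2
  refine ⟨c, fun S T i w σ hP hE hw hi => ?_⟩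
  set s := (T.ex i).size with hs
  set σ₁ := σ.writeNat 11 0 0 0 s with h₁
  have e₁ := Exec.setNat (S := S) σ 11 (.const 0) (.const 0) (.const 0)
    (.add (.add (.add (.add nodesE edgesE) labelsE) nodeFeatsE) edgeFeatsE)
  have hev : (NExp.add (.add (.add (.add nodesE edgesE) labelsE) nodeFeatsE) edgeFeatsE).eval σ
      = s := by
    simp only [NExp.eval, hi, hE.nV i, hE.nE i, hE.L, hE.p, hE.q]
    rfl
  rw [hev] at e₁
  simp only [NExp.eval] at e₁
  rw [← h₁] at e₁
  have b₁ : σ₁.nat 11 0 0 0 = s := by simp [h₁, Mem.writeNat]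
  obtain ⟨t₂, e₂, ht₂⟩ := exec_compile S (c := squareProg) (by decide) (by decide) σ₁
  set σ₂ := squareProg.run σ₁ with h₂
  have f₂ : Frame _ σ₁ σ₂ := frame_run squareProg σ₁
  have b₂ : σ₂.nat 12 0 0 0 = s ^ 2 + 1 := squareProg_spec σ₁ b₁
  have e₃ := Exec.setNat (S := S) σ₂ 11 (.const 0) (.const 0) (.const 0) (.var 12)
  simp only [NExp.eval, b₂] at e₃
  set σ₃ := σ₂.writeNat 11 0 0 0 (s ^ 2 + 1) with h₃
  have b₃ : σ₃.nat 11 0 0 0 = s ^ 2 + 1 := by simp [h₃, Mem.writeNat]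
  obtain ⟨t₄, e₄, ht₄⟩ := exec_compile S (c := seq mulTable oracleProg) (by decide) (by decide) σ₃
  set σ₄ := mulTable.run σ₃ with h₄
  have f₄ : Frame _ σ₃ σ₄ := frame_run mulTable σ₃
  have hn : ∀ a, a ≠ 11 → a ∉ squareProg.natWrites → a ∉ mulTable.natWrites →
      σ₄.nat a = σ.nat a := fun a ha ha' ha'' => by
    rw [f₄.nat a ha'', h₃, Mem.writeNat_nat_of_ne _ ha, f₂.nat a ha', h₁,
      Mem.writeNat_nat_of_ne _ ha]
  have hr : ∀ a, σ₄.real a = σ.real a := fun a => by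
    rw [f₄.real a (by simp [mulTable, forLT, realWrites]), h₃, Mem.writeNat_real,
      f₂.real a (by simp [squareProg, forLT, realWrites]), h₁, Mem.writeNat_real]
  have b₄ : σ₄.nat 11 0 0 0 = s ^ 2 + 1 := by rw [f₄.nat 11 (by decide), b₃]
  have hE₄ : T.Encoded σ₄ := hE.frame (fun a ha => hn a (by omega)
    (by revert a; decide) (by revert a; decide)) (fun a _ => hr a)
  obtain ⟨y, hy, hy'⟩ := hE₄.oracleProg_spec (w := w) (fun j => by rw [hr, hw j]) hP i
    (by rw [hn 9 (by decide) (by decide) (by decide), hi]) (by rw [b₄, ← hs]; omega)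
    (by
      have := mulTable_spec σ₃ rfl
      rw [b₃] at this
      rw [b₄]
      exact this)
  refine ⟨y, oracleProg.run σ₄, _, e₁.seq (e₂.seq (e₃.seq e₄)), ?_, hy, hy'⟩
  -- There is a node and it carries a label, so `nV` and `L` are positive.
  have hs2 : 2 ≤ s := by
    have h1 := (T.ex i).nV_pos
    have h2 : 0 < T.L := Fin.pos ((T.ex i).label ⟨0, h1⟩)
    rw [hs, Example.size]
    omega
  refine le_trans ?_ (hc s hs2)
  rw [b₁] at ht₂
  rw [b₃] at ht₄
  set k := 100 + k₁ + k₂ with hk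
  have p₁ : (s + 2) ^ k₁ ≤ (s ^ 2 + 3) ^ k := by
    calc (s + 2) ^ k₁ ≤ (s ^ 2 + 3) ^ k₁ := by
          gcongr
          · exact Nat.le_self_pow (by decide) s
          · omega
      _ ≤ _ := Nat.pow_le_pow_right (by omega) (by omega)
  have p₂ : (s ^ 2 + 1 + 2) ^ k₂ ≤ (s ^ 2 + 3) ^ k :=
    Nat.pow_le_pow_right (by omega) (by omega)
  have p₃ : 1 ≤ (s ^ 2 + 3) ^ k := Nat.one_le_pow _ _ (by omega)
  have q₁ := (ht₂.trans (hk₁ s)).trans (Nat.mul_le_mul_left k₁ p₁)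
  have q₂ := (ht₄.trans (hk₂ _)).trans (Nat.mul_le_mul_left k₂ p₂)
  have q₃ : k * (s ^ 2 + 3) ^ k =
      100 * (s ^ 2 + 3) ^ k + k₁ * (s ^ 2 + 3) ^ k + k₂ * (s ^ 2 + 3) ^ k := by
    rw [← add_mul, ← add_mul]
  simp only [NExp.time]
  omega

end SSVM

end

noncomputable section

namespace SSVM

/-! ### The number of iterations -/

/-- A sequence of optimality gaps that starts below `M / 2`. -/
theorem steps_le_of_small {e : ℕ → ℝ} {K : ℕ} {M x : ℝ} (hx : 0 < x) (hxM : 2 * x ≤ M)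
    (h0 : e 0 ≤ M / 2) (hpos : ∀ k < K, 0 ≤ e k)
    (hstep : ∀ k, k + 1 < K → ∃ z, e k ≤ z ∧ x ≤ z ∧
      ∀ μ : ℝ, 0 ≤ μ → μ ≤ 1 → e (k + 1) ≤ e k - (μ * z - μ ^ 2 * (M / 4))) :
    K ≤ ⌈2 * M / x⌉₊ := by
  have hM : 0 < M := by linarith
  -- With `z₀` in place of `z`, the gain is maximal at `μ = 2 * z₀ / M`, where it equals `z₀ ^ 2 /
  -- M`; `z₀ ≤ M / 2` keeps this `μ` at most one.
  have step : ∀ k, k + 1 < K → ∀ z₀, 0 ≤ z₀ → z₀ ≤ M / 2 → (z₀ ≤ e k ∨ z₀ ≤ x) →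
      e (k + 1) ≤ e k - z₀ ^ 2 / M := by
    intro k hk z₀ h1 h2 h3
    obtain ⟨z, hz1, hz2, hz3⟩ := hstep k hk
    have hz : z₀ ≤ z := h3.elim (fun h => h.trans hz1) (fun h => h.trans hz2)
    have h4 : 0 ≤ 2 * z₀ / M := by positivity
    have h5 := hz3 (2 * z₀ / M) h4 (by rw [div_le_one hM]; linarith)
    have h6 : 2 * z₀ / M * z₀ ≤ 2 * z₀ / M * z := mul_le_mul_of_nonneg_left hz h4
    have h7 : 2 * z₀ / M * z₀ - (2 * z₀ / M) ^ 2 * (M / 4) = z₀ ^ 2 / M := by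
      field_simp
      ring
    linarith
  -- The recursion `e' ≤ e - e² / M` gives the usual `1 / k` rate. The shift by two makes the base
  -- case the hypothesis `h0`, and `t - t² / M` is increasing up to `M / 2`.
  have claim1 : ∀ k < K, e k ≤ M / (k + 2) := by
    intro k
    induction k with
    | zero => intro _; simpa using h0
    | succ k ih =>
      intro hk
      have ih := ih (by omega)
      have hm : (0 : ℝ) < k + 2 := by positivity
      have hs : M / (k + 2) ≤ M / 2 :=
        div_le_div_of_nonneg_left hM.le (by norm_num) (by linarith [Nat.cast_nonneg (α := ℝ) k])
      have h1 := step k hk (e k) (hpos k (by omega)) (ih.trans hs) (Or.inl le_rfl)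
      have h2 : e k - e k ^ 2 / M ≤ M / (k + 2) - (M / (k + 2)) ^ 2 / M := by
        have : 0 ≤ (M / (k + 2) - e k) * (M - (M / (k + 2) + e k)) / M := by
          apply div_nonneg (mul_nonneg _ _) hM.le <;> linarith
        have e1 : (M / (k + 2) - e k) * (M - (M / (k + 2) + e k)) / M =
            M / (k + 2) - (M / (k + 2)) ^ 2 / M - (e k - e k ^ 2 / M) := by
          field_simp
          ring
        linarith
      have h3 : M / (k + 2) - (M / (k + 2)) ^ 2 / M ≤ M / (k + 3) := by
        have : M / ((k : ℝ) + 3) - (M / (k + 2) - (M / (k + 2)) ^ 2 / M) =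
            M / ((k + 3) * (k + 2) ^ 2) := by
          field_simp
          ring
        have : 0 ≤ M / (((k : ℝ) + 3) * (k + 2) ^ 2) := by positivity
        linarith
      push_cast
      rw [show (k : ℝ) + 1 + 2 = k + 3 by ring]
      linarith
  set n := M / x with hn
  have hn2 : 2 ≤ n := by rw [hn, le_div_iff₀ hx]; linarith
  have hceil : 2 ≤ ⌈n⌉₊ := by
    have : ((2 : ℕ) : ℝ) ≤ (⌈n⌉₊ : ℝ) := by
      push_cast
      exact hn2.trans (Nat.le_ceil n)
    exact_mod_cast this
  have hlt : (⌈n⌉₊ : ℝ) < n + 1 := Nat.ceil_lt_add_one (by linarith)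
  -- From index `j` on, the gap is at most `x`. Thereafter only `x ≤ z` is used, which gives the
  -- constant decrease `x ^ 2 / M`.
  obtain ⟨j, hj⟩ : ∃ j, ⌈n⌉₊ = j + 2 := ⟨⌈n⌉₊ - 2, by omega⟩
  have claim2 : ∀ i, j + i < K → e (j + i) ≤ x - i * (x ^ 2 / M) := by
    intro i
    induction i with
    | zero =>
      intro hi
      have h1 := claim1 j (by omega)
      have h2 : M / (j + 2) ≤ x := by
        rw [div_le_iff₀ (by positivity)]
        have : n ≤ j + 2 := by
          have := Nat.le_ceil n
          rw [hj] at this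
          exact_mod_cast this
        rw [hn, div_le_iff₀ hx] at this
        linarith
      simpa using h1.trans h2
    | succ i ih =>
      intro hi
      have h1 := step (j + i) hi x hx.le (by linarith) (Or.inr le_rfl)
      have h2 := ih (by omega)
      rw [← add_assoc]
      push_cast
      linarith
  -- Either `K ≤ j`, or `K = j + i + 1` with `i ≤ n`; as `j < n - 1`, the shift by two absorbs both
  -- the ceiling and the last step.
  have hfin : (K : ℝ) ≤ 2 * n := by
    rw [hj] at hlt
    push_cast at hlt
    by_cases hK : K ≤ j
    · have : (K : ℝ) ≤ j := by exact_mod_cast hK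
      linarith
    · obtain ⟨i, rfl⟩ : ∃ i, K = j + i + 1 := ⟨K - j - 1, by omega⟩
      have h1 := claim2 i (by omega)
      have h2 := hpos (j + i) (by omega)
      have h3 : (i : ℝ) ≤ n := by
        rw [hn, le_div_iff₀ hx]
        have h4 : (i : ℝ) * (x ^ 2 / M) ≤ x := by linarith
        have h5 : (i : ℝ) * (x ^ 2 / M) = i * x * x / M := by ring
        rw [h5, div_le_iff₀ hM] at h4
        nlinarith
      push_cast
      linarith
  have : (K : ℝ) ≤ 2 * M / x := by rw [hn] at hfin; rw [mul_div_assoc]; exact hfin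
  exact_mod_cast this.trans (Nat.le_ceil _)

/-- If `e 0 > M / 2`, one step with `μ = 1` brings the gap to at most `M / 4`, because `z ≥ e 0`.
The logarithmic term is then at least one and pays for this step. -/
theorem steps_le {e : ℕ → ℝ} {K : ℕ} {M x D : ℝ} (hx : 0 < x) (hxM : 2 * x ≤ M)
    (h0 : e 0 ≤ D) (hpos : ∀ k < K, 0 ≤ e k)
    (hstep : ∀ k, k + 1 < K → ∃ z, e k ≤ z ∧ x ≤ z ∧
      ∀ μ : ℝ, 0 ≤ μ → μ ≤ 1 → e (k + 1) ≤ e k - (μ * z - μ ^ 2 * (M / 4))) :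
    K ≤ ⌈Real.logb 2 (D / (M / 2))⌉₊ + ⌈2 * M / x⌉₊ := by
  have hM : 0 < M := by linarith
  rcases le_or_gt (e 0) (M / 2) with h | h
  · exact (steps_le_of_small hx hxM h hpos hstep).trans (Nat.le_add_left _ _)
  · have h1 : 0 < ⌈Real.logb 2 (D / (M / 2))⌉₊ := by
      rw [Nat.ceil_pos]
      apply Real.logb_pos (by norm_num)
      rw [one_lt_div (by linarith)]
      linarith
    have h2 : K - 1 ≤ ⌈2 * M / x⌉₊ := by
      rcases Nat.lt_or_ge 1 K with hK | hK
      · refine steps_le_of_small (e := fun k => e (k + 1)) hx hxM ?_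
          (fun k hk => hpos _ (by omega)) (fun k hk => hstep (k + 1) (by omega))
        obtain ⟨z, hz1, -, hz3⟩ := hstep 0 hK
        have := hz3 1 zero_le_one le_rfl
        simp only [zero_add] at this ⊢
        linarith
      · simp [Nat.sub_eq_zero_of_le hK]
    omega

/-- The norm and growth estimates below rest on nonnegative sums of squares; this expands them into
inner products, which are then treated as plain numbers. -/
theorem sum_sq_lin {ι : Type} [Fintype ι] (a b c : ℝ) (u v w : ι → ℝ) :
    ∑ j, (a * u j + b * v j + c * w j) ^ 2 =
      a ^ 2 * ∑ j, u j ^ 2 + b ^ 2 * ∑ j, v j ^ 2 + c ^ 2 * ∑ j, w j ^ 2 +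
      2 * a * b * ∑ j, u j * v j + 2 * a * c * ∑ j, u j * w j + 2 * b * c * ∑ j, v j * w j := by
  simp only [Finset.mul_sum, ← Finset.sum_add_distrib]
  exact Finset.sum_congr rfl fun j _ => by ring

/-! ### Losses, feature gaps and the quadratic program -/

namespace Example

variable {L p q : ℕ}

theorem loss_le (x : Example L p q) {ρ : ℝ} (hρ : 0 ≤ ρ) (y : x.Lab) :
    x.loss ρ y ≤ ρ * L / 2 := by
  have hV : (0 : ℝ) < x.nV := by exact_mod_cast x.nV_pos
  have h1 : (∑ u, ∑ k, if x.truth (u, k) ≠ y (u, k) then (1 : ℝ) else 0) ≤ x.nV * L := by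
    calc _ ≤ ∑ _u : Fin x.nV, ∑ _k : Fin L, (1 : ℝ) := by
          gcongr
          split_ifs <;> norm_num
      _ = _ := by simp
  calc x.loss ρ y ≤ ρ / (2 * (x.nV : ℝ)) * (x.nV * L) :=
        mul_le_mul_of_nonneg_left h1 (by positivity)
    _ = _ := by field_simp

theorem loss_truth (x : Example L p q) (ρ : ℝ) : x.loss ρ x.truth = 0 := by
  simp [loss]

end Example

namespace Training

variable {T : Training}

theorem avgLoss_le (y : T.Tuple) : T.avgLoss y ≤ T.ρ * T.L / 2 := by
  have hn : (0 : ℝ) < T.n := by exact_mod_cast T.n_pos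
  have h : ∑ i, (T.ex i).loss T.ρ (y i) ≤ T.n * (T.ρ * T.L / 2) := by
    calc _ ≤ ∑ _i : Fin T.n, T.ρ * T.L / 2 :=
          Finset.sum_le_sum fun i _ => (T.ex i).loss_le T.ρ_pos.le _
      _ = _ := by simp
  calc T.avgLoss y ≤ 1 / (T.n : ℝ) * (T.n * (T.ρ * T.L / 2)) :=
        mul_le_mul_of_nonneg_left h (by positivity)
    _ = _ := by field_simp

/-- In each coordinate, the square of an average is at most the average of the squares. -/
theorem sum_featGap_sq_le {R : ℝ} (hR : ∀ (i : Fin T.n) (y : (T.ex i).Lab),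
    ∑ j, ((T.ex i).psi (T.ex i).truth j - (T.ex i).psi y j) ^ 2 ≤ R ^ 2) (y : T.Tuple) :
    ∑ j, T.featGap y j ^ 2 ≤ R ^ 2 := by
  have hn : (0 : ℝ) < T.n := by exact_mod_cast T.n_pos
  have h1 : ∀ j, T.featGap y j ^ 2 ≤
      1 / (T.n : ℝ) * ∑ i, ((T.ex i).psi (T.ex i).truth j - (T.ex i).psi (y i) j) ^ 2 := by
    intro j
    have := sq_sum_le_card_mul_sum_sq (s := (Finset.univ : Finset (Fin T.n)))
      (f := fun i => (T.ex i).psi (T.ex i).truth j - (T.ex i).psi (y i) j)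
    rw [Finset.card_univ, Fintype.card_fin] at this
    unfold featGap
    rw [mul_pow]
    calc _ ≤ (1 / (T.n : ℝ)) ^ 2 * (T.n *
          ∑ i, ((T.ex i).psi (T.ex i).truth j - (T.ex i).psi (y i) j) ^ 2) :=
          mul_le_mul_of_nonneg_left this (by positivity)
      _ = _ := by field_simp
  calc _ ≤ ∑ j, 1 / (T.n : ℝ) *
        ∑ i, ((T.ex i).psi (T.ex i).truth j - (T.ex i).psi (y i) j) ^ 2 :=
        Finset.sum_le_sum fun j _ => h1 j
    _ = 1 / (T.n : ℝ) * ∑ i, ∑ j,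
        ((T.ex i).psi (T.ex i).truth j - (T.ex i).psi (y i) j) ^ 2 := by
        rw [← Finset.mul_sum, Finset.sum_comm]
    _ ≤ 1 / (T.n : ℝ) * ∑ _i : Fin T.n, R ^ 2 := by
        gcongr with i
        exact hR i (y i)
    _ = R ^ 2 := by
        rw [Finset.sum_const, Finset.card_univ, Fintype.card_fin, nsmul_eq_mul]
        field_simp

theorem feasible_zero (W : Set T.Tuple) : T.Feasible W (fun _ => 0) (T.ρ * T.L / 2) := by
  have := T.ρ_pos
  refine ⟨by positivity, fun y _ => ?_, fun _ _ => le_rfl⟩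
  simpa using avgLoss_le y

/-- On the sublevel set of the feasible point `(0, ρL/2)` the objective bounds `w` and `ξ`, so this
set is compact. Taking `W` arbitrary also covers the set of all tuples, whose optimum is the target
of the iteration. -/
theorem exists_isArgmin (W : Set T.Tuple) : ∃ w ξ, T.IsArgmin W w ξ := by
  set M := T.objective (fun _ => 0) (T.ρ * T.L / 2) with hM
  have hobj : Continuous fun z : T.Weight × ℝ => T.objective z.1 z.2 := by
    unfold objective
    fun_prop
  have hC := T.C_pos
  set A : Set (T.Weight × ℝ) := {z | T.Feasible W z.1 z.2 ∧ T.objective z.1 z.2 ≤ M} with hA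
  have hclosed : IsClosed A := by
    refine IsClosed.inter ?_ (isClosed_le hobj continuous_const)
    have : {z : T.Weight × ℝ | T.Feasible W z.1 z.2} = {z | 0 ≤ z.2} ∩
        ((⋂ y ∈ W, {z | T.avgLoss y - z.2 ≤ ∑ j, z.1 j * T.featGap y j}) ∩
          ⋂ j ∈ T.P, {z | 0 ≤ z.1 j}) := by
      ext z
      simp [Feasible]
    change IsClosed {z : T.Weight × ℝ | T.Feasible W z.1 z.2}
    rw [this]
    refine (isClosed_le continuous_const continuous_snd).inter
      ((isClosed_biInter fun y _ => isClosed_le (by fun_prop) (by fun_prop)).inter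
        (isClosed_biInter fun j _ => isClosed_le (by fun_prop) (by fun_prop)))
  have hsub : A ⊆
      (Set.univ.pi fun _ => Set.Icc (-(2 * M + 1)) (2 * M + 1)) ×ˢ Set.Icc 0 (M / T.C) := by
    rintro ⟨w, ξ⟩ ⟨hf, ho⟩
    have h0 := hf.1
    have h1 : 0 ≤ ∑ j, w j ^ 2 := Finset.sum_nonneg fun j _ => sq_nonneg _
    change 1 / 2 * ∑ j, w j ^ 2 + T.C * ξ ≤ M at ho
    change 0 ≤ ξ at h0
    refine ⟨fun j _ => ?_, h0, ?_⟩
    · have h2 : w j ^ 2 ≤ ∑ j, w j ^ 2 :=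
        Finset.single_le_sum (f := fun j => w j ^ 2) (fun j _ => sq_nonneg _) (Finset.mem_univ j)
      have h3 : w j ^ 2 ≤ 2 * M := by nlinarith
      change -(2 * M + 1) ≤ w j ∧ w j ≤ 2 * M + 1
      constructor <;> nlinarith
    · change ξ ≤ M / T.C
      rw [le_div_iff₀ hC]
      linarith
  have hcomp : IsCompact A :=
    ((isCompact_univ_pi fun _ => isCompact_Icc).prod isCompact_Icc).of_isClosed_subset
      hclosed hsub
  have hne : A.Nonempty := ⟨(fun _ => 0, T.ρ * T.L / 2), feasible_zero W, le_rfl⟩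
  obtain ⟨z, ⟨hf, ho⟩, hmin⟩ := hcomp.exists_isMinOn hne hobj.continuousOn
  refine ⟨z.1, z.2, hf, fun w' ξ' hf' => ?_⟩
  rcases le_or_gt (T.objective w' ξ') M with h | h
  · exact hmin (show (w', ξ') ∈ A from ⟨hf', h⟩)
  · exact le_trans ho h.le

theorem exists_oracle (i : Fin T.n) (w : T.Weight) :
    ∃ y : (T.ex i).Lab, (T.ex i).IsOracle T.ρ w y :=
  Finite.exists_max ((T.ex i).augScore T.ρ w)

theorem exists_step (s : T.State) (hs : T.Guard s) : ∃ s', T.Step s s' := by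
  obtain ⟨w, ξ, h⟩ := exists_isArgmin s.W
  choose y hy using fun i => exists_oracle (T := T) i w
  exact ⟨⟨s.W ∪ {y}, ((T.avgLoss y - ∑ j, w j * T.featGap y j : ℝ) : EReal), ξ, w⟩, hs, h, y, hy,
    rfl, rfl⟩

theorem Feasible.mono {W W' : Set T.Tuple} (h : W ⊆ W') {w : T.Weight} {ξ : ℝ}
    (hf : T.Feasible W' w ξ) : T.Feasible W w ξ :=
  ⟨hf.1, fun y hy => hf.2.1 y (h hy), hf.2.2⟩

/-- The first-order optimality condition. -/
theorem IsArgmin.variational {W : Set T.Tuple} {w w' : T.Weight} {ξ ξ' : ℝ}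
    (h : T.IsArgmin W w ξ) (h' : T.Feasible W w' ξ') :
    0 ≤ (∑ j, w j * w' j) - (∑ j, w j ^ 2) + T.C * (ξ' - ξ) := by
  set a := ∑ j, w j ^ 2 with ha
  set d := ∑ j, w j * w' j with hd
  set b := ∑ j, w' j ^ 2 with hb
  have hconv : ∀ t : ℝ, 0 ≤ t → t ≤ 1 →
      0 ≤ t * (d - a + T.C * (ξ' - ξ)) + t ^ 2 / 2 * (a - 2 * d + b) := by
    intro t h0 h1
    have hf : T.Feasible W (fun j => (1 - t) * w j + t * w' j) ((1 - t) * ξ + t * ξ') := by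
      obtain ⟨⟨f1, f2, f3⟩, -⟩ := h
      obtain ⟨g1, g2, g3⟩ := h'
      have h1' : 0 ≤ 1 - t := by linarith
      refine ⟨by positivity, fun y hy => ?_, fun j hj => ?_⟩
      · have e : ∑ j, ((1 - t) * w j + t * w' j) * T.featGap y j =
            (1 - t) * ∑ j, w j * T.featGap y j + t * ∑ j, w' j * T.featGap y j := by
          simp only [Finset.mul_sum, ← Finset.sum_add_distrib]
          exact Finset.sum_congr rfl fun j _ => by ring
        rw [e]
        nlinarith [mul_le_mul_of_nonneg_left (f2 y hy) h1', mul_le_mul_of_nonneg_left (g2 y hy) h0]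
      · have := f3 j hj
        have := g3 j hj
        positivity
    have := h.2 _ _ hf
    have e := sum_sq_lin (1 - t) t 0 w w' 0
    simp only [Pi.zero_apply, mul_zero, add_zero, Finset.sum_const_zero, ← ha, ← hb, ← hd] at e
    unfold objective at this
    rw [e, ← ha] at this
    nlinarith
  have hD : 0 ≤ a - 2 * d + b := by
    have := sum_sq_lin 1 (-1) 0 w w' 0
    have h2 : 0 ≤ ∑ j, (1 * w j + -1 * w' j + 0 * (0 : T.Weight) j) ^ 2 :=
      Finset.sum_nonneg fun j _ => sq_nonneg _
    rw [this] at h2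
    simp only [Pi.zero_apply, mul_zero, Finset.sum_const_zero, ← ha, ← hb, ← hd] at h2
    linarith
  by_contra! hA
  set A := d - a + T.C * (ξ' - ξ) with hA'
  set D := a - 2 * d + b
  -- A step so short that a negative linear term `A` would outweigh the quadratic one; `D + 1`
  -- avoids division by zero.
  set t := min 1 (-A / (D + 1)) with ht
  have ht0 : 0 < t := lt_min one_pos (div_pos (by linarith) (by linarith))
  have ht1 : t * (D + 1) ≤ -A := by
    rw [← le_div_iff₀ (by linarith)]
    exact min_le_right _ _
  have := hconv t ht0.le (min_le_left _ _)
  have h3 : 0 ≤ t * (A + t / 2 * D) := by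
    calc (0 : ℝ) ≤ _ := this
      _ = _ := by ring
  have h4 : 0 ≤ A + t / 2 * D := nonneg_of_mul_nonneg_right h3 ht0
  nlinarith

/-- Compare with the point `(0, ξ + m)`: by the optimality condition the extra slack costs at least
`‖w‖²`. With the `m` supplied by Young's inequality this becomes `‖w‖ ≤ CR`, without dual variables.
-/
theorem IsArgmin.sum_sq_le {W : Set T.Tuple} {w : T.Weight} {ξ R : ℝ} (h : T.IsArgmin W w ξ)
    (hR : ∀ y ∈ W, ∑ j, T.featGap y j ^ 2 ≤ R ^ 2) : ∑ j, w j ^ 2 ≤ T.C ^ 2 * R ^ 2 := by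
  have hC := T.C_pos
  set a := ∑ j, w j ^ 2 with ha
  have ha0 : 0 ≤ a := Finset.sum_nonneg fun j _ => sq_nonneg _
  -- `m` bounds the product of `w` with each feature gap `g` from `W`: expand `‖w - C g‖² ≥ 0`.
  set m := (a / T.C + T.C * R ^ 2) / 2 with hm
  have hm0 : 0 ≤ m := by positivity
  have hf : T.Feasible W (fun _ => 0) (ξ + m) := by
    refine ⟨add_nonneg h.1.1 hm0, fun y hy => ?_, fun _ _ => le_rfl⟩
    have h1 := h.1.2.1 y hy
    have h2 : ∑ j, w j * T.featGap y j ≤ m := by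
      have e := sum_sq_lin 1 (-T.C) 0 w (T.featGap y) 0
      have h3 : 0 ≤ ∑ j, (1 * w j + -T.C * T.featGap y j + 0 * (0 : T.Weight) j) ^ 2 :=
        Finset.sum_nonneg fun j _ => sq_nonneg _
      rw [e] at h3
      simp only [Pi.zero_apply, mul_zero, Finset.sum_const_zero, ← ha] at h3
      have h4 := hR y hy
      rw [hm, le_div_iff₀ (by norm_num), ← sub_nonneg]
      have h5 : 0 ≤ (a + T.C ^ 2 * R ^ 2 - 2 * T.C * ∑ j, w j * T.featGap y j) / T.C := by
        apply div_nonneg _ hC.le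
        nlinarith [mul_le_mul_of_nonneg_left h4 (sq_nonneg T.C)]
      calc 0 ≤ _ := h5
        _ = _ := by field_simp
    simp only [zero_mul, Finset.sum_const_zero]
    linarith
  have := h.variational hf
  simp only [mul_zero, Finset.sum_const_zero, ← ha] at this
  have e : T.C * (ξ + m - ξ) = a / 2 + T.C ^ 2 * R ^ 2 / 2 := by
    rw [hm]
    field_simp
    ring
  linarith

/-- The growth of the optimal value when a violated constraint is added. -/
theorem IsArgmin.growth {W W' : Set T.Tuple} (hW : W ⊆ W') {w w' : T.Weight} {ξ ξ' R : ℝ}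
    (h : T.IsArgmin W w ξ) (h' : T.Feasible W' w' ξ')
    (hR : ∀ y, ∑ j, T.featGap y j ^ 2 ≤ R ^ 2) {y : T.Tuple} (hy : y ∈ W') {μ : ℝ}
    (h0 : 0 ≤ μ) (h1 : μ ≤ 1) :
    T.objective w ξ + (μ * (T.C * (T.avgLoss y - (∑ j, w j * T.featGap y j) - ξ))
      - μ ^ 2 * (8 * R ^ 2 * T.C ^ 2 / 4)) ≤ T.objective w' ξ' := by
  have hC := T.C_pos
  have hV := h.variational (h'.mono hW)
  have ha := h.sum_sq_le (R := R) fun y _ => hR y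
  have hg := hR y
  have hc := h'.2.1 y hy
  -- With `g` the feature gap of `y`, the vector `(1 - μ) w + μ C g` is where a dual line search
  -- would move. Its squared distance to `w'` being nonnegative bounds `‖w'‖²` from below.
  have e1 := sum_sq_lin 1 (-(1 - μ)) (-(μ * T.C)) w' w (T.featGap y)
  have p1 : 0 ≤ ∑ j, (1 * w' j + -(1 - μ) * w j + -(μ * T.C) * T.featGap y j) ^ 2 :=
    Finset.sum_nonneg fun j _ => sq_nonneg _
  -- This controls the cross term: `‖w - C g‖² ≤ 2 ‖w‖² + 2 C² ‖g‖² ≤ 4 R² C²`, and half of it is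
  -- the coefficient `8 R² C² / 4`.
  have e2 := sum_sq_lin 1 T.C 0 w (T.featGap y) 0
  have p2 : 0 ≤ ∑ j, (1 * w j + T.C * T.featGap y j + 0 * (0 : T.Weight) j) ^ 2 :=
    Finset.sum_nonneg fun j _ => sq_nonneg _
  have e3 : ∑ j, w' j * w j = ∑ j, w j * w' j :=
    Finset.sum_congr rfl fun j _ => mul_comm _ _
  rw [e1, e3] at p1
  rw [e2] at p2
  simp only [Pi.zero_apply, mul_zero, Finset.sum_const_zero] at p2
  unfold objective
  generalize (∑ j, w j * T.featGap y j) = e at *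
  generalize (∑ j, w' j * T.featGap y j) = f at *
  generalize (∑ j, w j ^ 2) = a at *
  generalize (∑ j, w' j ^ 2) = b at *
  generalize (∑ j, T.featGap y j ^ 2) = c at *
  generalize (∑ j, w j * w' j) = d at *
  have q1 := mul_nonneg (sub_nonneg.2 h1) hV
  have q2 : 0 ≤ μ * T.C * (f - (T.avgLoss y - ξ')) := by
    have : 0 ≤ f - (T.avgLoss y - ξ') := by linarith
    positivity
  have q3 := mul_nonneg (sq_nonneg μ) p2
  have q4 : 0 ≤ μ ^ 2 * (T.C ^ 2 * R ^ 2 - a) :=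
    mul_nonneg (sq_nonneg μ) (by linarith)
  have q5 : 0 ≤ μ ^ 2 * T.C ^ 2 * (R ^ 2 - c) :=
    mul_nonneg (by positivity) (by linarith)
  nlinarith

theorem sum_featGap (y : T.Tuple) (w : T.Weight) :
    ∑ j, w j * T.featGap y j = 1 / (T.n : ℝ) *
      ∑ i, ((∑ j, w j * (T.ex i).psi (T.ex i).truth j) - ∑ j, w j * (T.ex i).psi (y i) j) := by
  simp only [featGap, Finset.mul_sum, ← Finset.sum_sub_distrib]
  rw [Finset.sum_comm]
  exact Finset.sum_congr rfl fun i _ => Finset.sum_congr rfl fun j _ => by ring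

/-- The oracle maximizes the violation. -/
theorem violation_le {w : T.Weight} {y : T.Tuple}
    (hy : ∀ i, (T.ex i).IsOracle T.ρ w (y i)) (z : T.Tuple) :
    T.avgLoss z - ∑ j, w j * T.featGap z j ≤ T.avgLoss y - ∑ j, w j * T.featGap y j := by
  have key : ∀ z : T.Tuple, T.avgLoss z - ∑ j, w j * T.featGap z j =
      1 / (T.n : ℝ) * ((∑ i, (T.ex i).augScore T.ρ w (z i)) -
        ∑ i, ∑ j, w j * (T.ex i).psi (T.ex i).truth j) := by
    intro z
    rw [sum_featGap, avgLoss]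
    simp only [Example.augScore, Finset.sum_add_distrib, Finset.sum_sub_distrib]
    ring
  rw [key, key]
  refine mul_le_mul_of_nonneg_left (sub_le_sub_right ?_ _) (by positivity)
  exact Finset.sum_le_sum fun i _ => hy i (z i)

/-- The parameters found in an iteration, with the slack given by the new violation, are feasible
for the full problem. -/
theorem feasible_of_oracle {W : Set T.Tuple} {w : T.Weight} {ξ : ℝ} (h : T.Feasible W w ξ)
    {y : T.Tuple} (hy : ∀ i, (T.ex i).IsOracle T.ρ w (y i)) :
    T.Feasible Set.univ w (T.avgLoss y - ∑ j, w j * T.featGap y j) := by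
  refine ⟨?_, fun z _ => ?_, h.2.2⟩
  -- The ground truth violates its own constraint by zero, so the largest violation is nonnegative.
  · have := violation_le hy fun i => (T.ex i).truth
    have e1 : T.avgLoss (fun i => (T.ex i).truth) = 0 := by
      simp [avgLoss, Example.loss_truth]
    have e2 : ∑ j, w j * T.featGap (fun i => (T.ex i).truth) j = 0 := by
      simp [featGap]
    rw [e1, e2, sub_zero] at this
    exact this
  · have := violation_le hy z
    linarith

/-- `steps_le` is applied to the gap between the optimum over all tuples and the value of the
program solved in iteration `k`. Here `M / 2 = 4R²C²`, the first gap is at most `CρL/2`, and `x =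
Cε`; a factor `C` cancels in both terms. -/
theorem iterations_le {R : ℝ}
    (hR : ∀ (i : Fin T.n) (y : (T.ex i).Lab),
      ∑ j, ((T.ex i).psi (T.ex i).truth j - (T.ex i).psi y j) ^ 2 ≤ R ^ 2)
    (hε : T.ε ≤ 4 * R ^ 2 * T.C) (s : ℕ → T.State) (K : ℕ) (hs : T.IsRun s K) :
    K ≤ ⌈Real.logb 2 ((T.ρ * T.L / 2) / (4 * R ^ 2 * T.C))⌉₊ + ⌈16 * R ^ 2 * T.C / T.ε⌉₊ := by
  have hC := T.C_pos
  have hε0 := T.ε_pos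
  have hR2 : 0 < R ^ 2 := by
    by_contra! h
    nlinarith
  have hgap := sum_featGap_sq_le hR
  obtain ⟨w₀, ξ₀, h₀⟩ := exists_isArgmin (T := T) Set.univ
  set f₀ := T.objective w₀ ξ₀ with hf₀
  have hmin : f₀ ≤ T.C * (T.ρ * T.L / 2) := by
    have h1 := h₀.2 _ _ (feasible_zero Set.univ)
    have h2 : T.objective (fun _ => 0) (T.ρ * T.L / 2) = T.C * (T.ρ * T.L / 2) := by
      simp [objective]
    rw [← h2]
    exact h1
  rcases Nat.eq_zero_or_pos K with hK | hK
  · omega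
  have key := steps_le (e := fun k => f₀ - T.objective (s (k + 1)).w (s (k + 1)).ξ) (K := K)
    (M := 8 * R ^ 2 * T.C ^ 2) (x := T.C * T.ε) (D := T.C * (T.ρ * T.L / 2)) (by positivity)
    (by nlinarith) ?_ ?_ ?_
  · have e1 : T.C * (T.ρ * T.L / 2) / (8 * R ^ 2 * T.C ^ 2 / 2) =
        (T.ρ * T.L / 2) / (4 * R ^ 2 * T.C) := by
      field_simp
      ring
    have e2 : 2 * (8 * R ^ 2 * T.C ^ 2) / (T.C * T.ε) = 16 * R ^ 2 * T.C / T.ε := by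
      field_simp
      ring
    rwa [e1, e2] at key
  · have h1 : 0 ≤ T.objective (s 1).w (s 1).ξ :=
      add_nonneg (mul_nonneg (by norm_num) (Finset.sum_nonneg fun j _ => sq_nonneg _))
        (mul_nonneg hC.le (hs.2 0 hK).2.1.1.1)
    simp only [zero_add]
    linarith
  · intro k hk
    have := (hs.2 k hk).2.1.2 _ _ (h₀.1.mono (Set.subset_univ _))
    exact sub_nonneg.2 this
  · intro k hk
    obtain ⟨-, h1, y, hy, hW, hη⟩ := hs.2 k (by omega)
    obtain ⟨hG, h2, -⟩ := hs.2 (k + 1) hk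
    set v := T.avgLoss y - (∑ j, (s (k + 1)).w j * T.featGap y j) - (s (k + 1)).ξ with hv
    -- That iteration `k + 1` takes place means that the violation found in iteration `k` exceeds
    -- `ε`. For the last iteration nothing of the kind is known, which is why `steps_le` asks for
    -- the recursion only when `k + 1 < K`.
    have hG' : T.ε < v := by
      unfold Guard at hG
      rw [hη, ← EReal.coe_sub, EReal.coe_lt_coe_iff] at hG
      exact hG
    refine ⟨T.C * v, ?_, by gcongr, fun μ m0 m1 => ?_⟩
    -- With slack `ξ + v` the current weights are feasible for all tuples, so `C v` is at least the
    -- gap.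
    · have := h₀.2 _ _ (feasible_of_oracle h1.1 hy)
      simp only [hf₀, objective] at this ⊢
      rw [hv]
      linarith
    · have := h1.growth (W' := (s (k + 1)).W) (by rw [hW]; exact Set.subset_union_left)
        h2.1 hgap (y := y) (by rw [hW]; exact Or.inr rfl) m0 m1
      rw [← hv] at this
      linarith

end Training

end SSVM

end

noncomputable section

namespace SSVM

/-! ### One iteration of the algorithm as a bounded program -/

/-- The memory contains the input, a large loop bound and the multiplication table. -/
structure Training.Prepared (T : Training) (σ : Mem) : Prop where
  enc : T.Encoded σ
  bound : T.size ^ 4 < σ.nat 11 0 0 0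
  mul : ∀ x < σ.nat 11 0 0 0, ∀ y < σ.nat 11 0 0 0, σ.nat 13 x y 0 = x * y

namespace Training

variable {T : Training} {σ : Mem}

theorem one_le_L (T : Training) : 1 ≤ T.L := by
  have i : Fin T.n := ⟨0, T.n_pos⟩
  exact Fin.pos ((T.ex i).label ⟨0, (T.ex i).nV_pos⟩)

theorem ex_size_le (T : Training) (i : Fin T.n) : (T.ex i).size ≤ T.size := by
  have : (T.ex i).nV + (T.ex i).nE ≤ ∑ i, ((T.ex i).nV + (T.ex i).nE) :=
    Finset.single_le_sum (f := fun i => (T.ex i).nV + (T.ex i).nE) (fun _ _ => Nat.zero_le _)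
      (Finset.mem_univ i)
  unfold Example.size size
  omega

theorem three_le_size (T : Training) : 3 ≤ T.size := by
  have i : Fin T.n := ⟨0, T.n_pos⟩
  have h1 := T.ex_size_le i
  have h2 : (T.ex i).nV + (T.ex i).nE ≤ ∑ i, ((T.ex i).nV + (T.ex i).nE) :=
    Finset.single_le_sum (f := fun i => (T.ex i).nV + (T.ex i).nE) (fun _ _ => Nat.zero_le _)
      (Finset.mem_univ i)
  have h3 := (T.ex i).nV_pos
  have h4 := T.n_pos
  have h5 := T.one_le_L
  unfold size
  omega

theorem Prepared.frame {τ : Mem} {c : BProg} (h : T.Prepared σ) (hf : BProg.Frame c σ τ)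
    (hn : ∀ a ∈ [0, 1, 2, 3, 4, 5, 6, 11, 13], a ∉ c.natWrites)
    (hr : ∀ a ∈ [0, 1, 2], a ∉ c.realWrites) : T.Prepared τ := by
  have h11 := hf.nat 11 (hn 11 (by decide))
  have h13 := hf.nat 13 (hn 13 (by decide))
  refine ⟨h.enc.frame_run hf (fun a ha => hn a ?_) (fun a ha => hr a ?_), ?_, ?_⟩
  · revert a
    decide
  · revert a
    decide
  · rw [h11]
    exact h.bound
  · rw [h11, h13]
    exact h.mul

theorem Prepared.le_bound (h : T.Prepared σ) {x : ℕ} (hx : x ≤ T.size ^ 3) :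
    x < σ.nat 11 0 0 0 := by
  have h1 := h.bound
  have h2 : T.size ^ 3 ≤ T.size ^ 4 :=
    Nat.pow_le_pow_right (by linarith [T.three_le_size]) (by decide)
  omega

theorem le_size_cube (T : Training) {x : ℕ} (hx : x ≤ T.size) : x ≤ T.size ^ 3 :=
  hx.trans (Nat.le_self_pow (by decide) _)

theorem le_size (T : Training) : T.n ≤ T.size ∧ T.L ≤ T.size ∧ T.p ≤ T.size ∧ T.q ≤ T.size := by
  unfold size
  omega

theorem ex_le_size (T : Training) (i : Fin T.n) :
    (T.ex i).nV ≤ T.size ∧ (T.ex i).nE ≤ T.size := by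
  have := T.ex_size_le i
  unfold Example.size at this
  omega

/-- `L p + L² q ≤ s² + s³ < s⁴` as `s ≥ 3`, so loops over all parameters fit under the loop bound.
-/
theorem dim_lt (T : Training) : dim T.L T.p T.q < T.size ^ 4 := by
  obtain ⟨-, hL, hp, hq⟩ := T.le_size
  have h3 := T.three_le_size
  set s := T.size
  calc dim T.L T.p T.q ≤ s * s + s * s * s := by
        unfold dim
        gcongr
    _ < s ^ 4 := by
        have h4 : 3 * (s * s * s) ≤ s * (s * s * s) := Nat.mul_le_mul_right _ h3
        have h5 : s * s * 1 ≤ s * s * s := Nat.mul_le_mul_left _ (by omega)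
        have h6 : 0 < s * s * s := by positivity
        have h7 : s ^ 4 = s * (s * s * s) := by ring
        omega

theorem Prepared.mul_eq (h : T.Prepared σ) {x y : ℕ} (hx : x ≤ T.size) (hy : y ≤ T.size ^ 3) :
    σ.nat 13 x y 0 = x * y :=
  h.mul x (h.le_bound (T.le_size_cube hx)) y (h.le_bound hy)

/-- The memory contains the labelings found by the oracle and the ground truth as numbers. -/
structure Labeled (T : Training) (σ : Mem) (y : T.Tuple) : Prop where
  lab : ∀ (i : Fin T.n) (u : Fin (T.ex i).nV) (k : Fin T.L),
    σ.nat 34 i u k = if y i (u, k) then 1 else 0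
  tru : ∀ (i : Fin T.n) (u : Fin (T.ex i).nV) (k : Fin T.L),
    σ.nat 35 i u k = if (T.ex i).truth (u, k) then 1 else 0

theorem Labeled.frame {τ : Mem} {c : BProg} {y : T.Tuple} (h : T.Labeled σ y)
    (hf : BProg.Frame c σ τ) (h34 : 34 ∉ c.natWrites) (h35 : 35 ∉ c.natWrites) :
    T.Labeled τ y := by
  constructor
  · rw [hf.nat 34 h34]
    exact h.lab
  · rw [hf.nat 35 h35]
    exact h.tru

theorem cast_bit (b : Bool) : (((if b then 1 else 0 : ℕ) : ℕ) : ℝ) = ind b := by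
  cases b <;> simp [ind]

end Training

namespace BProg

variable {T : Training} {σ : Mem}

/-- The number of examples. -/
abbrev examplesE : NExp := .get 0 (.const 0) zero zero

/-- Record the labeling of the selected example and its ground truth. -/
def copyBody : BProg :=
  seq (setNat 34 (.var 9) (.var 21) (.var 22) (.get 10 (.var 21) (.var 22) zero))
    (seq (setNat 35 (.var 9) (.var 21) (.var 22) zero)
      (whenEq (.get 5 (.var 9) (.var 21) zero) (.var 22)
        (setNat 35 (.var 9) (.var 21) (.var 22) (.const 1))))

/-- Record the labeling of the selected example and its ground truth at all nodes. -/
def copyProg : BProg := forLT 21 nodesE (forLT 22 labelsE copyBody)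

theorem copyBody_spec (τ : Mem) (i u k : ℕ) :
    (copyBody.run τ).nat 34 i u k =
      (if i = τ.nat 9 0 0 0 ∧ u = τ.nat 21 0 0 0 ∧ k = τ.nat 22 0 0 0 then
        τ.nat 10 (τ.nat 21 0 0 0) (τ.nat 22 0 0 0) 0 else τ.nat 34 i u k) ∧
    (copyBody.run τ).nat 35 i u k =
      (if i = τ.nat 9 0 0 0 ∧ u = τ.nat 21 0 0 0 ∧ k = τ.nat 22 0 0 0 then
        (if τ.nat 5 (τ.nat 9 0 0 0) (τ.nat 21 0 0 0) 0 = τ.nat 22 0 0 0 then 1 else 0)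
        else τ.nat 35 i u k) := by
  unfold copyBody
  rw [run_seq, run_seq, run_whenEq]
  by_cases h : τ.nat 5 (τ.nat 9 0 0 0) (τ.nat 21 0 0 0) 0 = τ.nat 22 0 0 0
  · simp [NExp.eval, Mem.writeNat, h]
    split_ifs <;> rfl
  · simp [NExp.eval, Mem.writeNat, h]

/-- The second part protects the records of the other examples, since the program runs once per
example. -/
theorem copyProg_spec (h : T.Prepared σ) (i : Fin T.n) (hi : σ.nat 9 0 0 0 = i) :
    (∀ (u : Fin (T.ex i).nV) (k : Fin T.L),
      (copyProg.run σ).nat 34 i u k = σ.nat 10 u k 0 ∧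
      (copyProg.run σ).nat 35 i u k = if (T.ex i).truth (u, k) then 1 else 0) ∧
    ∀ i' ≠ (i : ℕ), (copyProg.run σ).nat 34 i' = σ.nat 34 i' ∧
      (copyProg.run σ).nat 35 i' = σ.nat 35 i' := by
  have hbV := (h.le_bound (T.le_size_cube (T.ex_le_size i).1)).le
  have hbL := (h.le_bound (T.le_size_cube T.le_size.2.1)).le
  have hV : ∀ τ, Frame copyProg σ τ → nodesE.eval τ = (T.ex i).nV := fun τ hf => by
    simp only [NExp.eval, hf.nat 1 (by decide), hf.nat 9 (by decide), hi, h.enc.nV i]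
  have hL : ∀ τ, Frame copyProg σ τ → labelsE.eval τ = T.L := fun τ hf => by
    simp only [NExp.eval, hf.nat 0 (by decide), h.enc.L]
  constructor
  · have key := run_forLT₂_fill (σ := σ) (v := 21) (w := 22) (e := nodesE) (f := labelsE)
      (c := copyBody) (by decide) (T.ex i).nV T.L hbV hbL hV hL
      (fun u k τ => τ.nat 34 i u k = σ.nat 10 u k 0 ∧
        τ.nat 35 i u k = if σ.nat 5 i u 0 = k then 1 else 0)
      (fun _ _ _ _ h => by
        rw [Mem.writeNat_nat_of_ne _ (by decide), Mem.writeNat_nat_of_ne _ (by decide)]; exact h)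
      (fun _ _ _ _ h => by
        rw [Mem.writeNat_nat_of_ne _ (by decide), Mem.writeNat_nat_of_ne _ (by decide)]; exact h)
      (fun u _ k _ τ g1 g2 g3 => by
        have g3 : Frame copyProg σ τ := g3
        have n9 : τ.nat 9 0 0 0 = i := by rw [g3.nat 9 (by decide), hi]
        constructor
        · rw [(copyBody_spec τ i u k).1, (copyBody_spec τ i u k).2, n9, g1, g2,
            if_pos ⟨rfl, rfl, rfl⟩, if_pos ⟨rfl, rfl, rfl⟩, g3.nat 10 (by decide),
            g3.nat 5 (by decide)]
          exact ⟨rfl, rfl⟩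
        · intro u' _ k' _ hne h'
          have hne' : ¬ ((i : ℕ) = i ∧ u' = u ∧ k' = k) := fun hh => hne (by rw [hh.2.1, hh.2.2])
          rw [(copyBody_spec τ i u' k').1, (copyBody_spec τ i u' k').2, n9, g1, g2,
            if_neg hne', if_neg hne']
          exact h')
    intro u k
    obtain ⟨h1, h2⟩ := key u u.2 k k.2
    refine ⟨h1, h2.trans ?_⟩
    rw [h.enc.label i u]
    simp [Example.truth, Fin.ext_iff]
  · intro i' hi'
    refine run_forLT₂ (σ := σ) (v := 21) (w := 22) (e := nodesE) (f := labelsE)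
      (c := copyBody) (by decide) (T.ex i).nV T.L hbV hbL hV hL
      (fun _ _ τ => τ.nat 34 i' = σ.nat 34 i' ∧ τ.nat 35 i' = σ.nat 35 i')
      (fun _ _ _ _ h => by
        rw [Mem.writeNat_nat_of_ne _ (by decide), Mem.writeNat_nat_of_ne _ (by decide)]; exact h)
      (fun _ _ _ _ h => by
        rw [Mem.writeNat_nat_of_ne _ (by decide), Mem.writeNat_nat_of_ne _ (by decide)]; exact h)
      ⟨rfl, rfl⟩ (fun _ _ h => h) (fun u _ k _ τ _ _ g3 g4 => ?_)
    have g3 : Frame copyProg σ τ := g3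
    have n9 : τ.nat 9 0 0 0 = i := by rw [g3.nat 9 (by decide), hi]
    rw [← g4.1, ← g4.2]
    constructor
    · funext u' k'
      rw [(copyBody_spec τ i' u' k').1, n9, if_neg fun hh => hi' hh.1]
    · funext u' k'
      rw [(copyBody_spec τ i' u' k').2, n9, if_neg fun hh => hi' hh.1]

/-- Call the separation oracle on all examples. -/
def oraclesProg : BProg := forLT 9 examplesE (seq oracleProg copyProg)

/-- The invariant asserts only that some optimal labeling is recorded for each example treated so
far; the tuple is chosen after the loop. -/
theorem oraclesProg_spec (h : T.Prepared σ) {w : T.Weight} (hw : T.HoldsWeight σ w)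
    (hP : ∀ j ∈ T.P, 0 ≤ w j) :
    ∃ y : T.Tuple, (∀ i, (T.ex i).IsOracle T.ρ w (y i)) ∧ T.Labeled (oraclesProg.run σ) y := by
  have key := run_forLT (σ := σ) (v := 9) (e := examplesE) (c := seq oracleProg copyProg)
    (by decide) T.n (h.le_bound (T.le_size_cube T.le_size.1)).le
    (fun τ hf => by simp only [NExp.eval, hf.nat 0 (by decide), h.enc.n])
    (fun m τ => ∀ i : Fin T.n, (i : ℕ) < m → ∃ y : (T.ex i).Lab, (T.ex i).IsOracle T.ρ w y ∧
      ∀ (u : Fin (T.ex i).nV) (k : Fin T.L), τ.nat 34 i u k = (if y (u, k) then 1 else 0) ∧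
        τ.nat 35 i u k = if (T.ex i).truth (u, k) then 1 else 0)
    (fun m τ x hI => by
      rw [Mem.writeNat_nat_of_ne _ (by decide), Mem.writeNat_nat_of_ne _ (by decide)]
      exact hI)
    (fun i hi => absurd hi (Nat.not_lt_zero _))
    (fun m hm τ g1 g2 g3 i hi => by
      have hPτ := h.frame g2 (by decide) (by decide)
      have fo := frame_run oracleProg τ
      have hPo := hPτ.frame fo (by decide) (by decide)
      have n9 : (oracleProg.run τ).nat 9 0 0 0 = m := by rw [fo.nat 9 (by decide), g1]
      have hc := copyProg_spec hPo ⟨m, hm⟩ n9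
      rw [run_seq]
      rcases Nat.lt_succ_iff_lt_or_eq.1 hi with h' | h'
      · obtain ⟨c1, c2⟩ := hc.2 i (by simp; omega)
        rw [c1, c2, fo.nat 34 (by decide), fo.nat 35 (by decide)]
        exact g3 i h'
      · obtain rfl : i = ⟨m, hm⟩ := Fin.ext h'
        obtain ⟨y, hy, hy'⟩ := hPτ.enc.oracleProg_spec (w := w)
          (fun j => by rw [g2.real 3 (by decide), hw j]) hP ⟨m, hm⟩ g1
          (by
            have h1 := T.ex_size_le ⟨m, hm⟩
            refine hPτ.le_bound ?_
            calc (T.ex ⟨m, hm⟩).size ^ 2 ≤ T.size ^ 2 := by gcongr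
              _ ≤ T.size ^ 3 :=
                Nat.pow_le_pow_right (by linarith [T.three_le_size]) (by decide)) hPτ.mul
        exact ⟨y, hy, fun u k => ⟨(hc.1 u k).1.trans (hy' u k), (hc.1 u k).2⟩⟩)
  choose y hy using fun i : Fin T.n => key i i.2
  exact ⟨y, fun i => (hy i).1, fun i u k => ((hy i).2 u k).1, fun i u k => ((hy i).2 u k).2⟩

/-- The sum over all examples of the differences of the features with index `(k, a)`. -/
def unarySum : BProg :=
  sumTo 10 9 examplesE
    (sumTo 9 21 nodesE skip (.mul (.sub (.cast (.get 35 (.var 9) (.var 21) (.var 22)))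
      (.cast (.get 34 (.var 9) (.var 21) (.var 22)))) (.get 1 (.var 9) (.var 21) (.var 26))))
    (.var 9)

theorem unarySum_spec (h : T.Prepared σ) {y : T.Tuple} (hy : T.Labeled σ y) (k : Fin T.L)
    (a : Fin T.p) (hk : σ.nat 22 0 0 0 = k) (ha : σ.nat 26 0 0 0 = a) :
    (unarySum.run σ).real 10 0 0 0 / T.n = T.featGap y (Sum.inl (k, a)) := by
  have key := run_sumTo (σ := σ) (acc := 10) (v := 9) (e := examplesE) (term := .var 9)
    (inner := sumTo 9 21 nodesE skip (.mul (.sub (.cast (.get 35 (.var 9) (.var 21) (.var 22)))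
      (.cast (.get 34 (.var 9) (.var 21) (.var 22)))) (.get 1 (.var 9) (.var 21) (.var 26))))
    (by decide) (by decide) T.n (h.le_bound (T.le_size_cube T.le_size.1)).le
    (fun τ hf => by simp only [NExp.eval, hf.nat 0 (by decide), h.enc.n])
    (fun i => ∑ u ∈ Finset.range (σ.nat 1 i 0 0),
      ((σ.nat 35 i u k : ℝ) - σ.nat 34 i u k) * σ.real 1 i u a)
    (fun i hi τ g1 g2 => by
      have e1 := h.enc.nV ⟨i, hi⟩
      refine run_sumTo (σ := τ) (by decide) (by decide) _ ?_ (fun υ hf => ?_) _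
        (fun u hu υ f1 f2 => ?_)
      · rw [e1, g2.nat 11 (by decide)]
        exact (h.le_bound (T.le_size_cube (T.ex_le_size ⟨i, hi⟩).1)).le
      · simp only [NExp.eval, hf.nat 1 (by decide), hf.nat 9 (by decide), g1,
          g2.nat 1 (by decide)]
      · simp only [run_skip, RExp.eval, NExp.eval, f1, f2.nat 35 (by decide),
          f2.nat 34 (by decide), f2.nat 9 (by decide), f2.nat 22 (by decide),
          f2.nat 26 (by decide), f2.real 1 (by decide), g1, g2.nat 35 (by decide),
          g2.nat 34 (by decide), g2.nat 22 (by decide), g2.nat 26 (by decide),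
          g2.real 1 (by decide), hk, ha])
  have e : (unarySum.run σ).real 10 0 0 0 = _ := key
  rw [e, Training.featGap, div_eq_inv_mul, one_div, Finset.sum_range]
  congr 1
  refine Finset.sum_congr rfl fun i _ => ?_
  rw [h.enc.nV i, Finset.sum_range]
  simp only [Example.psi]
  rw [← Finset.sum_sub_distrib]
  refine Finset.sum_congr rfl fun u _ => ?_
  rw [hy.lab i u k, hy.tru i u k, h.enc.nodeFeat i u a, Training.cast_bit, Training.cast_bit]
  ring

/-- The sum over all examples of the differences of the features with index `((k, l), b)`. -/
def pairSum : BProg :=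
  sumTo 10 9 examplesE
    (sumTo 9 24 edgesE skip (.mul (.sub
      (.mul (.cast (.get 35 (.var 9) (.get 3 (.var 9) (.var 24) zero) (.var 22)))
        (.cast (.get 35 (.var 9) (.get 4 (.var 9) (.var 24) zero) (.var 23))))
      (.mul (.cast (.get 34 (.var 9) (.get 3 (.var 9) (.var 24) zero) (.var 22)))
        (.cast (.get 34 (.var 9) (.get 4 (.var 9) (.var 24) zero) (.var 23)))))
      (.get 2 (.var 9) (.var 24) (.var 25))))
    (.var 9)

theorem pairSum_spec (h : T.Prepared σ) {y : T.Tuple} (hy : T.Labeled σ y) (k l : Fin T.L)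
    (b : Fin T.q) (hk : σ.nat 22 0 0 0 = k) (hl : σ.nat 23 0 0 0 = l)
    (hb : σ.nat 25 0 0 0 = b) :
    (pairSum.run σ).real 10 0 0 0 / T.n = T.featGap y (Sum.inr ((k, l), b)) := by
  have key := run_sumTo (σ := σ) (acc := 10) (v := 9) (e := examplesE) (term := .var 9)
    (inner := sumTo 9 24 edgesE skip (.mul (.sub
      (.mul (.cast (.get 35 (.var 9) (.get 3 (.var 9) (.var 24) zero) (.var 22)))
        (.cast (.get 35 (.var 9) (.get 4 (.var 9) (.var 24) zero) (.var 23))))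
      (.mul (.cast (.get 34 (.var 9) (.get 3 (.var 9) (.var 24) zero) (.var 22)))
        (.cast (.get 34 (.var 9) (.get 4 (.var 9) (.var 24) zero) (.var 23)))))
      (.get 2 (.var 9) (.var 24) (.var 25))))
    (by decide) (by decide) T.n (h.le_bound (T.le_size_cube T.le_size.1)).le
    (fun τ hf => by simp only [NExp.eval, hf.nat 0 (by decide), h.enc.n])
    (fun i => ∑ e ∈ Finset.range (σ.nat 2 i 0 0),
      ((σ.nat 35 i (σ.nat 3 i e 0) k : ℝ) * σ.nat 35 i (σ.nat 4 i e 0) l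
        - (σ.nat 34 i (σ.nat 3 i e 0) k : ℝ) * σ.nat 34 i (σ.nat 4 i e 0) l) * σ.real 2 i e b)
    (fun i hi τ g1 g2 => by
      have e1 := h.enc.nE ⟨i, hi⟩
      refine run_sumTo (σ := τ) (by decide) (by decide) _ ?_ (fun υ hf => ?_) _
        (fun u hu υ f1 f2 => ?_)
      · rw [e1, g2.nat 11 (by decide)]
        exact (h.le_bound (T.le_size_cube (T.ex_le_size ⟨i, hi⟩).2)).le
      · simp only [NExp.eval, hf.nat 2 (by decide), hf.nat 9 (by decide), g1,
          g2.nat 2 (by decide)]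
      · simp only [run_skip, RExp.eval, NExp.eval, f1, f2.nat 35 (by decide),
          f2.nat 34 (by decide), f2.nat 9 (by decide), f2.nat 22 (by decide),
          f2.nat 23 (by decide), f2.nat 25 (by decide), f2.nat 3 (by decide),
          f2.nat 4 (by decide), f2.real 2 (by decide), g1, g2.nat 35 (by decide),
          g2.nat 34 (by decide), g2.nat 22 (by decide), g2.nat 23 (by decide),
          g2.nat 25 (by decide), g2.nat 3 (by decide), g2.nat 4 (by decide),
          g2.real 2 (by decide), hk, hl, hb])
  have e : (pairSum.run σ).real 10 0 0 0 = _ := key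
  rw [e, Training.featGap, div_eq_inv_mul, one_div, Finset.sum_range]
  congr 1
  refine Finset.sum_congr rfl fun i _ => ?_
  rw [h.enc.nE i, Finset.sum_range]
  simp only [Example.psi]
  rw [← Finset.sum_sub_distrib]
  refine Finset.sum_congr rfl fun e _ => ?_
  rw [h.enc.src i e, h.enc.tgt i e, hy.lab i _ k, hy.tru i _ k, hy.lab i _ l, hy.tru i _ l,
    h.enc.edgeFeat i e b]
  simp only [Training.cast_bit]
  ring

/-- The sum of the losses of all examples. -/
def lossSum : BProg :=
  sumTo 10 9 examplesE
    (sumTo 11 21 nodesE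
      (sumTo 9 22 labelsE skip (.mul
        (.sub (.cast (.get 35 (.var 9) (.var 21) (.var 22)))
          (.cast (.get 34 (.var 9) (.var 21) (.var 22))))
        (.sub (.cast (.get 35 (.var 9) (.var 21) (.var 22)))
          (.cast (.get 34 (.var 9) (.var 21) (.var 22))))))
      (.var 9))
    (.mul lossE (.var 11))

/-- For bits, the square of the difference is the indicator of disagreement, so the loss is computed
without branching. -/
theorem lossSum_spec (h : T.Prepared σ) {y : T.Tuple} (hy : T.Labeled σ y) :
    (lossSum.run σ).real 10 0 0 0 / T.n = T.avgLoss y := by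
  have key := run_sumTo (σ := σ) (acc := 10) (v := 9) (e := examplesE)
    (term := .mul lossE (.var 11))
    (inner := sumTo 11 21 nodesE
      (sumTo 9 22 labelsE skip (.mul
        (.sub (.cast (.get 35 (.var 9) (.var 21) (.var 22)))
          (.cast (.get 34 (.var 9) (.var 21) (.var 22))))
        (.sub (.cast (.get 35 (.var 9) (.var 21) (.var 22)))
          (.cast (.get 34 (.var 9) (.var 21) (.var 22))))))
      (.var 9))
    (by decide) (by decide) T.n (h.le_bound (T.le_size_cube T.le_size.1)).le
    (fun τ hf => by simp only [NExp.eval, hf.nat 0 (by decide), h.enc.n])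
    (fun i => σ.real 0 1 0 0 / (2 * (σ.nat 1 i 0 0 : ℝ)) * ∑ u ∈ Finset.range (σ.nat 1 i 0 0),
      ∑ k ∈ Finset.range T.L, ((σ.nat 35 i u k : ℝ) - σ.nat 34 i u k) *
        ((σ.nat 35 i u k : ℝ) - σ.nat 34 i u k))
    (fun i hi τ g1 g2 => by
      have e1 := h.enc.nV ⟨i, hi⟩
      have hs := run_sumTo (σ := τ) (acc := 11) (v := 21) (e := nodesE) (term := .var 9)
        (inner := sumTo 9 22 labelsE skip (.mul
          (.sub (.cast (.get 35 (.var 9) (.var 21) (.var 22)))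
            (.cast (.get 34 (.var 9) (.var 21) (.var 22))))
          (.sub (.cast (.get 35 (.var 9) (.var 21) (.var 22)))
            (.cast (.get 34 (.var 9) (.var 21) (.var 22))))))
        (by decide) (by decide) (σ.nat 1 i 0 0)
        (by
          rw [e1, g2.nat 11 (by decide)]
          exact (h.le_bound (T.le_size_cube (T.ex_le_size ⟨i, hi⟩).1)).le)
        (fun υ hf => by
          simp only [NExp.eval, hf.nat 1 (by decide), hf.nat 9 (by decide), g1,
            g2.nat 1 (by decide)])
        (fun u => ∑ k ∈ Finset.range T.L, ((σ.nat 35 i u k : ℝ) - σ.nat 34 i u k) *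
          ((σ.nat 35 i u k : ℝ) - σ.nat 34 i u k))
        (fun u hu υ f1 f2 => by
          refine run_sumTo (σ := υ) (by decide) (by decide) _ ?_ (fun ω hf => ?_) _
            (fun k hk ω k1 k2 => ?_)
          · rw [f2.nat 11 (by decide), g2.nat 11 (by decide)]
            exact (h.le_bound (T.le_size_cube T.le_size.2.1)).le
          · simp only [NExp.eval, hf.nat 0 (by decide), f2.nat 0 (by decide),
              g2.nat 0 (by decide), h.enc.L]
          · simp only [run_skip, RExp.eval, NExp.eval, k1, k2.nat 35 (by decide),
              k2.nat 34 (by decide), k2.nat 9 (by decide), k2.nat 21 (by decide), f1,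
              f2.nat 35 (by decide), f2.nat 34 (by decide), f2.nat 9 (by decide), g1,
              g2.nat 35 (by decide), g2.nat 34 (by decide)])
      have fs := frame_run (sumTo 11 21 nodesE
        (sumTo 9 22 labelsE skip (.mul
          (.sub (.cast (.get 35 (.var 9) (.var 21) (.var 22)))
            (.cast (.get 34 (.var 9) (.var 21) (.var 22))))
          (.sub (.cast (.get 35 (.var 9) (.var 21) (.var 22)))
            (.cast (.get 34 (.var 9) (.var 21) (.var 22))))))
        (.var 9)) τ
      simp only [RExp.eval, NExp.eval, hs, fs.nat 9 (by decide), fs.nat 1 (by decide),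
        fs.real 0 (by decide), g1, g2.nat 1 (by decide), g2.real 0 (by decide), Nat.cast_ofNat])
  have e : (lossSum.run σ).real 10 0 0 0 = _ := key
  rw [e, Training.avgLoss, div_eq_inv_mul, one_div, Finset.sum_range]
  congr 1
  refine Finset.sum_congr rfl fun i _ => ?_
  rw [h.enc.ρ, h.enc.nV i, Finset.sum_range, Example.loss]
  congr 1
  refine Finset.sum_congr rfl fun u _ => ?_
  rw [Finset.sum_range]
  refine Finset.sum_congr rfl fun k _ => ?_
  rw [hy.lab i u k, hy.tru i u k, Training.cast_bit, Training.cast_bit]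
  cases (T.ex i).truth (u, k) <;> cases y i (u, k) <;> simp [ind]

end BProg

end SSVM

end

noncomputable section

/-! ### Assembling the new constraint and testing for termination -/

namespace SSVM

namespace BProg

variable {T : Training} {σ : Mem}

/-- The place of the unary weight `(k, a)`. -/
abbrev unaryAddr : NExp := .add (.var 26) (mulE nodeFeatsE (.var 22))

/-- The place of the pairwise weight `((k, l), b)`. -/
abbrev pairAddr : NExp :=
  .add (mulE labelsE nodeFeatsE) (.add (.var 25)
    (mulE edgeFeatsE (.add (.var 23) (mulE labelsE (.var 22)))))

/-- The unary part of the new constraint, in the real array 12. -/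
def unaryProg : BProg :=
  forLT 22 labelsE (forLT 26 nodeFeatsE
    (seq unarySum (setReal 12 unaryAddr zero zero (.div (.var 10) (.cast examplesE)))))

theorem unaryProg_spec (h : T.Prepared σ) {y : T.Tuple} (hy : T.Labeled σ y) (k : Fin T.L)
    (a : Fin T.p) :
    (unaryProg.run σ).real 12 (idxEquiv T.L T.p T.q (Sum.inl (k, a))) 0 0 =
      T.featGap y (Sum.inl (k, a)) := by
  rw [idxEquiv_inl]
  have key := run_forLT₂_fill (σ := σ) (v := 22) (w := 26) (e := labelsE) (f := nodeFeatsE)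
    (c := seq unarySum (setReal 12 unaryAddr zero zero (.div (.var 10) (.cast examplesE))))
    (by decide) T.L T.p (h.le_bound (T.le_size_cube T.le_size.2.1)).le
    (h.le_bound (T.le_size_cube T.le_size.2.2.1)).le
    (fun τ hf => by simp only [NExp.eval, hf.nat 0 (by decide), h.enc.L])
    (fun τ hf => by simp only [NExp.eval, hf.nat 0 (by decide), h.enc.p])
    (fun k a τ => ∀ (hk : k < T.L) (ha : a < T.p),
      τ.real 12 (a + T.p * k) 0 0 = T.featGap y (Sum.inl (⟨k, hk⟩, ⟨a, ha⟩)))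
    (fun _ _ _ _ h => h) (fun _ _ _ _ h => h)
    (fun k hk a ha τ g1 g2 g3 => by
      have hP := h.frame g3 (by decide) (by decide)
      have hY := hy.frame g3 (by decide) (by decide)
      have fs := frame_run unarySum τ
      have e1 := hP.mul_eq (x := T.p) (y := k) T.le_size.2.2.1
        (T.le_size_cube (hk.le.trans T.le_size.2.1))
      have addr : unaryAddr.eval (unarySum.run τ) = a + T.p * k := by
        simp only [NExp.eval, fs.nat 26 (by decide), fs.nat 22 (by decide),
          fs.nat 13 (by decide), fs.nat 0 (by decide), hP.enc.p, g1, g2, e1]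
      constructor
      · intro _ _
        have := unarySum_spec hP hY ⟨k, hk⟩ ⟨a, ha⟩ g1 g2
        simp only [run_seq, run_setReal, addr]
        simp only [NExp.eval, Mem.writeReal_real_self, and_self, if_true, RExp.eval,
          fs.nat 0 (by decide), hP.enc.n]
        exact this
      · intro k' hk' a' ha' hne h' hk'' ha''
        simp only [run_seq, run_setReal, addr]
        simp only [NExp.eval, Mem.writeReal_real_self]
        rw [if_neg, fs.real 12 (by decide)]
        · exact h' hk'' ha''
        · rintro ⟨he, -⟩
          have := flat_inj (L := T.p) (u := k') (u' := k) ha' ha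
            (by rw [mul_comm k', mul_comm k]; omega)
          exact hne (by rw [this.1, this.2]))
  exact key k k.2 a a.2 k.2 a.2

/-- The pairwise part of the new constraint, in the real array 13. -/
def pairProg : BProg :=
  forLT 22 labelsE (forLT 23 labelsE (forLT 25 edgeFeatsE
    (seq pairSum (setReal 13 pairAddr zero zero (.div (.var 10) (.cast examplesE))))))

/-- All other addresses are recorded as untouched, because the loops over `k` and `l` have to keep
the blocks already written. -/
theorem pairRow_spec (h : T.Prepared σ) {y : T.Tuple} (hy : T.Labeled σ y) (k l : Fin T.L)
    (hk : σ.nat 22 0 0 0 = k) (hl : σ.nat 23 0 0 0 = l) :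
    (∀ b : Fin T.q, ((forLT 25 edgeFeatsE
      (seq pairSum (setReal 13 pairAddr zero zero (.div (.var 10) (.cast examplesE))))).run
        σ).real 13 (T.L * T.p + (b + T.q * (l + T.L * k))) 0 0 =
        T.featGap y (Sum.inr ((k, l), b))) ∧
    ∀ z, (∀ b < T.q, z ≠ T.L * T.p + (b + T.q * (l + T.L * k))) →
      ((forLT 25 edgeFeatsE
        (seq pairSum (setReal 13 pairAddr zero zero (.div (.var 10) (.cast examplesE))))).run
          σ).real 13 z 0 0 = σ.real 13 z 0 0 := by
  have key := run_forLT (σ := σ) (v := 25) (e := edgeFeatsE)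
    (c := seq pairSum (setReal 13 pairAddr zero zero (.div (.var 10) (.cast examplesE))))
    (by decide) T.q (h.le_bound (T.le_size_cube T.le_size.2.2.2)).le
    (fun τ hf => by simp only [NExp.eval, hf.nat 0 (by decide), h.enc.q])
    (fun m τ => (∀ b : Fin T.q, (b : ℕ) < m →
        τ.real 13 (T.L * T.p + (b + T.q * (l + T.L * k))) 0 0 =
          T.featGap y (Sum.inr ((k, l), b))) ∧
      ∀ z, (∀ b < T.q, z ≠ T.L * T.p + (b + T.q * (l + T.L * k))) →
        τ.real 13 z 0 0 = σ.real 13 z 0 0)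
    (fun _ _ _ h => h) ⟨fun b hb => absurd hb (Nat.not_lt_zero _), fun _ _ => rfl⟩
    (fun m hm τ g1 g2 ⟨g3, g4⟩ => by
      have hP := h.frame g2 (by decide) (by decide)
      have hY := hy.frame g2 (by decide) (by decide)
      have fs := frame_run pairSum τ
      obtain ⟨-, sL, sp, sq⟩ := T.le_size
      have e1 := hP.mul_eq (x := T.L) (y := T.p) sL (T.le_size_cube sp)
      have e2 := hP.mul_eq (x := T.L) (y := k) sL (T.le_size_cube (k.2.le.trans sL))
      have e3 := hP.mul_eq (x := T.q) (y := l + T.L * k) sq (by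
        calc (l : ℕ) + T.L * k ≤ T.size + T.size * T.size := by
              gcongr
              · exact l.2.le.trans sL
              · exact k.2.le.trans sL
          _ ≤ T.size ^ 3 := by
              have h3 := T.three_le_size
              have h4 : T.size * 1 ≤ T.size * T.size := Nat.mul_le_mul_left _ (by omega)
              have h5 : 3 * (T.size * T.size) ≤ T.size * (T.size * T.size) :=
                Nat.mul_le_mul_right _ h3
              have h6 : T.size ^ 3 = T.size * (T.size * T.size) := by ring
              omega)
      have n22 : τ.nat 22 0 0 0 = k := by rw [g2.nat 22 (by decide), hk]
      have n23 : τ.nat 23 0 0 0 = l := by rw [g2.nat 23 (by decide), hl]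
      have addr : pairAddr.eval (pairSum.run τ) =
          T.L * T.p + (m + T.q * (l + T.L * k)) := by
        simp only [NExp.eval, fs.nat 25 (by decide), fs.nat 22 (by decide),
          fs.nat 23 (by decide), fs.nat 13 (by decide), fs.nat 0 (by decide), hP.enc.p,
          hP.enc.L, hP.enc.q, g1, n22, n23, e1, e2, e3]
      have hs := pairSum_spec hP hY k l ⟨m, hm⟩ n22 n23 g1
      simp only [run_seq, run_setReal, addr]
      simp only [NExp.eval, Mem.writeReal_real_self, and_true, RExp.eval,
        fs.nat 0 (by decide), hP.enc.n]
      refine ⟨fun b hb => ?_, fun z hz => ?_⟩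
      · split_ifs with hc
        · obtain rfl : b = ⟨m, hm⟩ := Fin.ext (by simp only; omega)
          exact hs
        · rw [fs.real 13 (by decide)]
          refine g3 b ?_
          have : (b : ℕ) ≠ m := fun h' => hc (by rw [h'])
          omega
      · rw [if_neg (hz m hm), fs.real 13 (by decide)]
        exact g4 z hz)
  exact ⟨fun b => key.1 b b.2, key.2⟩

theorem pairProg_spec (h : T.Prepared σ) {y : T.Tuple} (hy : T.Labeled σ y) (k l : Fin T.L)
    (b : Fin T.q) :
    (pairProg.run σ).real 13 (idxEquiv T.L T.p T.q (Sum.inr ((k, l), b))) 0 0 =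
      T.featGap y (Sum.inr ((k, l), b)) := by
  rw [idxEquiv_inr]
  have key := run_forLT₂_fill (σ := σ) (v := 22) (w := 23) (e := labelsE) (f := labelsE)
    (c := forLT 25 edgeFeatsE
      (seq pairSum (setReal 13 pairAddr zero zero (.div (.var 10) (.cast examplesE)))))
    (by decide) T.L T.L (h.le_bound (T.le_size_cube T.le_size.2.1)).le
    (h.le_bound (T.le_size_cube T.le_size.2.1)).le
    (fun τ hf => by simp only [NExp.eval, hf.nat 0 (by decide), h.enc.L])
    (fun τ hf => by simp only [NExp.eval, hf.nat 0 (by decide), h.enc.L])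
    (fun k l τ => ∀ (hk : k < T.L) (hl : l < T.L) (b : Fin T.q),
      τ.real 13 (T.L * T.p + (b + T.q * (l + T.L * k))) 0 0 =
        T.featGap y (Sum.inr ((⟨k, hk⟩, ⟨l, hl⟩), b)))
    (fun _ _ _ _ h => h) (fun _ _ _ _ h => h)
    (fun k hk l hl τ g1 g2 g3 => by
      have hr := pairRow_spec (h.frame g3 (by decide) (by decide))
        (hy.frame g3 (by decide) (by decide)) ⟨k, hk⟩ ⟨l, hl⟩ g1 g2
      refine ⟨fun _ _ b => hr.1 b, fun k' hk' l' hl' hne h' hk'' hl'' b => ?_⟩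
      rw [hr.2 _ fun b' hb' he => ?_]
      · exact h' hk'' hl'' b
      -- Division by `q` and then by `L` recovers the pair of labels from the address.
      · have h1 := flat_inj (L := T.q) (u := l' + T.L * k') (u' := l + T.L * k) b.2 hb' (by
          rw [mul_comm _ T.q, mul_comm _ T.q]
          simp only at he
          omega)
        have h2 := flat_inj (L := T.L) (u := k') (u' := k) hl' hl
          (by rw [mul_comm k', mul_comm k]; omega)
        exact hne (by rw [h2.1, h2.2]))
  exact key k k.2 l l.2 k.2 l.2 b

/-- The number of parameters. -/
abbrev dimE : NExp :=
  .add (mulE labelsE nodeFeatsE) (mulE edgeFeatsE (mulE labelsE labelsE))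

theorem dimE_eval (h : T.Prepared σ) : dimE.eval σ = dim T.L T.p T.q := by
  obtain ⟨-, sL, sp, sq⟩ := T.le_size
  have e1 := h.mul_eq (x := T.L) (y := T.p) sL (T.le_size_cube sp)
  have e2 := h.mul_eq (x := T.L) (y := T.L) sL (T.le_size_cube sL)
  have e3 := h.mul_eq (x := T.q) (y := T.L * T.L) sq (by
    calc T.L * T.L ≤ T.size * T.size := by gcongr
      _ = T.size ^ 2 := by ring
      _ ≤ T.size ^ 3 := Nat.pow_le_pow_right (by linarith [T.three_le_size]) (by decide))
  simp only [NExp.eval, h.enc.L, h.enc.p, h.enc.q, e1, e2, e3, dim]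
  ring

/-- Write the new constraint into the matrix of the quadratic program. -/
def rowProg : BProg :=
  forLT 36 dimE (branch (.natLE (.add (.var 36) (.const 1)) (mulE labelsE nodeFeatsE))
    (setReal 5 (.var 7) (.var 36) zero (.get 12 (.var 36) zero zero))
    (setReal 5 (.var 7) (.var 36) zero (.get 13 (.var 36) zero zero)))

/-- Unary and pairwise entries come from two scratch arrays, so that neither computation has to
preserve the output of the other; the threshold `L * p` selects the source. -/
theorem rowProg_spec (h : T.Prepared σ) :
    (∀ j < dim T.L T.p T.q, (rowProg.run σ).real 5 (σ.nat 7 0 0 0) j 0 =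
      if j < T.L * T.p then σ.real 12 j 0 0 else σ.real 13 j 0 0) ∧
    ∀ r ≠ σ.nat 7 0 0 0, (rowProg.run σ).real 5 r = σ.real 5 r := by
  refine run_forLT (σ := σ) (by decide) (dim T.L T.p T.q) (T.dim_lt.le.trans h.bound.le)
    (fun τ hf => dimE_eval (h.frame hf (by decide) (by decide)))
    (fun m τ => (∀ j < m, τ.real 5 (σ.nat 7 0 0 0) j 0 =
      if j < T.L * T.p then σ.real 12 j 0 0 else σ.real 13 j 0 0) ∧
      ∀ r ≠ σ.nat 7 0 0 0, τ.real 5 r = σ.real 5 r)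
    (fun _ _ _ h => h) ⟨fun j hj => absurd hj (Nat.not_lt_zero _), fun _ _ => rfl⟩
    (fun m hm τ g1 g2 ⟨g3, g4⟩ => ?_)
  have hP := h.frame g2 (by decide) (by decide)
  have e1 := hP.mul_eq (x := T.L) (y := T.p) T.le_size.2.1 (T.le_size_cube T.le_size.2.2.1)
  have hb : ∀ z, (mulE labelsE nodeFeatsE).eval τ = z ↔ T.L * T.p = z := fun z => by
    simp only [NExp.eval, hP.enc.L, hP.enc.p, e1]
  simp only [run_branch_natLE, (hb _).2 rfl]
  simp only [NExp.eval, g1]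
  by_cases hc : m + 1 ≤ T.L * T.p
  · rw [if_pos hc]
    simp only [run_setReal, NExp.eval, RExp.eval, g1, g2.nat 7 (by decide),
      g2.real 12 (by decide)]
    refine ⟨fun j hj => ?_, fun r hr => ?_⟩
    · rw [Mem.writeReal_real_self]
      by_cases hjm : j = m
      · rw [if_pos ⟨rfl, hjm, rfl⟩, hjm, if_pos (by omega)]
      · rw [if_neg fun hh => hjm hh.2.1]
        exact g3 j (by omega)
    · funext z z'
      rw [Mem.writeReal_real_self, if_neg fun hh => hr hh.1, g4 r hr]
  · rw [if_neg hc]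
    simp only [run_setReal, NExp.eval, RExp.eval, g1, g2.nat 7 (by decide),
      g2.real 13 (by decide)]
    refine ⟨fun j hj => ?_, fun r hr => ?_⟩
    · rw [Mem.writeReal_real_self]
      by_cases hjm : j = m
      · rw [if_pos ⟨rfl, hjm, rfl⟩, hjm, if_neg (by omega)]
      · rw [if_neg fun hh => hjm hh.2.1]
        exact g3 j (by omega)
    · funext z z'
      rw [Mem.writeReal_real_self, if_neg fun hh => hr hh.1, g4 r hr]

/-- The product of the parameters with the new row. -/
def scoreProg : BProg :=
  sumTo 10 36 dimE skip (.mul (.get 3 (.var 36) zero zero) (.get 5 (.var 7) (.var 36) zero))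

theorem scoreProg_spec (h : T.Prepared σ) :
    (scoreProg.run σ).real 10 0 0 0 = ∑ j ∈ Finset.range (dim T.L T.p T.q),
      σ.real 3 j 0 0 * σ.real 5 (σ.nat 7 0 0 0) j 0 := by
  refine run_sumTo (σ := σ) (by decide) (by decide) _ (T.dim_lt.le.trans h.bound.le)
    (fun τ hf => dimE_eval (h.frame hf (by decide) (by decide))) _ (fun j hj τ g1 g2 => ?_)
  simp only [run_skip, RExp.eval, NExp.eval, g1, g2.real 3 (by decide), g2.real 5 (by decide),
    g2.nat 7 (by decide)]

/-- Decide whether another iteration is needed and count the constraint. -/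
def finishProg : BProg :=
  seq (branch (.realLE (.sub (.sub (.get 6 (.var 7) zero zero) (.var 10)) (.var 4))
      (.get 0 (.const 2) zero zero))
    (setNat 32 zero zero zero zero) (setNat 32 zero zero zero (.const 1)))
    (setNat 7 zero zero zero (.add (.var 7) (.const 1)))

theorem finishProg_spec (σ : Mem) :
    (finishProg.run σ).nat 7 0 0 0 = σ.nat 7 0 0 0 + 1 ∧
    ((finishProg.run σ).nat 32 0 0 0 = 1 ↔ σ.real 0 2 0 0 <
      σ.real 6 (σ.nat 7 0 0 0) 0 0 - σ.real 10 0 0 0 - σ.real 4 0 0 0) ∧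
    ((finishProg.run σ).nat 32 0 0 0 = 0 ∨ (finishProg.run σ).nat 32 0 0 0 = 1) := by
  unfold finishProg
  rw [run_seq]
  have hc : (Test.realLE (.sub (.sub (.get 6 (.var 7) zero zero) (.var 10)) (.var 4))
      (.get 0 (.const 2) zero zero)).holds σ ↔
      ¬ σ.real 0 2 0 0 < σ.real 6 (σ.nat 7 0 0 0) 0 0 - σ.real 10 0 0 0 - σ.real 4 0 0 0 := by
    rw [not_lt]
    exact Iff.rfl
  by_cases h : σ.real 0 2 0 0 <
      σ.real 6 (σ.nat 7 0 0 0) 0 0 - σ.real 10 0 0 0 - σ.real 4 0 0 0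
  · rw [run_branch_neg fun h' => hc.1 h' h]
    simp [NExp.eval, Mem.writeNat, h]
  · rw [run_branch_pos (hc.2 h)]
    simp [NExp.eval, Mem.writeNat]
    linarith

/-- The part of an iteration after the call of the solver. -/
def bodyProg : BProg :=
  seq oraclesProg (seq unaryProg (seq pairProg (seq rowProg (seq lossSum
    (seq (setReal 6 (.var 7) zero zero (.div (.var 10) (.cast examplesE)))
      (seq scoreProg finishProg))))))

/-- Only the row numbered by variable 7 is written and earlier rows persist, so the stored matrix
grows with the working set. The answers of the solver survive the oracle calls, which is what allows
the violation to be evaluated afterwards. -/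
theorem bodyProg_spec (h : T.Prepared σ) {w : T.Weight} (hw : T.HoldsWeight σ w)
    (hP : ∀ j ∈ T.P, 0 ≤ w j) :
    ∃ y : T.Tuple, (∀ i, (T.ex i).IsOracle T.ρ w (y i)) ∧
      (bodyProg.run σ).nat 7 0 0 0 = σ.nat 7 0 0 0 + 1 ∧
      (∀ j, (bodyProg.run σ).real 5 (σ.nat 7 0 0 0) (idxEquiv T.L T.p T.q j) 0 =
        T.featGap y j) ∧
      (∀ r ≠ σ.nat 7 0 0 0, (bodyProg.run σ).real 5 r = σ.real 5 r) ∧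
      (bodyProg.run σ).real 6 (σ.nat 7 0 0 0) 0 0 = T.avgLoss y ∧
      (∀ r ≠ σ.nat 7 0 0 0, (bodyProg.run σ).real 6 r 0 0 = σ.real 6 r 0 0) ∧
      ((bodyProg.run σ).nat 32 0 0 0 = 1 ↔
        T.ε < T.avgLoss y - (∑ j, w j * T.featGap y j) - σ.real 4 0 0 0) ∧
      ((bodyProg.run σ).nat 32 0 0 0 = 0 ∨ (bodyProg.run σ).nat 32 0 0 0 = 1) := by
  set σ₁ := oraclesProg.run σ with h₁
  set σ₂ := unaryProg.run σ₁ with h₂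
  set σ₃ := pairProg.run σ₂ with h₃
  set σ₄ := rowProg.run σ₃ with h₄
  set σ₅ := lossSum.run σ₄ with h₅
  set σ₆ := (setReal 6 (.var 7) zero zero (.div (.var 10) (.cast examplesE))).run σ₅ with h₆
  set σ₇ := scoreProg.run σ₆ with h₇
  have hrun : bodyProg.run σ = finishProg.run σ₇ := rfl
  have f₁ : Frame _ σ σ₁ := frame_run oraclesProg σ
  have f₂ : Frame _ σ₁ σ₂ := frame_run unaryProg σ₁
  have f₃ : Frame _ σ₂ σ₃ := frame_run pairProg σ₂
  have f₄ : Frame _ σ₃ σ₄ := frame_run rowProg σ₃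
  have f₅ : Frame _ σ₄ σ₅ := frame_run lossSum σ₄
  have f₆ : Frame _ σ₅ σ₆ :=
    frame_run (setReal 6 (.var 7) zero zero (.div (.var 10) (.cast examplesE))) σ₅
  have f₇ : Frame _ σ₆ σ₇ := frame_run scoreProg σ₆
  have f₈ : Frame _ σ₇ _ := frame_run finishProg σ₇
  have P₁ := h.frame f₁ (by decide) (by decide)
  have P₂ := P₁.frame f₂ (by decide) (by decide)
  have P₃ := P₂.frame f₃ (by decide) (by decide)
  have P₄ := P₃.frame f₄ (by decide) (by decide)
  have P₅ := P₄.frame f₅ (by decide) (by decide)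
  have P₆ := P₅.frame f₆ (by decide) (by decide)
  have P₇ := P₆.frame f₇ (by decide) (by decide)
  obtain ⟨y, hy, Y₁⟩ := oraclesProg_spec h hw hP
  rw [← h₁] at Y₁
  have Y₂ := Y₁.frame f₂ (by decide) (by decide)
  have Y₃ := Y₂.frame f₃ (by decide) (by decide)
  have Y₄ := Y₃.frame f₄ (by decide) (by decide)
  have n7₃ : σ₃.nat 7 = σ.nat 7 := by
    rw [f₃.nat 7 (by decide), f₂.nat 7 (by decide), f₁.nat 7 (by decide)]
  have n7₅ : σ₅.nat 7 = σ.nat 7 := by rw [f₅.nat 7 (by decide), f₄.nat 7 (by decide), n7₃]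
  have n7₆ : σ₆.nat 7 = σ.nat 7 := by rw [f₆.nat 7 (by decide), n7₅]
  have n7₇ : σ₇.nat 7 = σ.nat 7 := by rw [f₇.nat 7 (by decide), n7₆]
  have r5₃ : σ₃.real 5 = σ.real 5 := by
    rw [f₃.real 5 (by decide), f₂.real 5 (by decide), f₁.real 5 (by decide)]
  have r5₆ : σ₆.real 5 = σ₄.real 5 := by rw [f₆.real 5 (by decide), f₅.real 5 (by decide)]
  have r5 : (bodyProg.run σ).real 5 = σ₄.real 5 := by
    rw [hrun, f₈.real 5 (by decide), f₇.real 5 (by decide), r5₆]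
  have r6 : (bodyProg.run σ).real 6 = σ₆.real 6 := by
    rw [hrun, f₈.real 6 (by decide), f₇.real 6 (by decide)]
  have r6₅ : σ₅.real 6 = σ.real 6 := by
    rw [f₅.real 6 (by decide), f₄.real 6 (by decide), f₃.real 6 (by decide),
      f₂.real 6 (by decide), f₁.real 6 (by decide)]
  have r3₆ : σ₆.real 3 = σ.real 3 := by
    rw [f₆.real 3 (by decide), f₅.real 3 (by decide), f₄.real 3 (by decide),
      f₃.real 3 (by decide), f₂.real 3 (by decide), f₁.real 3 (by decide)]
  have r4₇ : σ₇.real 4 = σ.real 4 := by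
    rw [f₇.real 4 (by decide), f₆.real 4 (by decide), f₅.real 4 (by decide),
      f₄.real 4 (by decide), f₃.real 4 (by decide), f₂.real 4 (by decide),
      f₁.real 4 (by decide)]
  obtain ⟨row, rows⟩ := rowProg_spec P₃
  rw [← h₄, n7₃] at row rows
  have hrow : ∀ j, σ₄.real 5 (σ.nat 7 0 0 0) (idxEquiv T.L T.p T.q j) 0 = T.featGap y j := by
    intro j
    rw [row _ (Fin.isLt _)]
    rcases j with ⟨k, a⟩ | ⟨⟨k, l⟩, b⟩
    · have := unaryProg_spec P₁ Y₁ k a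
      rw [← h₂] at this
      rw [if_pos, f₃.real 12 (by decide), this]
      rw [idxEquiv_inl]
      calc (a : ℕ) + T.p * k = k * T.p + a := by ring
        _ < T.L * T.p := flat_lt k.2 a.2
    · have := pairProg_spec P₂ Y₂ k l b
      rw [← h₃] at this
      rw [if_neg, this]
      rw [idxEquiv_inr]
      omega
  have hloss := lossSum_spec P₄ Y₄
  rw [← h₅] at hloss
  have h6 : ∀ z, σ₆.real 6 z 0 0 = if z = σ.nat 7 0 0 0 then T.avgLoss y else σ.real 6 z 0 0 := by
    intro z
    rw [h₆]
    simp only [run_setReal, NExp.eval, RExp.eval, Mem.writeReal_real_self, n7₅, P₅.enc.n, hloss,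
      r6₅, and_true]
  have hscore := scoreProg_spec P₆
  rw [← h₇, r3₆, r5₆, n7₆, Finset.sum_range, ← (idxEquiv T.L T.p T.q).sum_comp] at hscore
  have hscore' : σ₇.real 10 0 0 0 = ∑ j, w j * T.featGap y j := by
    rw [hscore]
    exact Finset.sum_congr rfl fun j _ => by rw [hrow, hw j]
  obtain ⟨g1, g2, g3⟩ := finishProg_spec σ₇
  rw [n7₇] at g1 g2
  refine ⟨y, hy, ?_, fun j => ?_, fun r hr => ?_, ?_, fun r hr => ?_, ?_, ?_⟩
  · rw [hrun, g1]
  · rw [r5, hrow]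
  · rw [r5, rows r hr, r5₃]
  · rw [r6, h6, if_pos rfl]
  · rw [r6, h6, if_neg hr]
  · rw [hrun, g2, P₇.enc.ε, r4₇, hscore', f₇.real 6 (by decide), h6, if_pos rfl]
  · rw [hrun]
    exact g3

end BProg

end SSVM

end

noncomputable section

namespace SSVM

/-! ### The main loop -/

namespace Training

variable {T : Training} {σ : Mem}

theorem toQP_feasible_iff (l : List T.Tuple) (w : T.Weight) (ξ : ℝ) :
    (T.toQP l).Feasible (fun j => w ((idxEquiv T.L T.p T.q).symm j)) ξ ↔
      T.Feasible {y | y ∈ l} w ξ := by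
  have hs : ∀ y, ∑ j, w ((idxEquiv T.L T.p T.q).symm j) *
      T.featGap y ((idxEquiv T.L T.p T.q).symm j) = ∑ j, w j * T.featGap y j := fun y =>
    (idxEquiv T.L T.p T.q).symm.sum_comp fun j => w j * T.featGap y j
  refine and_congr_right fun _ => and_congr ⟨fun h y hy => ?_, fun h r => ?_⟩
    ⟨fun h j hj => ?_, fun h j hj => ?_⟩
  · obtain ⟨r, rfl⟩ := List.get_of_mem hy
    rw [← hs]
    exact h r
  · have := h _ (List.get_mem l r)
    rw [← hs] at this
    exact this
  · have := h (idxEquiv T.L T.p T.q j) (by simpa [toQP] using hj)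
    simpa using this
  · exact h _ (by simpa [toQP] using hj)

theorem toQP_objective (l : List T.Tuple) (w : T.Weight) (ξ : ℝ) :
    (T.toQP l).objective (fun j => w ((idxEquiv T.L T.p T.q).symm j)) ξ = T.objective w ξ := by
  have := (idxEquiv T.L T.p T.q).symm.sum_comp fun j => w j ^ 2
  unfold objective
  rw [← this]
  rfl

/-- The parameter vector found by the solver. -/
def solution (T : Training) (S : QPSolver) (l : List T.Tuple) : T.Weight :=
  fun j => S.solW (T.toQP l) (idxEquiv T.L T.p T.q j)

/-- The two forms of the program differ only in the numbering of the coordinates, and renumbering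
preserves feasibility and objective. -/
theorem solution_isArgmin (S : QPSolver) (l : List T.Tuple) :
    T.IsArgmin {y | y ∈ l} (T.solution S l) (S.solXi (T.toQP l)) := by
  obtain ⟨h1, h2⟩ := S.exact_sol (T.toQP l) T.C_pos
  have e : S.solW (T.toQP l) =
      fun j => T.solution S l ((idxEquiv T.L T.p T.q).symm j) := by
    funext j
    exact congrArg (S.solW (T.toQP l)) ((idxEquiv T.L T.p T.q).apply_symm_apply j).symm
  rw [e] at h1 h2
  refine ⟨(toQP_feasible_iff l _ _).1 h1, fun w' ξ' h' => ?_⟩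
  exact (toQP_objective l _ _).symm.le.trans
    ((h2 _ _ ((toQP_feasible_iff l w' ξ').2 h')).trans (toQP_objective l w' ξ').le)

/-- The memory before or after an iteration, with the listed working set `l`. -/
structure Synced (T : Training) (σ : Mem) (l : List T.Tuple) (st : T.State) : Prop where
  prep : T.Prepared σ
  d : σ.nat 8 0 0 0 = dim T.L T.p T.q
  m : σ.nat 7 0 0 0 = l.length
  A : ∀ (r : Fin l.length) j, σ.real 5 r (idxEquiv T.L T.p T.q j) 0 = T.featGap (l.get r) j
  b : ∀ r : Fin l.length, σ.real 6 r 0 0 = T.avgLoss (l.get r)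
  W : {y | y ∈ l} = st.W
  nodup : T.Guard st → l.Nodup
  flag : σ.nat 32 0 0 0 = 1 ↔ T.Guard st
  flag_le : σ.nat 32 0 0 0 ≤ 1
  weight : ¬ T.Guard st → T.HoldsWeight σ st.w

theorem Synced.readQP {l : List T.Tuple} {st : T.State} (h : T.Synced σ l st) :
    σ.readQP = T.toQP l := by
  -- The types of the other fields depend on `m` and `d`, so these are generalized before they are
  -- identified.
  have key : ∀ m d, m = l.length → d = dim T.L T.p T.q →
      (⟨m, d, fun r j => σ.real 5 r j 0, fun r => σ.real 6 r 0 0, σ.real 0 0 0 0,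
        fun j => decide (σ.nat 6 j 0 0 = 1)⟩ : QP) = T.toQP l := by
    rintro _ _ rfl rfl
    unfold toQP
    congr 1
    · funext r j
      rw [← h.A, Equiv.apply_symm_apply]
    · funext r
      exact h.b r
    · exact h.prep.enc.C
    · funext j
      have := h.prep.enc.marks ((idxEquiv T.L T.p T.q).symm j)
      rw [Equiv.apply_symm_apply] at this
      rw [this]
      by_cases hj : (idxEquiv T.L T.p T.q).symm j ∈ T.P <;> simp [hj]
  exact key _ _ h.m h.d

theorem guard_coe {W : Set T.Tuple} {x ξ : ℝ} {w : T.Weight} :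
    T.Guard ⟨W, (x : EReal), ξ, w⟩ ↔ T.ε < x - ξ := by
  unfold Guard
  rw [← EReal.coe_sub, EReal.coe_lt_coe_iff]

-- One machine round is one iteration. The nonnegativity that the oracle relies on is part of the
-- feasibility of the solver's answer.
open BProg in
theorem Synced.step (S : QPSolver) {l : List T.Tuple} {st : T.State} (h : T.Synced σ l st)
    (hg : T.Guard st) :
    ∃ (y : T.Tuple) (st' : T.State) (τ : Mem) (t : ℕ),
      Exec S (.seq .solveQP bodyProg.compile) σ τ t [T.toQP l] ∧ T.Step st st' ∧
      T.Synced τ (l ++ [y]) st' ∧ τ.nat 11 0 0 0 = σ.nat 11 0 0 0 ∧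
      t ≤ 1 + (l.length + 1) * (dim T.L T.p T.q + 1) + S.cost (T.toQP l) +
        bodyProg.timeBound (σ.nat 11 0 0 0) := by
  have e₁ := Exec.solveQP (S := S) σ
  rw [h.readQP] at e₁
  set σ₁ := σ.writeSol (S.solW (T.toQP l)) (S.solXi (T.toQP l)) with h₁
  have n₁ : σ₁.nat = σ.nat := rfl
  have r₁ : ∀ a, a ≠ 3 → a ≠ 4 → σ₁.real a = σ.real a := fun a h3 h4 => by
    funext i j k
    simp [h₁, Mem.writeSol, h3, h4]
  have ξ₁ : σ₁.real 4 0 0 0 = S.solXi (T.toQP l) := by simp [h₁, Mem.writeSol]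
  have w₁ : T.HoldsWeight σ₁ (T.solution S l) := fun j => by
    have hd : ((idxEquiv T.L T.p T.q j : Fin _) : ℕ) < (T.toQP l).d := Fin.isLt _
    simp only [h₁, Mem.writeSol, hd, and_self, dif_pos]
    rfl
  have hopt := solution_isArgmin S l
  have P₁ : T.Prepared σ₁ := by
    refine ⟨h.prep.enc.frame (fun a _ => by rw [n₁]) fun a ha => r₁ a (by omega) (by omega),
      ?_, ?_⟩
    · rw [n₁]; exact h.prep.bound
    · rw [n₁]; exact h.prep.mul
  obtain ⟨y, hy, b7, b5, b5', b6, b6', b32, b32'⟩ := bodyProg_spec P₁ w₁ hopt.1.2.2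
  obtain ⟨t, e₂, ht⟩ := exec_compile S (c := bodyProg) (by decide) (by decide) σ₁
  set σ₂ := bodyProg.run σ₁ with h₂
  have f₂ : Frame _ σ₁ σ₂ := frame_run bodyProg σ₁
  rw [n₁, h.m] at b7 b5 b5' b6 b6'
  rw [ξ₁] at b32
  set w := T.solution S l with hw
  set ξ := S.solXi (T.toQP l) with hξ
  set x := T.avgLoss y - ∑ j, w j * T.featGap y j with hx
  have hG : T.Guard ⟨st.W ∪ {y}, (x : EReal), ξ, w⟩ ↔ T.ε < x - ξ := guard_coe
  refine ⟨y, ⟨st.W ∪ {y}, (x : EReal), ξ, w⟩, σ₂, _, e₁.seq e₂, ?_, ?_, ?_, ?_⟩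
  · refine ⟨hg, ?_, y, hy, rfl, rfl⟩
    rw [← h.W]
    exact hopt
  · refine ⟨P₁.frame f₂ (by decide) (by decide), ?_, ?_, ?_, ?_, ?_, ?_, ?_, ?_, ?_⟩
    · rw [f₂.nat 8 (by decide), n₁, h.d]
    · rw [b7, List.length_append, List.length_singleton]
    · rintro ⟨r, hr⟩ j
      rw [List.length_append, List.length_singleton] at hr
      simp only [List.get_eq_getElem]
      rcases Nat.lt_succ_iff_lt_or_eq.1 hr with h' | rfl
      · rw [b5' r h'.ne, r₁ 5 (by decide) (by decide), List.getElem_append_left h']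
        exact h.A ⟨r, h'⟩ j
      · rw [b5, List.getElem_concat_length rfl]
    · rintro ⟨r, hr⟩
      rw [List.length_append, List.length_singleton] at hr
      simp only [List.get_eq_getElem]
      rcases Nat.lt_succ_iff_lt_or_eq.1 hr with h' | rfl
      · rw [b6' r h'.ne, r₁ 6 (by decide) (by decide), List.getElem_append_left h']
        exact h.b ⟨r, h'⟩
      · rw [b6, List.getElem_concat_length rfl]
    · rw [← h.W]
      ext z
      simp [or_comm]
    -- If `y` were already listed, its constraint would hold with slack `ξ`, so the violation minus
    -- `ξ` would not exceed zero and the loop would stop. A repetition can thus occur only at the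
    -- very end, when no further program is posed.
    · intro hg'
      have hε := T.ε_pos
      refine List.nodup_append.2 ⟨h.nodup hg, List.nodup_singleton y, fun a ha b hb hab => ?_⟩
      rw [List.mem_singleton] at hb
      subst hab hb
      have h3 := hopt.1.2.1 a ha
      have h4 := hG.1 hg'
      rw [hx] at h4
      linarith
    · rw [hG]
      exact b32
    · omega
    · intro _ j
      rw [f₂.real 3 (by decide)]
      exact w₁ j
  · rw [f₂.nat 11 (by decide), n₁]
  · rw [n₁] at ht
    have : (T.toQP l).m = l.length := rfl
    have : (T.toQP l).d = dim T.L T.p T.q := rfl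
    simp only [*] at *
    omega

/-- The loop of the algorithm. -/
def mainLoop : Prog :=
  .loop (.natLE (.const 1) (.var 32)) (.seq .solveQP BProg.bodyProg.compile)

/-- A while loop terminates only by an argument from outside: `fuel` bounds the length of every
sequence of steps from the current state and drops by one per round. `D` bounds the number of
constraints in every call, hence the charge for passing the program. -/
theorem Synced.loop (S : QPSolver) (D fuel : ℕ) {l : List T.Tuple} {st : T.State}
    (h : T.Synced σ l st) (hD : l.length + fuel ≤ D)
    (hfuel : ∀ (u : ℕ → T.State) (K : ℕ), u 0 = st → (∀ k < K, T.Step (u k) (u (k + 1))) →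
      K ≤ fuel) :
    ∃ (u : ℕ → T.State) (K : ℕ) (τ : Mem) (t : ℕ) (qs : List QP),
      Exec S mainLoop σ τ t qs ∧ u 0 = st ∧ (∀ k < K, T.Step (u k) (u (k + 1))) ∧
      ¬ T.Guard (u K) ∧ T.HoldsWeight τ (u K).w ∧ qs.length = K ∧
      (∀ k < K, ∃ l : List T.Tuple, l.Nodup ∧ {y | y ∈ l} = (u k).W ∧
        qs[k]? = some (T.toQP l)) ∧
      t ≤ K * (20 + (D + 1) * (dim T.L T.p T.q + 1) + BProg.bodyProg.timeBound (σ.nat 11 0 0 0)) +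
        20 + (qs.map S.cost).sum := by
  induction fuel generalizing σ l st with
  | zero =>
    have hg : ¬ T.Guard st := fun hg => by
      obtain ⟨-, st', -, -, -, hs, -⟩ := h.step S hg
      have := hfuel (fun k => if k = 0 then st else st') 1 (by simp) (fun k hk => by
        obtain rfl : k = 0 := by omega
        simpa using hs)
      omega
    refine ⟨fun _ => st, 0, σ, _, [], Exec.loop_false fun hb => hg (h.flag.1 ?_), rfl,
      fun k hk => absurd hk (Nat.not_lt_zero _), hg, h.weight hg, rfl,
      fun k hk => absurd hk (Nat.not_lt_zero _), ?_⟩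
    · have h1 := h.flag_le
      have h2 : 1 ≤ σ.nat 32 0 0 0 := hb
      omega
    · simp [Test.time, NExp.time]
  | succ fuel ih =>
    by_cases hg : T.Guard st
    · obtain ⟨y, st', τ, t, he, hs, hτ, h11, ht⟩ := h.step S hg
      obtain ⟨u, K, υ, t', qs, he', hu0, hu, hgu, hwu, hlen, hqs, ht'⟩ :=
        ih hτ (by simp; omega) (fun u K hu0 hu => by
          -- Putting `st` in front of a sequence from `st'` yields one from `st` that is longer by
          -- one.
          have := hfuel (fun k => Nat.casesOn k st u) (K + 1) rfl (fun k hk => by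
            cases k with
            | zero => simpa [hu0] using hs
            | succ k => exact hu k (by omega))
          omega)
      refine ⟨fun k => Nat.casesOn k st u, K + 1, υ, _, [T.toQP l] ++ qs,
        Exec.loop_true (le_of_eq (h.flag.2 hg).symm) he he', rfl, fun k hk => ?_, hgu, hwu, ?_,
        fun k hk => ?_, ?_⟩
      · cases k with
        | zero => simpa [hu0] using hs
        | succ k => exact hu k (by omega)
      · simp [hlen]
      · cases k with
        | zero => exact ⟨l, h.nodup hg, h.W, by simp⟩
        | succ k =>
          obtain ⟨l', h1, h2, h3⟩ := hqs k (by omega)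
          exact ⟨l', h1, h2, by simpa using h3⟩
      · rw [h11] at ht'
        have h1 : (l.length + 1) * (dim T.L T.p T.q + 1) ≤ (D + 1) * (dim T.L T.p T.q + 1) :=
          Nat.mul_le_mul_right _ (by omega)
        simp only [List.map_append, List.map_cons, List.map_nil, List.sum_append, List.sum_cons,
          List.sum_nil, Test.time, NExp.time]
        rw [add_mul K 1, one_mul]
        omega
    · refine ⟨fun _ => st, 0, σ, _, [], Exec.loop_false fun hb => hg (h.flag.1 ?_), rfl,
        fun k hk => absurd hk (Nat.not_lt_zero _), hg, h.weight hg, rfl,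
        fun k hk => absurd hk (Nat.not_lt_zero _), ?_⟩
      · have h1 := h.flag_le
        have h2 : 1 ≤ σ.nat 32 0 0 0 := hb
        omega
      · simp [Test.time, NExp.time]

end Training

end SSVM

end

noncomputable section

namespace SSVM

/-! ### Initialization -/

namespace BProg

variable {T : Training} {σ : Mem}

/-- Compute the size of the input. -/
def sizeProg : BProg :=
  seq (setNat 12 zero zero zero (.add (.add (.add examplesE labelsE) nodeFeatsE) edgeFeatsE))
    (forLT 9 examplesE (setNat 12 zero zero zero (.add (.var 12) (.add nodesE edgesE))))

theorem sizeProg_spec (h : T.Encoded σ) (hn : T.n ≤ σ.nat 11 0 0 0) :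
    (sizeProg.run σ).nat 12 0 0 0 = T.size := by
  unfold sizeProg
  rw [run_seq]
  set c₁ : BProg :=
    setNat 12 zero zero zero (.add (.add (.add examplesE labelsE) nodeFeatsE) edgeFeatsE) with hc₁
  have f₁ := frame_run c₁ σ
  have v₁ : (c₁.run σ).nat 12 0 0 0 = T.n + T.L + T.p + T.q := by
    simp [hc₁, NExp.eval, Mem.writeNat, h.n, h.L, h.p, h.q]
  have h₁ : T.Encoded (c₁.run σ) := h.frame_run f₁ (by decide) (by decide)
  set τ := c₁.run σ
  have key := run_forLT (σ := τ) (v := 9) (e := examplesE)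
    (c := setNat 12 zero zero zero (.add (.var 12) (.add nodesE edgesE)))
    (by decide) T.n (by rw [f₁.nat 11 (by decide)]; exact hn)
    (fun υ hf => by simp only [NExp.eval, hf.nat 0 (by decide), h₁.n])
    (fun m υ => υ.nat 12 0 0 0 = T.n + T.L + T.p + T.q +
      ∑ i ∈ Finset.range m, (τ.nat 1 i 0 0 + τ.nat 2 i 0 0))
    (fun m υ x hI => by rw [Mem.writeNat_nat_of_ne _ (by decide)]; exact hI)
    (by simpa using v₁)
    (fun m hm υ g1 g2 g3 => by
      simp only [run_setNat, NExp.eval, Mem.writeNat_nat_self, and_self, if_true, g1, g3,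
        g2.nat 1 (by decide), g2.nat 2 (by decide), Finset.sum_range_succ]
      ring)
  rw [key, Finset.sum_range, Training.size]
  simp only [h₁.nV, h₁.nE]
  ring

/-- Prepare the first iteration. -/
def prepProg : BProg :=
  seq mulTable (seq (setNat 7 zero zero zero zero) (seq (setNat 8 zero zero zero dimE)
    (setNat 32 zero zero zero (.const 1))))

theorem prepProg_spec (h : T.Encoded σ) (hB : T.size ^ 4 < σ.nat 11 0 0 0) :
    T.Synced (prepProg.run σ) [] T.init := by
  have f₁ := frame_run mulTable σ
  have P₁ : T.Prepared (mulTable.run σ) := by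
    refine ⟨h.frame_run f₁ (by decide) (by decide), ?_, ?_⟩
    · rw [f₁.nat 11 (by decide)]
      exact hB
    · rw [f₁.nat 11 (by decide)]
      exact mulTable_spec σ rfl
  have P₂ := P₁.frame (frame_run (setNat 7 zero zero zero zero) _) (by decide) (by decide)
  have hd := dimE_eval P₂
  have P₃ := P₂.frame (frame_run (seq (setNat 8 zero zero zero dimE)
    (setNat 32 zero zero zero (.const 1))) _) (by decide) (by decide)
  -- Since `η = ∞` at the start, the guard holds and nothing is required of the weight array, whose
  -- content is arbitrary.
  have hg : T.Guard T.init := by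
    simp [Training.Guard, Training.init]
  refine ⟨P₃, ?_, ?_, fun r => r.elim0, fun r => r.elim0, ?_, fun _ => List.nodup_nil, ?_, ?_,
    fun h => absurd hg h⟩
  · rw [← hd]
    simp only [prepProg, run_seq, run_setNat, NExp.eval]
    rw [Mem.writeNat_nat_of_ne _ (by decide), Mem.writeNat_nat_self, if_pos ⟨rfl, rfl, rfl⟩]
  · simp [prepProg, NExp.eval, Mem.writeNat]
  · simp [Training.init]
  · simp [prepProg, NExp.eval, Mem.writeNat, hg]
  · simp [prepProg, NExp.eval, Mem.writeNat]

/-- Run `c` and take the result as the new loop bound. -/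
def thenRebound (c : BProg) : Prog :=
  .seq c.compile (.setNat 11 (.const 0) (.const 0) (.const 0) (.var 12))

/-- The time bound for a bounded program requires that it leave the loop bound alone, so the bound
is replaced between such programs. -/
theorem exec_thenRebound (S : QPSolver) {c : BProg} (hok : c.ok = true) (h11 : 11 ∉ c.natWrites)
    (hn : ∀ a < 7, a ∉ c.natWrites) (hr : ∀ a < 3, a ∉ c.realWrites) (h : T.Encoded σ) {v : ℕ}
    (hv : (c.run σ).nat 12 0 0 0 = v) :
    ∃ τ t, Exec S c.thenRebound σ τ t [] ∧ T.Encoded τ ∧ τ.nat 11 0 0 0 = v ∧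
      t ≤ c.timeBound (σ.nat 11 0 0 0) + 20 := by
  obtain ⟨t, e, ht⟩ := exec_compile S hok h11 σ
  refine ⟨_, _, e.seq (Exec.setNat _ 11 (.const 0) (.const 0) (.const 0) (.var 12)), ?_, ?_, ?_⟩
  · refine (h.frame_run (frame_run c σ) hn hr).frame (fun a ha => ?_) fun a _ => rfl
    exact Mem.writeNat_nat_of_ne _ (by omega) _ _ _ _
  · simp [Mem.writeNat, NExp.eval, hv]
  · simp only [NExp.time]
    omega

end BProg

/-! ### Bounds that are polynomial in the size of the input -/

theorem ind_mem (b : Bool) : 0 ≤ ind b ∧ ind b ≤ 1 := by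
  cases b <;> simp [ind]

/-- A coordinate is a sum of at most `m` features with weights in `[0, 1]`, so each term changes by
at most `F`. -/
theorem Example.abs_psi_sub_le {L p q : ℕ} (x : Example L p q) {F : ℝ} {m : ℕ}
    (hV : x.nV ≤ m) (hE : x.nE ≤ m) (hF : 0 ≤ F) (hn : ∀ u a, |x.nodeFeat u a| ≤ F)
    (he : ∀ e b, |x.edgeFeat e b| ≤ F) (y z : x.Lab) (j : Idx L p q) :
    |x.psi y j - x.psi z j| ≤ m * F := by
  have key : ∀ a b f : ℝ, 0 ≤ a ∧ a ≤ 1 → 0 ≤ b ∧ b ≤ 1 → |f| ≤ F → |a * f - b * f| ≤ F := by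
    intro a b f ha hb hf
    rw [← sub_mul, abs_mul]
    have : |a - b| ≤ 1 := abs_le.2 ⟨by linarith [ha.1, hb.2], by linarith [ha.2, hb.1]⟩
    calc |a - b| * |f| ≤ 1 * F := by gcongr
      _ = F := one_mul F
  rcases j with ⟨k, a⟩ | ⟨⟨k, l⟩, b⟩
  · simp only [psi, ← Finset.sum_sub_distrib]
    calc _ ≤ ∑ u, |ind (y (u, k)) * x.nodeFeat u a - ind (z (u, k)) * x.nodeFeat u a| :=
          Finset.abs_sum_le_sum_abs _ _
      _ ≤ ∑ _u : Fin x.nV, F :=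
          Finset.sum_le_sum fun u _ => key _ _ _ (ind_mem _) (ind_mem _) (hn u a)
      _ = x.nV * F := by simp
      _ ≤ m * F := by gcongr
  · have h2 : ∀ b c : Bool, 0 ≤ ind b * ind c ∧ ind b * ind c ≤ 1 := fun b c => by
      cases b <;> cases c <;> simp [ind]
    simp only [psi, ← Finset.sum_sub_distrib]
    refine (Finset.abs_sum_le_sum_abs _ _).trans ?_
    calc _ ≤ ∑ _e : Fin x.nE, F :=
          Finset.sum_le_sum fun e _ => key _ _ _ (h2 _ _) (h2 _ _) (he e b)
      _ = x.nE * F := by simp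
      _ ≤ m * F := by gcongr

namespace Training

variable {T : Training} {σ : Mem}

/-- There are at most `N⁴` coordinates, and each difference is at most `N²` before squaring. -/
theorem sum_psi_sub_sq_le {F : ℝ} (hF : T.FeatBound F) {N : ℕ} (hs : T.size ≤ N)
    (hFN : F ≤ N) (i : Fin T.n) (y : (T.ex i).Lab) :
    ∑ j, ((T.ex i).psi (T.ex i).truth j - (T.ex i).psi y j) ^ 2 ≤ (N : ℝ) ^ 8 := by
  have hN : (0 : ℝ) ≤ N := N.cast_nonneg
  have h1 : ∀ j, ((T.ex i).psi (T.ex i).truth j - (T.ex i).psi y j) ^ 2 ≤ (N : ℝ) ^ 4 := by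
    intro j
    have := (T.ex i).abs_psi_sub_le ((T.ex_le_size i).1.trans hs) ((T.ex_le_size i).2.trans hs)
      hN (fun u a => ((hF i).1 u a).trans hFN) (fun e b => ((hF i).2 e b).trans hFN)
      (T.ex i).truth y j
    rw [← sq_abs]
    calc _ ≤ ((N : ℝ) * N) ^ 2 := by gcongr
      _ = (N : ℝ) ^ 4 := by ring
  have h2 : Fintype.card (Idx T.L T.p T.q) ≤ N ^ 4 := by
    rw [Fintype.card_congr (idxEquiv T.L T.p T.q), Fintype.card_fin]
    exact T.dim_lt.le.trans (Nat.pow_le_pow_left hs 4)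
  calc _ ≤ ∑ _j : Idx T.L T.p T.q, (N : ℝ) ^ 4 := Finset.sum_le_sum fun j _ => h1 j
    _ = Fintype.card (Idx T.L T.p T.q) * (N : ℝ) ^ 4 := by simp
    _ ≤ (N : ℝ) ^ 4 * (N : ℝ) ^ 4 := by
        gcongr
        exact_mod_cast h2
    _ = (N : ℝ) ^ 8 := by ring

/-- No relation between `ε` and the features is assumed; the radius is enlarged until the hypothesis
of `iterations_le` holds and its logarithmic term vanishes. -/
theorem iterations_le_poly {F : ℝ} (hF : T.FeatBound F) {N : ℕ}
    (hN : N = T.size + ⌈T.C⌉₊ + ⌈T.ρ⌉₊ + ⌈F⌉₊ + ⌈1 / T.ε⌉₊) {s : ℕ → T.State} {K : ℕ}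
    (hs : T.IsRun s K) : K ≤ 22 * N ^ 10 := by
  have hC := T.C_pos
  have hρ := T.ρ_pos
  have hε := T.ε_pos
  have cast_le : ∀ {x : ℝ}, ⌈x⌉₊ ≤ N → x ≤ N := fun h =>
    (Nat.le_ceil _).trans (by exact_mod_cast h)
  have bC : T.C ≤ N := cast_le (by omega)
  have bρ : T.ρ ≤ N := cast_le (by omega)
  have bF : F ≤ N := cast_le (by omega)
  have bε : 1 / T.ε ≤ N := cast_le (by omega)
  have bL : (T.L : ℝ) ≤ N := by
    have := T.le_size.2.1
    exact_mod_cast (by omega : T.L ≤ N)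
  have b1 : (1 : ℝ) ≤ N := by
    have := T.three_le_size
    exact_mod_cast (by omega : 1 ≤ N)
  have hL : (0 : ℝ) ≤ T.L := T.L.cast_nonneg
  -- With `R² = V`, the number `4R²C` becomes `4N⁸C + ε + ρL/2`: the second summand gives `ε ≤
  -- 4R²C`, the third makes the argument of the logarithm at most one.
  set V : ℝ := (N : ℝ) ^ 8 + T.ε / (4 * T.C) + T.ρ * T.L / (8 * T.C) with hV
  have hV0 : 0 ≤ V := by positivity
  have hR : Real.sqrt V ^ 2 = V := Real.sq_sqrt hV0
  have e4 : 4 * V * T.C = 4 * (N : ℝ) ^ 8 * T.C + T.ε + T.ρ * T.L / 2 := by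
    rw [hV]
    field_simp
    ring
  have p8 : 0 ≤ 4 * (N : ℝ) ^ 8 * T.C := by positivity
  have pL : 0 ≤ T.ρ * T.L / 2 := by positivity
  have h1 := T.iterations_le (R := Real.sqrt V) (fun i y => by
      rw [hR]
      refine (sum_psi_sub_sq_le hF (by omega) bF i y).trans ?_
      rw [hV, add_assoc]
      exact le_add_of_nonneg_right (by positivity))
    (by rw [hR]; linarith) s K hs
  rw [hR] at h1
  have hlog : ⌈Real.logb 2 ((T.ρ * T.L / 2) / (4 * V * T.C))⌉₊ = 0 := by
    rw [Nat.ceil_eq_zero]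
    refine Real.logb_nonpos (by norm_num) (by positivity) ?_
    exact div_le_one_of_le₀ (by linarith) (by linarith)
  rw [hlog, zero_add] at h1
  refine h1.trans (Nat.ceil_le.2 ?_)
  have e16 : 16 * V * T.C / T.ε =
      16 * (N : ℝ) ^ 8 * T.C * (1 / T.ε) + 4 + 2 * (T.ρ * T.L * (1 / T.ε)) := by
    rw [show 16 * V * T.C = 4 * (4 * V * T.C) by ring, e4]
    field_simp
    ring
  have q1 : 16 * (N : ℝ) ^ 8 * T.C * (1 / T.ε) ≤ 16 * (N : ℝ) ^ 8 * N * N := by gcongr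
  have q2 : T.ρ * T.L * (1 / T.ε) ≤ (N : ℝ) * N * N := by gcongr
  have q3 : (N : ℝ) ^ 3 ≤ (N : ℝ) ^ 10 := pow_le_pow_right₀ b1 (by norm_num)
  have q4 : (1 : ℝ) ≤ (N : ℝ) ^ 10 := one_le_pow₀ b1
  push_cast
  rw [e16]
  linarith

end Training

/-! ### The complete program and its running time -/

/-- The program that executes the whole algorithm. -/
def algorithmMain : Prog :=
  .seq (.setNat 11 (.const 0) (.const 0) (.const 0) BProg.examplesE)
    (.seq BProg.sizeProg.thenRebound (.seq BProg.squareProg.thenRebound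
      (.seq BProg.squareProg.thenRebound (.seq BProg.prepProg.compile Training.mainLoop))))

-- The loop bound grows from `n` to the size `s` of the input and, by squaring twice, to `(s² + 1)²
-- + 1 > s⁴`, enough for the main loop. The total is then the preparation plus the number of
-- iterations times the cost of one round, solver time apart.
open BProg in
theorem algorithmMain_spec : ∃ c : ℕ, ∀ (S : QPSolver) (T : Training) (F : ℝ) (σ : Mem),
    T.FeatBound F → T.Encoded σ →
    ∃ (s : ℕ → T.State) (K : ℕ) (σ' : Mem) (t : ℕ) (qs : List QP),
      Exec S algorithmMain σ σ' t qs ∧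
      T.IsRun s K ∧ ¬ T.Guard (s K) ∧ T.HoldsWeight σ' (s K).w ∧
      qs.length = K ∧
      (∀ k < K, ∃ l : List T.Tuple, l.Nodup ∧ {y | y ∈ l} = (s k).W ∧
        qs[k]? = some (T.toQP l)) ∧
      ∀ N : ℕ, N = T.size + ⌈T.C⌉₊ + ⌈T.ρ⌉₊ + ⌈F⌉₊ + ⌈1 / T.ε⌉₊ →
        K ≤ c * N ^ c ∧
        t ≤ c * N ^ c + (qs.map S.cost).sum ∧
        ∀ B : ℕ, (∀ Q ∈ qs, S.cost Q ≤ B) → t ≤ c * N ^ c * (B + 1) := by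
  obtain ⟨k₁, hk₁⟩ := timeBound_poly sizeProg
  obtain ⟨k₂, hk₂⟩ := timeBound_poly squareProg
  obtain ⟨k₃, hk₃⟩ := timeBound_poly prepProg
  obtain ⟨k₄, hk₄⟩ := timeBound_poly bodyProg
  obtain ⟨c, hc⟩ := poly_bound (300 + k₁ + 2 * k₂ + k₃ + k₄) 13
  -- The added 22 lets the same constant also bound the number of iterations, at most `22 * N ^ 10`.
  refine ⟨c + 22, fun S T F σ hF hE => ?_⟩
  obtain ⟨N, hN⟩ : ∃ N, N = T.size + ⌈T.C⌉₊ + ⌈T.ρ⌉₊ + ⌈F⌉₊ + ⌈1 / T.ε⌉₊ := ⟨_, rfl⟩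
  set D := 22 * N ^ 10 with hD
  have e₁ := Exec.setNat (S := S) σ 11 (.const 0) (.const 0) (.const 0) examplesE
  have hex : examplesE.eval σ = T.n := hE.n
  rw [hex] at e₁
  simp only [NExp.eval] at e₁
  set σ₁ := σ.writeNat 11 0 0 0 T.n with h₁
  have b₁ : σ₁.nat 11 0 0 0 = T.n := by simp [h₁, Mem.writeNat]
  have E₁ : T.Encoded σ₁ := hE.frame (fun a ha => Mem.writeNat_nat_of_ne _ (by omega) _ _ _ _)
    fun a _ => rfl
  obtain ⟨σ₂, t₂, e₂, E₂, b₂, ht₂⟩ := exec_thenRebound S (c := sizeProg) (by decide) (by decide)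
    (by decide) (by decide) E₁ (sizeProg_spec E₁ b₁.ge)
  obtain ⟨σ₃, t₃, e₃, E₃, b₃, ht₃⟩ := exec_thenRebound S (c := squareProg) (by decide)
    (by decide) (by decide) (by decide) E₂ (squareProg_spec σ₂ b₂)
  obtain ⟨σ₄, t₄, e₄, E₄, b₄, ht₄⟩ := exec_thenRebound S (c := squareProg) (by decide)
    (by decide) (by decide) (by decide) E₃ (squareProg_spec σ₃ b₃)
  have hB : T.size ^ 4 < σ₄.nat 11 0 0 0 := by
    rw [b₄]
    have : T.size ^ 4 ≤ (T.size ^ 2 + 1) ^ 2 := by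
      calc T.size ^ 4 = (T.size ^ 2) ^ 2 := by ring
        _ ≤ _ := Nat.pow_le_pow_left (Nat.le_succ _) 2
    omega
  obtain ⟨t₅, e₅, ht₅⟩ := exec_compile S (c := prepProg) (by decide) (by decide) σ₄
  have b₅ : (prepProg.run σ₄).nat 11 = σ₄.nat 11 :=
    (frame_run prepProg σ₄).nat 11 (by decide)
  obtain ⟨u, K, τ, t, qs, he, hu0, hu, hgu, hwu, hlen, hqs, ht⟩ :=
    (prepProg_spec E₄ hB).loop S D D (by simp) fun u K h0 h =>
      Training.iterations_le_poly hF hN ⟨h0, h⟩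
  have hK : K ≤ D := Training.iterations_le_poly hF hN ⟨hu0, hu⟩
  refine ⟨u, K, τ, _, qs, e₁.seq (e₂.seq (e₃.seq (e₄.seq (e₅.seq he)))), ⟨hu0, hu⟩, hgu, hwu,
    hlen, hqs, ?_⟩
  rintro _ rfl
  rw [← hN]
  have hs3 := T.three_le_size
  have hsN : T.size ≤ N := by omega
  have hN3 : 3 ≤ N := by omega
  have hc' := hc N (by omega)
  obtain ⟨k, hk⟩ : ∃ k, k = 300 + k₁ + 2 * k₂ + k₃ + k₄ := ⟨_, rfl⟩
  -- `X` dominates `D + 1`, the dimension plus one, and every loop bound plus two. The bounded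
  -- programs get the exponent `k - 1`, which leaves one factor `X` for the number of iterations.
  obtain ⟨X, hX⟩ : ∃ X, X = N ^ 13 + 3 := ⟨_, rfl⟩
  rw [← hk, ← hX] at hc'
  have hDX : D + 1 ≤ X := by
    have : 3 ^ 3 * N ^ 10 ≤ N ^ 13 :=
      (Nat.mul_le_mul_right _ (Nat.pow_le_pow_left hN3 3)).trans_eq (pow_add N 3 10).symm
    omega
  have hN4 : N ^ 2 * 9 ≤ N ^ 4 := by
    have := Nat.mul_le_mul_left (N ^ 2) (Nat.pow_le_pow_left hN3 2)
    rwa [← pow_add] at this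
  have hN13 : N ^ 4 * 9 ≤ N ^ 13 := by
    have h1 := Nat.mul_le_mul_left (N ^ 4) (Nat.pow_le_pow_left hN3 2)
    rw [← pow_add] at h1
    exact h1.trans (Nat.pow_le_pow_right (by omega) (by decide))
  have hNN : N ≤ N ^ 2 := Nat.le_self_pow (by decide) N
  have hs2 : T.size ^ 2 ≤ N ^ 2 := Nat.pow_le_pow_left hsN 2
  have hs4 : T.size ^ 4 ≤ N ^ 4 := Nat.pow_le_pow_left hsN 4
  have hbX : σ₄.nat 11 0 0 0 + 2 ≤ X := by
    rw [b₄]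
    have : (T.size ^ 2 + 1) ^ 2 = T.size ^ 4 + 2 * T.size ^ 2 + 1 := by ring
    omega
  have hdX : dim T.L T.p T.q + 1 ≤ X := by
    have := T.dim_lt
    omega
  have hX1 : 1 ≤ X := by omega
  have tb : ∀ {c : BProg} {k' B : ℕ}, (∀ B, c.timeBound B ≤ k' * (B + 2) ^ k') → B + 2 ≤ X →
      k' + 2 ≤ k → c.timeBound B ≤ k' * X ^ (k - 1) := fun h hB hk' =>
    (h _).trans (Nat.mul_le_mul_left _
      ((Nat.pow_le_pow_left hB _).trans (Nat.pow_le_pow_right hX1 (by omega))))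
  have q₂ : t₂ ≤ k₁ * X ^ (k - 1) + 20 := by
    have := tb (B := σ₁.nat 11 0 0 0) hk₁ (by
      rw [b₁]
      have := T.le_size.1
      omega) (by omega)
    omega
  have q₃ : t₃ ≤ k₂ * X ^ (k - 1) + 20 := by
    have := tb (B := σ₂.nat 11 0 0 0) hk₂ (by rw [b₂]; omega) (by omega)
    omega
  have q₄ : t₄ ≤ k₂ * X ^ (k - 1) + 20 := by
    have := tb (B := σ₃.nat 11 0 0 0) hk₂ (by rw [b₃]; omega) (by omega)
    omega
  have q₅ : t₅ ≤ k₃ * X ^ (k - 1) := ht₅.trans (tb hk₃ hbX (by omega))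
  have q₆ := tb (B := σ₄.nat 11 0 0 0) hk₄ hbX (by omega)
  have hXk : X * X ^ (k - 1) = X ^ k := by
    rw [mul_comm, ← pow_succ]
    congr 1
    omega
  have hpow : X ^ (k - 1) ≤ X ^ k := Nat.pow_le_pow_right hX1 (by omega)
  have hpow1 : 1 ≤ X ^ (k - 1) := Nat.one_le_pow _ _ hX1
  have hpow2 : X * X ≤ X ^ (k - 1) := by
    calc X * X = X ^ 2 := (sq X).symm
      _ ≤ _ := Nat.pow_le_pow_right hX1 (by omega)
  have q₇ : K * (20 + (D + 1) * (dim T.L T.p T.q + 1) +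
      bodyProg.timeBound ((prepProg.run σ₄).nat 11 0 0 0)) ≤ (21 + k₄) * X ^ k := by
    rw [b₅, ← hXk, mul_left_comm]
    have h1 : (D + 1) * (dim T.L T.p T.q + 1) ≤ X * X := Nat.mul_le_mul hDX hdX
    refine Nat.mul_le_mul (hK.trans ((Nat.le_succ D).trans hDX)) ?_
    rw [add_mul 21 k₄]
    refine Nat.add_le_add ?_ q₆
    have h2 := h1.trans hpow2
    clear * - h2 hpow1
    omega
  have up : ∀ m, m * X ^ (k - 1) ≤ m * X ^ k := fun m => Nat.mul_le_mul_left m hpow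
  have hsum : k * X ^ k = 300 * X ^ k + k₁ * X ^ k + 2 * (k₂ * X ^ k) + k₃ * X ^ k +
      k₄ * X ^ k := by
    rw [hk]
    ring
  rw [hsum] at hc'
  rw [add_mul 21 k₄] at q₇
  have total : 1 + (1 + (NExp.const 0).time + (NExp.const 0).time + (NExp.const 0).time +
      examplesE.time) + (1 + t₂ + (1 + t₃ + (1 + t₄ + (1 + t₅ + t)))) ≤
      c * N ^ c + (qs.map S.cost).sum := by
    have hY : 1 ≤ X ^ k := hpow1.trans hpow
    have r₂ := q₂.trans (Nat.add_le_add_right (up k₁) 20)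
    have r₃ := q₃.trans (Nat.add_le_add_right (up k₂) 20)
    have r₄ := q₄.trans (Nat.add_le_add_right (up k₂) 20)
    have r₅ := q₅.trans (up k₃)
    have r₆ := ht.trans (Nat.add_le_add_right (Nat.add_le_add_right q₇ 20) _)
    simp only [NExp.time]
    clear * - hc' hY r₂ r₃ r₄ r₅ r₆
    omega
  have pc : c * N ^ c ≤ c * N ^ (c + 22) :=
    Nat.mul_le_mul_left c (Nat.pow_le_pow_right (by omega) (by omega))
  have pD : D ≤ 22 * N ^ (c + 22) :=
    Nat.mul_le_mul_left 22 (Nat.pow_le_pow_right (by omega) (by omega))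
  have psum : (c + 22) * N ^ (c + 22) = c * N ^ (c + 22) + 22 * N ^ (c + 22) := add_mul _ _ _
  refine ⟨by omega, by omega, fun B hBq => total.trans ?_⟩
  have hcost : (qs.map S.cost).sum ≤ D * B := by
    have h1 := List.sum_le_card_nsmul (qs.map S.cost) B (by simpa using hBq)
    rw [List.length_map, hlen, smul_eq_mul] at h1
    exact h1.trans (Nat.mul_le_mul_right B hK)
  calc c * N ^ c + (qs.map S.cost).sum ≤ c * N ^ c + D * B := by omega
    _ ≤ c * N ^ (c + 22) * (B + 1) + 22 * N ^ (c + 22) * (B + 1) :=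
        Nat.add_le_add (pc.trans (Nat.le_mul_of_pos_right _ (Nat.succ_pos B)))
          (Nat.mul_le_mul pD (Nat.le_succ B))
    _ = (c + 22) * N ^ (c + 22) * (B + 1) := by rw [psum, add_mul]

end SSVM

end

theorem theorem2 :
    -- The loop: it never gets stuck, and the number of iterations obeys the cutting-plane bound.
    (∀ T : SSVM.Training,
      (∀ s : T.State, T.Guard s → ∃ s', T.Step s s') ∧
      ∀ R : ℝ,
        (∀ (i : Fin T.n) (y : (T.ex i).Lab),
          ∑ j, ((T.ex i).psi (T.ex i).truth j - (T.ex i).psi y j) ^ 2 ≤ R ^ 2) →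
        T.ε ≤ 4 * R ^ 2 * T.C →
        ∀ (s : ℕ → T.State) (K : ℕ), T.IsRun s K →
          K ≤ ⌈Real.logb 2 ((T.ρ * T.L / 2) / (4 * R ^ 2 * T.C))⌉₊ + ⌈16 * R ^ 2 * T.C / T.ε⌉₊) ∧
    -- The separation oracle: a submodular binary energy minimization.
    (∀ (T : SSVM.Training) (i : Fin T.n) (w : T.Weight), (∀ j ∈ T.P, 0 ≤ w j) →
      ((T.ex i).binaryEnergy T.ρ w).Submodular ∧
      ∀ y : (T.ex i).Lab, ((T.ex i).binaryEnergy T.ρ w).energy y = -(T.ex i).augScore T.ρ w y) ∧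
    -- One program computes it exactly in polynomially many steps, without the solver.
    (∃ (oracle : SSVM.Prog) (c : ℕ), ∀ (S : SSVM.QPSolver) (T : SSVM.Training) (i : Fin T.n)
        (w : T.Weight) (σ : SSVM.Mem),
      (∀ j ∈ T.P, 0 ≤ w j) → T.Encoded σ → T.HoldsWeight σ w → σ.nat 9 0 0 0 = i →
      ∃ (y : (T.ex i).Lab) (σ' : SSVM.Mem) (t : ℕ),
        SSVM.Exec S oracle σ σ' t [] ∧ t ≤ c * (T.ex i).size ^ c ∧
        (T.ex i).IsOracle T.ρ w y ∧
        ∀ (u : Fin (T.ex i).nV) (k : Fin T.L), σ'.nat 10 u k 0 = if y (u, k) then 1 else 0) ∧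
    -- One program executes the whole algorithm in polynomial time.
    (∃ (algorithm : SSVM.Prog) (c : ℕ), ∀ (S : SSVM.QPSolver) (T : SSVM.Training) (F : ℝ)
        (σ : SSVM.Mem),
      T.FeatBound F → T.Encoded σ →
      ∃ (s : ℕ → T.State) (K : ℕ) (σ' : SSVM.Mem) (t : ℕ) (qs : List SSVM.QP),
        SSVM.Exec S algorithm σ σ' t qs ∧
        T.IsRun s K ∧ ¬ T.Guard (s K) ∧ T.HoldsWeight σ' (s K).w ∧
        -- the solver is called once in each iteration, on the program of that iteration
        qs.length = K ∧
        (∀ k < K, ∃ l : List T.Tuple, l.Nodup ∧ {y | y ∈ l} = (s k).W ∧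
          qs[k]? = some (T.toQP l)) ∧
        ∀ N : ℕ, N = T.size + ⌈T.C⌉₊ + ⌈T.ρ⌉₊ + ⌈F⌉₊ + ⌈1 / T.ε⌉₊ →
          K ≤ c * N ^ c ∧
          t ≤ c * N ^ c + (qs.map S.cost).sum ∧
          ∀ B : ℕ, (∀ Q ∈ qs, S.cost Q ≤ B) → t ≤ c * N ^ c * (B + 1)) := by
  obtain ⟨c, hc⟩ := SSVM.oracleMain_spec
  obtain ⟨c', hc'⟩ := SSVM.algorithmMain_spec
  exact ⟨fun T => ⟨SSVM.Training.exists_step, fun R hR hε s K hs =>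
      SSVM.Training.iterations_le hR hε s K hs⟩,
    fun T i w hw => ⟨(T.ex i).binaryEnergy_submodular T.ρ w fun j => hw _ (T.pairwise_mem j),
      (T.ex i).binaryEnergy_energy T.ρ w⟩,
    ⟨SSVM.oracleMain, c, hc⟩, ⟨SSVM.algorithmMain, c', hc'⟩⟩
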